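/- **Setting.** Let $S=(s_1,\dots,s_n)$ be a sign string with $n_++2n_-=3\ell$ and let $J=(j_1,\dots,j_n)$ be a state string, $j_p\in\{1,0,-1\}$. *Webs.* An $\mathfrak{sl}_3$-web with boundary $S$ is a planar oriented trivalent graph in a half plane below a horizontal cut line, all of whose trivalent vertices are sources or sinks, with $n$ univalent ends on the cut line; the $p$-th boundary edge points upwards if $s_p=+$ and downwards if $s_p=-$. It is non-elliptic if it has no circle components and no internal face that is a digon or a square. A flow is an oriented subgraph that contains exactly two of the three edges at each trivalent vertex, one directed into and one out of the vertex; it extends $J$ if at the $p$-th boundary edge it points down, is absent, or points up for $j_p=1,0,-1$. Let $B_S^J$ be the set of pairs $u_f$ of a non-elliptic web $u$ with boundary $S$ and a flow $f$ on $u$ extending $J$, up to isotopies that fix the boundary. *Ladder webs.* A string $w=F_{i_k}^{(j_k)}\cdots F_{i_1}^{(j_1)}$ is drawn on $n$ vertical posts, labelled at the bottom by $(3^\ell,0^{n-\ell})$; the factor $F_i^{(j)}$ is a rung of thickness $j$ from post $i$ to post $i+1$, which lowers the label of post $i$ and raises that of post $i+1$ by $j$. All labels have to lie in $\{0,1,2,3\}$.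 Edges labelled $0$ or $3$ are erased, edges labelled $1$ are oriented up or to the right, edges labelled $2$ down or to the left. Let $W_S^J$ be the set of all ladder webs with a flow and with boundary $(S,J)$, where isotopies are not divided out and elliptic webs are allowed. For bookkeeping, rungs of thickness $0$ are permitted in elements of $W_S^J$. The string $w$, with all $j_r\ge 1$, presents a non-elliptic web $u$ if its ladder web is isotopic to $u$. *Tableaux.* Give an upward edge (label $1$) of state $1,0,-1$ the colour set $\{1\},\{2\},\{3\}$, a downward edge (label $2$) of state $1,0,-1$ the colour set $\{1,2\},\{1,3\},\{2,3\}$, and edges labelled $0$ and $3$ the colour sets $\emptyset$ and $\{1,2,3\}$. Let column $c$ consist of those $p\in\{1,\dots,n\}$ for which the $p$-th boundary edge has colour $c$, in increasing order $t^c_1<t^c_2<\cdots$. If all three columns have length $\ell$, let $\vec\lambda=(\lambda^1,\lambda^2,\lambda^3)$ with $\lambda^c=(t^c_\ell-\ell,\dots,t^c_1-1)$. The node in row $r$ and column $s$ has residue $s-r+m$, where $m$ is the maximal number of non-zero parts of a component. Let $\mathrm{Std}(\vec\lambda)$ be the set of fillings of $\vec\lambda$ by positive integers that increase strictly along rows and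 columns, where a number may occur repeatedly only in different components and at nodes of equal residue. *The map $\iota$.* Let $u_f\in B_S^J$ and let $w$ present $u$. Draw $u_f$ as the ladder web of $w$. Start with the empty filling; in step $r$, with factor $F_{i_r}^{(j_r)}$, add the number $r$ to each component $c$ whose colour leaves post $i_r$ at this step, at the highest node of $\vec\lambda$ of residue $i_r$ that has no entry and all of whose left and upper neighbours have one. The result is $\iota(u_f)=\iota_w(u_f)$. *The extended growth algorithm $\mathrm g$.* For $\vec T\in\mathrm{Std}(\vec\lambda)$ with maximal entry $k$ and $0\le j\le k$, let $\vec k^j_c=(|T^c_j|_1,|T^c_j|_2-1,|T^c_j|_3-2,\dots)$, where $|T^c_j|_r$ is the number of entries $\le j$ in row $r$ of $T^c$. Let $\Lambda^j_l\in\{\circ,1,0,-1,1^*,0^*,-1^*,\times\}$ be the symbol given by the set of those $c$ for which $l$ is an entry of $\vec k^j_c$: $\circ$ for $\emptyset$, $1,0,-1$ for $\{1\},\{2\},\{3\}$, $1^*,0^*,-1^*$ for $\{1,2\},\{1,3\},\{2,3\}$, and $\times$ for $\{1,2,3\}$. Then $\mathrm g(\vec T)$ is the ladder web with flow obtained by connecting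 the entries of the tower $(\Lambda^j)_{0\le j\le k}$, where post $p$ is put at position $l=p-\ell$, the symbols $\circ,j,j^*,\times$ stand for the labels $0,1,2,3$ and for the states of the edges, and between two consecutive levels there is one rung, whose thickness and state are what its left post loses. **Theorem.** 1. The extended growth algorithm is well-defined: if the three columns given by $(S,J)$ have length $\ell$, then for every $\vec T\in\mathrm{Std}(\vec\lambda)$ the above construction gives an element $\mathrm g(\vec T)$ of $W_S^J$ whose levels are the diagrams $\Lambda^j$ (and $\Lambda^j_l=\times$ for $l\le-\ell$, $\Lambda^j_l=\circ$ for $l>n-\ell$). 2. Every non-elliptic web with boundary $S$ is presented by some string of divided powers $F_i^{(j)}$. 3. For every $u_f\in B_S^J$ and every string $w$ presenting $u$, the three columns given by $(S,J)$ have length $\ell$, $\iota_w(u_f)$ is well-defined (each step can be carried out, and the result is unique) and lies in $\mathrm{Std}(\vec\lambda)$, and $\mathrm g(\iota_w(u_f))=u_f$, drawn as the ladder web of $w$. So every non-elliptic web with every flow is obtained from the extended growth algorithm. Moreover, $\iota_w(u_f)$ is the only element of $\mathrm{Std}(\vec\lambda)$ that $\mathrm g$ sends to $u_f$ drawn as the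 ladder web of $w$. 4. $\iota$ is an injection: for $u_f,v_{f'}\in B_S^J$ and strings $w,w'$ presenting $u$ and $v$, if $\iota_w(u_f)=\iota_{w'}(v_{f'})$ then $u_f=v_{f'}$ and $w=w'$; and if $u_f=v_{f'}$ and $w=w'$ then $\iota_w(u_f)=\iota_{w'}(v_{f'})$. -/

import Mathlib

/-! ## Abstract webs and flows -/

/-- The signs of a sign string. -/
inductive WebSign
  | plus
  | minus
  deriving DecidableEq

/-- An `𝔰𝔩₃`-web without circle components in a half plane with `n` boundary points on the
horizontal cut line above it, up to planar isotopy, as a combinatorial map.  A dart is an edge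
together with one of its two ends.  The cut line is collapsed to one *root vertex*, whose darts are
`bd 0, …, bd (n-1)`, the boundary points read from left to right (this is the counterclockwise
order around the root).  All other vertices are trivalent. -/
structure Web (n : ℕ) where
  Dart : Type
  [fin : Finite Dart]
  /-- the next dart counterclockwise around the vertex at which a dart is based -/
  rot : Equiv.Perm Dart
  /-- the other dart of the same edge -/
  opp : Equiv.Perm Dart
  opp_opp : ∀ d, opp (opp d) = d
  opp_ne : ∀ d, opp d ≠ d
  bd : Fin n → Dart
  bd_injective : Function.Injective bd
  rot_bd : ∀ p, rot (bd p) = bd (finRotate n p)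
  trivalent : ∀ d, d ∉ Set.range bd → rot (rot (rot d)) = d ∧ rot d ≠ d
  /-- `out d` says that the edge of `d` is oriented away from the base of `d` -/
  out : Dart → Bool
  out_opp : ∀ d, out (opp d) = !(out d)
  /-- every trivalent vertex is a source or a sink -/
  out_rot : ∀ d, d ∉ Set.range bd → out (rot d) = out d
  /-- every connected component is planar: `V - E + F = 2 C` -/
  planar :
    Nat.card (MulAction.orbitRel.Quotient (Subgroup.zpowers rot) Dart) +
      Nat.card (MulAction.orbitRel.Quotient (Subgroup.zpowers (rot⁻¹ * opp)) Dart) =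
    Nat.card (MulAction.orbitRel.Quotient (Subgroup.zpowers opp) Dart) +
      2 * Nat.card (MulAction.orbitRel.Quotient
        (Subgroup.closure ({rot, opp} : Set (Equiv.Perm Dart))) Dart)

namespace Web

variable {n : ℕ} (u : Web n)

/-- The permutation whose orbits are the faces (the face of `d` lies to the left of `d`). -/
def face : Equiv.Perm u.Dart := u.rot⁻¹ * u.opp

/-- No internal face (one that does not touch the cut line) is a digon or a square. -/
def NonElliptic : Prop :=
  ∀ d : u.Dart, (∀ k : ℕ, (u.face ^ k) d ∉ Set.range u.bd) →
    (u.face ^ 2) d ≠ d ∧ (u.face ^ 4) d ≠ d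

/-- The boundary is `S`: edges oriented upwards into the cut line are `+`. -/
def HasBoundary (S : Fin n → WebSign) : Prop :=
  ∀ p, u.out (u.bd p) = false ↔ S p = WebSign.plus

/-- A flow: `f d` is `1` (or `-1`) if a flow line runs through the edge of `d` away from (or
towards) the base of `d`, and `0` if there is none.  At a trivalent vertex the three values are
pairwise different, that is, one flow line comes in along one edge and leaves along another. -/
def IsFlow (f : u.Dart → SignType) : Prop :=
  (∀ d, f (u.opp d) = -f d) ∧ ∀ d, d ∉ Set.range u.bd → f (u.rot d) ≠ f d

end Web

/-- The set `B_S^J`: non-elliptic webs with boundary `S` and a flow that extends `J`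
(the state is `1` if the flow line is oriented downwards, that is, away from the cut line). -/
structure BasisWebWithFlow (n : ℕ) (S : Fin n → WebSign) (J : Fin n → SignType) where
  web : Web n
  nonElliptic : web.NonElliptic
  hasBoundary : web.HasBoundary S
  flow : web.Dart → SignType
  isFlow : web.IsFlow flow
  extends_state : ∀ p, flow (web.bd p) = J p

/-- Two webs with flow agree up to an isotopy that fixes the boundary. -/
def BasisWebWithFlow.Isotopic {n : ℕ} {S : Fin n → WebSign} {J : Fin n → SignType}
    (x y : BasisWebWithFlow n S J) : Prop :=
  ∃ e : x.web.Dart ≃ y.web.Dart,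
    (∀ d, e (x.web.rot d) = y.web.rot (e d)) ∧
    (∀ d, e (x.web.opp d) = y.web.opp (e d)) ∧
    (∀ p, e (x.web.bd p) = y.web.bd p) ∧
    (∀ d, y.web.out (e d) = x.web.out d) ∧
    ∀ d, y.flow (e d) = x.flow d

/-! ## Ladder webs: strings of divided powers applied to the highest weight vector -/

/-- Darts of a ladder diagram.  `vert p k b` belongs to the segment of post `p` directly above the
`k`-th rung level (`b = false`: its lower end, `b = true`: its upper end), `rung k b` to the `k`-th
rung (`b = false`: its left end, `b = true`: its right end). -/
inductive LDart
  | vert (p k : ℕ) (b : Bool)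
  | rung (k : ℕ) (b : Bool)
  deriving DecidableEq

namespace LDart

/-- The other dart of the same segment or rung. -/
def opp : LDart → LDart
  | vert p k b => vert p k (!b)
  | rung k b => rung k (!b)

end LDart

/-- A string of divided powers, read from bottom to top: the pair `(i, j)` stands for `F_i^{(j)}`,
a rung of thickness `j` from post `i` to post `i + 1`. -/
abbrev FString := List (ℕ × ℕ)

namespace FString

/-- The label of post `p` (posts are numbered from `1`) after the first `k` steps, starting with
the highest weight `(3, …, 3, 0, …, 0)` with `ℓ` entries `3`. -/
def label (ℓ : ℕ) (w : FString) (k : ℕ) : ℕ → ℤ :=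
  (w.take k).foldl
    (fun a s p => if p = s.1 then a p - s.2 else if p = s.1 + 1 then a p + s.2 else a p)
    (fun p => if 1 ≤ p ∧ p ≤ ℓ then 3 else 0)

/-- The `k`-th step, `k = 1, 2, …`. -/
def step (w : FString) (k : ℕ) : ℕ × ℕ := w.getD (k - 1) (0, 0)

/-- The string does not kill the highest weight vector: all rungs of positive thickness lie between
two of the `n` posts, and all labels stay between `0` and `3`. -/
def Valid (n ℓ : ℕ) (w : FString) : Prop :=
  (∀ s ∈ w, s.2 = 0 ∨ (1 ≤ s.1 ∧ s.1 + 1 ≤ n)) ∧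
    ∀ k p : ℕ, 0 ≤ label ℓ w k p ∧ label ℓ w k p ≤ 3

/-- The label (thickness) of the segment or rung of a dart. -/
def dartLabel (ℓ : ℕ) (w : FString) : LDart → ℤ
  | .vert p k _ => label ℓ w k p
  | .rung k _ => (step w k).2

/-- The darts that are really there: segments and rungs labelled `0` or `3` are erased. -/
def present (n ℓ : ℕ) (w : FString) (d : LDart) : Bool :=
  (match d with
    | .vert p k _ => decide (1 ≤ p ∧ p ≤ n ∧ k ≤ w.length)
    | .rung k _ => decide (1 ≤ k ∧ k ≤ w.length)) &&
  decide (dartLabel ℓ w d = 1 ∨ dartLabel ℓ w d = 2)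

/-- The vertex at which a dart is based: `some (p, k)` is the point of post `p` on the `k`-th rung
level, `none` is the cut line on top. -/
def base (w : FString) : LDart → Option (ℕ × ℕ)
  | .vert p k false => some (p, k)
  | .vert p k true => if k = w.length then none else some (p, k + 1)
  | .rung k false => some ((step w k).1, k)
  | .rung k true => some ((step w k).1 + 1, k)

/-- The darts based at a vertex in counterclockwise order: up, left, down, right at a point of a
post; from left to right along the cut line. -/
def star (n ℓ : ℕ) (w : FString) : Option (ℕ × ℕ) → List LDart
  | none => ((List.range n).map fun p => LDart.vert (p + 1) w.length true).filter
      fun d => present n ℓ w d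
  | some (p, k) =>
      [LDart.vert p k false, LDart.rung k true, LDart.vert p (k - 1) true, LDart.rung k false].filter
        fun d => present n ℓ w d && decide (base w d = some (p, k))

/-- The next dart counterclockwise around the base. -/
def next (n ℓ : ℕ) (w : FString) (d : LDart) : LDart := (star n ℓ w (base w d)).formPerm d

/-- The base of `d` is a point in the interior of an edge (or in a circle) of the web. -/
def Smooth (n ℓ : ℕ) (w : FString) (d : LDart) : Prop :=
  base w d ≠ none ∧ (star n ℓ w (base w d)).length = 2

/-- The base of `d` is a trivalent vertex or lies on the cut line. -/
def IsVertex (n ℓ : ℕ) (w : FString) (d : LDart) : Prop :=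
  base w d = none ∨ (star n ℓ w (base w d)).length = 3

/-- Edges labelled `1` are oriented upwards or to the right, edges labelled `2` downwards or to the
left.  `out` says that the edge is oriented away from the base of the dart. -/
def out (ℓ : ℕ) (w : FString) (d : LDart) : Bool :=
  match d with
  | .vert _ _ b => xor b (decide (dartLabel ℓ w d = 1))
  | .rung _ b => xor b (decide (dartLabel ℓ w d = 1))

/-- `Strand x y`: starting with the dart `x` and running through smooth points only, one traverses
the segment or rung of `y` towards the base of `y`. -/
inductive Strand (n ℓ : ℕ) (w : FString) : LDart → LDart → Prop
  | edge (x : LDart) : Strand n ℓ w x x.opp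
  | cont {x y : LDart} (h : Strand n ℓ w x y) (hy : Smooth n ℓ w y) :
      Strand n ℓ w x (next n ℓ w y).opp

/-- A flow on a ladder web, with the conventions of `Web.IsFlow`. -/
def IsFlow (n ℓ : ℕ) (w : FString) (φ : LDart → SignType) : Prop :=
  ∀ d, present n ℓ w d = true →
    φ d.opp = -φ d ∧
    (Smooth n ℓ w d → φ (next n ℓ w d) = -φ d) ∧
    (base w d ≠ none → (star n ℓ w (base w d)).length = 3 → φ (next n ℓ w d) ≠ φ d)

/-- `e` identifies `u` with the web drawn by the string `w`. -/
structure IsDrawing {n : ℕ} (ℓ : ℕ) (w : FString) (u : Web n) (e : u.Dart → LDart) : Prop where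
  valid : Valid n ℓ w
  injective : Function.Injective e
  range : ∀ x, x ∈ Set.range e ↔ present n ℓ w x = true ∧ IsVertex n ℓ w x
  bd : ∀ p : Fin n, e (u.bd p) = LDart.vert (p + 1) w.length true
  rot : ∀ d, e (u.rot d) = next n ℓ w (e d)
  opp : ∀ d, Strand n ℓ w (e d) (e (u.opp d))
  noCircle : ∀ x, present n ℓ w x = true →
    ∃ d y, Strand n ℓ w (e d) y ∧ (x = y ∨ x = y.opp)
  out : ∀ d, u.out d = out ℓ w (e d)

/-- `w` is a string of divided powers whose value on the highest weight vector is the web `u`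
(up to isotopy). -/
def Presents {n : ℕ} (ℓ : ℕ) (w : FString) (u : Web n) : Prop :=
  (∀ s ∈ w, 1 ≤ s.2) ∧ ∃ e, IsDrawing ℓ w u e

end FString

/-- A ladder diagram together with a candidate for a flow on it. -/
structure LadderWeb where
  word : FString
  flow : LDart → SignType

namespace LadderWeb

/-- The set `W_S^J` of all webs with flow and boundary `(S, J)`, drawn as ladder diagrams on the
grid (isotopies are not divided out, and the web may be elliptic). -/
structure IsWebWithFlow {n : ℕ} (ℓ : ℕ) (S : Fin n → WebSign) (J : Fin n → SignType)
    (L : LadderWeb) : Prop where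
  valid : L.word.Valid n ℓ
  isFlow : L.word.IsFlow n ℓ L.flow
  sign : ∀ p : Fin n, L.word.label ℓ L.word.length (p + 1) =
    match S p with
    | .plus => 1
    | .minus => 2
  state : ∀ p : Fin n, L.flow (LDart.vert (p + 1) L.word.length true) = J p

/-- The ladder web with flow `L` is the web with flow `x`, up to isotopy. -/
def Draws {n : ℕ} (ℓ : ℕ) {S : Fin n → WebSign} {J : Fin n → SignType}
    (L : LadderWeb) (x : BasisWebWithFlow n S J) : Prop :=
  L.word.IsFlow n ℓ L.flow ∧
    ∃ e, L.word.IsDrawing ℓ x.web e ∧ ∀ d, L.flow (e d) = x.flow d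

end LadderWeb

/-! ## From boundary data to `3`-multipartitions -/

/-- `n₊ + 2 n₋`. -/
def signWeight {n : ℕ} (S : Fin n → WebSign) : ℕ :=
  ∑ p, match S p with
    | .plus => 1
    | .minus => 2

/-- The columns that contain a number of the given sign and state: for the sign `+` the column
`1, 2, 3` for the state `1, 0, -1`, for the sign `-` the columns `12, 13, 23`. -/
def stateColumns : WebSign → SignType → Finset (Fin 3)
  | .plus, .pos => {0}
  | .plus, .zero => {1}
  | .plus, .neg => {2}
  | .minus, .pos => {0, 1}
  | .minus, .zero => {0, 2}
  | .minus, .neg => {1, 2}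

/-- Column `c` (from top to bottom) of the column-strict tableau of `(S, J)`. -/
def column {n : ℕ} (S : Fin n → WebSign) (J : Fin n → SignType) (c : Fin 3) : List ℕ :=
  ((List.finRange n).filter fun p => decide (c ∈ stateColumns (S p) (J p))).map
    fun p => (p : ℕ) + 1

/-- The tableau of `(S, J)` has shape `(3^ℓ)`. -/
def HasTableau {n : ℕ} (ℓ : ℕ) (S : Fin n → WebSign) (J : Fin n → SignType) : Prop :=
  ∀ c, (column S J c).length = ℓ

/-- The `3`-multipartition of `(S, J)`: subtract from each entry of the tableau its row number and
read the columns from bottom to top.  `shape ℓ S J c r` is the length of row `r = 0, 1, …` of the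
component `c = 0, 1, 2`. -/
def shape {n : ℕ} (ℓ : ℕ) (S : Fin n → WebSign) (J : Fin n → SignType) (c : Fin 3) (r : ℕ) : ℕ :=
  if r < ℓ then (column S J c).getD (ℓ - 1 - r) 0 - (ℓ - r) else 0

/-! ## `3`-multitableaux -/

/-- A (partial) filling: `T c r s` is the number in row `r` and column `s` (both counted from `0`)
of the component `c`, and `0` stands for "no entry". -/
abbrev MultiFilling := Fin 3 → ℕ → ℕ → ℕ

/-- The shift of the residues: the maximal number of non-zero parts of a component. -/
noncomputable def residueShift (lam : Fin 3 → ℕ → ℕ) : ℕ :=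
  Finset.univ.sup fun c => {r : ℕ | lam c r ≠ 0}.ncard

/-- The residue of the node in row `r` and column `s`. -/
noncomputable def residue (lam : Fin 3 → ℕ → ℕ) (r s : ℕ) : ℤ := (s : ℤ) - r + residueShift lam

/-- Standard fillings with positive numbers: strictly increasing along rows and columns; a number
may be repeated, but only in different components and at nodes of the same residue. -/
structure IsStandard (lam : Fin 3 → ℕ → ℕ) (T : MultiFilling) : Prop where
  support : ∀ c r s, T c r s ≠ 0 ↔ s < lam c r
  row : ∀ c r s s', s < s' → s' < lam c r → T c r s < T c r s'
  col : ∀ c r r' s, r < r' → s < lam c r' → T c r s < T c r' s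
  component : ∀ c r s r' s', s < lam c r → s' < lam c r' → T c r s = T c r' s' → r = r' ∧ s = s'
  residue_eq : ∀ c r s c' r' s', s < lam c r → s' < lam c' r' → T c r s = T c' r' s' →
    residue lam r s = residue lam r' s'

/-! ## The map from webs with flow to tableaux -/

/-- The node in row `r` and column `s` of component `c` has no entry yet, has residue `i`, and may
be filled next. -/
def IsFree (lam : Fin 3 → ℕ → ℕ) (T : MultiFilling) (c : Fin 3) (i : ℤ) (r s : ℕ) : Prop :=
  s < lam c r ∧ T c r s = 0 ∧ (r = 0 ∨ T c (r - 1) s ≠ 0) ∧ (s = 0 ∨ T c r (s - 1) ≠ 0) ∧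
    residue lam r s = i

/-- `T'` arises from `T` by adding, in each component that belongs to `M`, the number `k` at the
highest free node of residue `i`. -/
def AddNodes (lam : Fin 3 → ℕ → ℕ) (M : Finset (Fin 3)) (i : ℤ) (k : ℕ) (T T' : MultiFilling) :
    Prop :=
  ∀ c, (c ∉ M → T' c = T c) ∧
    (c ∈ M → ∃ r s, IsFree lam T c i r s ∧ (∀ r' s', IsFree lam T c i r' s' → r ≤ r') ∧
      T' c = fun r' s' => if r' = r ∧ s' = s then k else T c r' s')

namespace LadderWeb

/-- The colors (tableau columns) at the segment of post `p` above the `k`-th rung level: none for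
the label `0`, all for the label `3`, and as prescribed by the flow for `1` and `2`. -/
def colors (ℓ : ℕ) (L : LadderWeb) (k p : ℕ) : Finset (Fin 3) :=
  if L.word.label ℓ k p = 1 then stateColumns .plus (L.flow (LDart.vert p k true))
  else if L.word.label ℓ k p = 2 then stateColumns .minus (L.flow (LDart.vert p k true))
  else if L.word.label ℓ k p = 3 then Finset.univ
  else ∅

/-- The components that receive a node in the `k`-th step `F_i^{(j)}`, read off locally at the
bottom and the top of the step: the colors that leave the post `i`. -/
def moved (ℓ : ℕ) (L : LadderWeb) (k : ℕ) : Finset (Fin 3) :=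
  L.colors ℓ (k - 1) (L.word.step k).1 \ L.colors ℓ k (L.word.step k).1

/-- `T` is obtained from the empty filling by reading the ladder web from bottom to top. -/
def Fills (ℓ : ℕ) (lam : Fin 3 → ℕ → ℕ) (L : LadderWeb) (T : MultiFilling) : Prop :=
  ∃ seq : ℕ → MultiFilling, (seq 0 = fun _ _ _ => 0) ∧
    (∀ k, 1 ≤ k → k ≤ L.word.length →
      AddNodes lam (L.moved ℓ k) (L.word.step k).1 k (seq (k - 1)) (seq k)) ∧
    seq L.word.length = T

end LadderWeb

/-- `T` is the tableau `ι(u_f)`, where the web of `x = u_f` is drawn by means of the string `w` of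
divided powers. -/
def IsIota {n : ℕ} (ℓ : ℕ) {S : Fin n → WebSign} {J : Fin n → SignType} (w : FString)
    (x : BasisWebWithFlow n S J) (T : MultiFilling) : Prop :=
  ∃ φ : LDart → SignType, LadderWeb.Draws ℓ ⟨w, φ⟩ x ∧ LadderWeb.Fills ℓ (shape ℓ S J) ⟨w, φ⟩ T

/-! ## The extended growth algorithm -/

/-- Entries of `𝔰𝔩₃`-weight diagrams: `∘`, `×`, and the states `1, 0, -1` without and with a
marker `*`. -/
inductive WeightSymbol
  | circ
  | plain (j : SignType)
  | starred (j : SignType)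
  | cross

namespace WeightSymbol

/-- The label of the segment of the web at a symbol: `plain` entries are arrows pointing upwards
(label `1`), `starred` entries are arrows pointing downwards (label `2`). -/
def thickness : WeightSymbol → ℕ
  | circ => 0
  | plain _ => 1
  | starred _ => 2
  | cross => 3

/-- The state of the flow. -/
def state : WeightSymbol → SignType
  | plain j => j
  | starred j => j
  | _ => 0

end WeightSymbol

/-- The maximal entry of a filling. -/
noncomputable def maxEntry (T : MultiFilling) : ℕ := sSup {k | ∃ c r s, T c r s = k}

/-- The tuple `k^j_c = (|T_j^c|_1, |T_j^c|_2 - 1, |T_j^c|_3 - 2, …)`, where `|T_j^c|_r` is the number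
of nodes in the `r`-th row of component `c` with entries at most `j`. -/
noncomputable def kTuple (T : MultiFilling) (j : ℕ) (c : Fin 3) (r : ℕ) : ℤ :=
  ({s : ℕ | T c r s ≠ 0 ∧ T c r s ≤ j}.ncard : ℤ) - r

open Classical in
/-- The tower of weight diagrams of a filling. -/
noncomputable def tower (T : MultiFilling) (j : ℕ) (l : ℤ) : WeightSymbol :=
  match decide (l ∈ Set.range (kTuple T j 0)), decide (l ∈ Set.range (kTuple T j 1)),
      decide (l ∈ Set.range (kTuple T j 2)) with
  | true, true, true => .cross
  | true, true, false => .starred 1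
  | true, false, false => .plain 1
  | true, false, true => .starred 0
  | false, true, false => .plain 0
  | false, true, true => .starred (-1)
  | false, false, true => .plain (-1)
  | false, false, false => .circ

/-- The post at which the thickness drops from level `k - 1` to level `k` of a tower; post `p` is
the grid position `p - ℓ`. -/
noncomputable def towerPost (ℓ : ℕ) (D : ℕ → ℤ → WeightSymbol) (k : ℕ) : ℕ :=
  sInf {p : ℕ | (D k (p - ℓ)).thickness < (D (k - 1) (p - ℓ)).thickness}

/-- The ladder web with flow obtained by connecting the entries of a tower with levels `0, …, K`.
The vertical segments carry the thickness and the state of the entries; between two consecutive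
levels there is one rung, whose thickness and state are what its left post loses. -/
noncomputable def connect (ℓ K : ℕ) (D : ℕ → ℤ → WeightSymbol) : LadderWeb where
  word := (List.range K).map fun k =>
    let i := towerPost ℓ D (k + 1)
    (i, (D k (i - ℓ)).thickness - (D (k + 1) (i - ℓ)).thickness)
  flow
    | .vert p k true => (D k (p - ℓ)).state
    | .vert p k false => -(D k (p - ℓ)).state
    | .rung k b =>
        let i := towerPost ℓ D k
        let v : SignType :=
          SignType.sign (((D (k - 1) (i - ℓ)).state : ℤ) - ((D k (i - ℓ)).state : ℤ))
        if b then v else -v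

/-- The extended growth algorithm `g`. -/
noncomputable def growth (ℓ : ℕ) (T : MultiFilling) : LadderWeb :=
  connect ℓ (maxEntry T) (tower T)

/-- The tower of `T` is trivial outside of the `n` posts, and the labels of the web `g(T)` are those
given by the entries of the tower, so that `g(T)` indeed connects all entries of the tower. -/
def ConnectsTower (n ℓ : ℕ) (T : MultiFilling) : Prop :=
  (growth ℓ T).word.length = maxEntry T ∧
  ∀ k, k ≤ maxEntry T →
    (∀ l : ℤ, l ≤ -ℓ → tower T k l = .cross) ∧
    (∀ l : ℤ, (n : ℤ) - ℓ < l → tower T k l = .circ) ∧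
    ∀ p : ℕ, 1 ≤ p → p ≤ n →
      (growth ℓ T).word.label ℓ k p = (tower T k ((p : ℤ) - ℓ)).thickness

/-!
A flow on an `𝔰𝔩₃`-web is the same as a coloring by three colors: an edge with label `a` carries a
set of `a` colors, and at every trivalent vertex the colors of the thick edge are distributed to the
two thin ones.  Along a ladder diagram, a rung from post `i` to post `i + 1` therefore carries some
colors from left to right, and all other colors stay where they are
(`FString.isFlow_iff_conserves`).  Seen at the successive levels, the posts that contain a given
color `c` form a set of `ℓ` beads, which starts with the posts `1, …, ℓ`, and a rung moves a bead
from `i` to `i + 1`.  Read as first column hook lengths, the beads form a partition with at most `ℓ`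
rows, and the move adds a node of residue `i` to it (`FString.Conserves.exists_beadChain`).  So a
flow on a ladder diagram is a chain of `3`-multipartitions, and the beads at the end are the entries
of the three columns of the boundary data, so that the chain ends with the shape
(`LadderWeb.Draws.exists_beadChain`).

Chains of multipartitions of this kind are recorded by standard fillings, whose number `k` marks the
nodes that are added in step `k` (`BeadChain.records`, `Records.isStandard`), and every standard
filling arises in this way (`IsStandard.exists_beadChain`).  The map `ι` writes down the filling of
the chain (`Records.fills`); here the residue of a node determines the row in which it is added.  The
tower of the growth algorithm shows the beads of the chain at every level, so that the algorithm
draws the ladder diagram whose labels, rungs, and colors are those of the beads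
(`growth_label`, `growth_word`, `growth_colorsOf_vert`); it is a web with flow by the conservation of
colors (`growth_isWebWithFlow`).  Applied to the tableau of a web with flow, it returns the original
diagram, and the chain of multipartitions, hence the tableau, can be recovered from the colors
(`exists_isIota`).  The web and its flow are determined by the diagram up to isotopy
(`LadderWeb.Draws.isotopic`).  Conversely, a non-elliptic web can be drawn by a given string in only
one way (`FString.IsDrawing.unique`), because all of its components touch the boundary
(`Web.induction_on_connected`).

It remains to draw every non-elliptic web as a ladder diagram.  The web is built from bottom to top,
that is, a part of the web below a line is cut further down until nothing is left.  By the discrete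
Gauss--Bonnet inequality `Web.IsLowerPart.six_le_sum`, which counts vertices, edges, and faces with
the Euler characteristic and uses that inner faces have at least six sides, some two neighbouring
edges at the line are the ends of an arc, or of two edges with a common vertex, or the legs with
the signs `+`, `-` of an `H` (`Web.IsLowerPart.exists_isCorner`).  Each of these can be cut off without
raising the genus, and it is drawn by one rung on top of the diagram of the remaining part.  Two
further kinds of rungs move edges sideways past erased posts.  The induction runs over the sum of all
products of a post number and its label, which a rung raises
(`FString.IsLabelledPart.exists_drawsLower`, `FString.exists_presents`).
-/

/-! ### Euler characteristics of combinatorial maps -/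

section SetoidCount

variable {D : Type*}

/-- The number of equivalence classes. -/
noncomputable def classCount (r : Setoid D) : ℕ := Nat.card (Quotient r)

/-- The equivalence relation that arises from `r` by merging the classes of `a` and `b`. -/
def glue (r : Setoid D) (a b : D) : Setoid D where
  r x y := r x y ∨ (r x a ∧ r b y) ∨ (r x b ∧ r a y)
  iseqv := by
    refine ⟨fun x => Or.inl (r.refl x), ?_, ?_⟩
    · rintro x y (h | ⟨h, h'⟩ | ⟨h, h'⟩)
      · exact Or.inl (r.symm h)
      · exact Or.inr (Or.inr ⟨r.symm h', r.symm h⟩)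
      · exact Or.inr (Or.inl ⟨r.symm h', r.symm h⟩)
    · rintro x y z (h | ⟨h, h'⟩ | ⟨h, h'⟩) (g | ⟨g, g'⟩ | ⟨g, g'⟩)
      · exact Or.inl (r.trans h g)
      · exact Or.inr (Or.inl ⟨r.trans h g, g'⟩)
      · exact Or.inr (Or.inr ⟨r.trans h g, g'⟩)
      · exact Or.inr (Or.inl ⟨h, r.trans h' g⟩)
      · exact Or.inr (Or.inl ⟨h, g'⟩)
      · exact Or.inl (r.trans h g')
      · exact Or.inr (Or.inr ⟨h, r.trans h' g⟩)
      · exact Or.inl (r.trans h g')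
      · exact Or.inr (Or.inr ⟨h, g'⟩)

theorem le_glue (r : Setoid D) (a b : D) : r ≤ glue r a b := fun _ _ h => Or.inl h

theorem glue_rel (r : Setoid D) (a b : D) : glue r a b a b :=
  Or.inr (Or.inl ⟨r.refl a, r.refl b⟩)

theorem glue_le {r t : Setoid D} {a b : D} (h : r ≤ t) (hab : t a b) : glue r a b ≤ t := by
  rintro x y (g | ⟨g, g'⟩ | ⟨g, g'⟩)
  · exact h g
  · exact t.trans (t.trans (h g) hab) (h g')
  · exact t.trans (t.trans (h g) (t.symm hab)) (h g')

theorem glue_eq_self {r : Setoid D} {a b : D} (h : r a b) : glue r a b = r :=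
  le_antisymm (glue_le le_rfl h) (le_glue r a b)

theorem glue_eq_glue {r t : Setoid D} {a b : D} (h : r ≤ glue t a b) (h' : t ≤ glue r a b) :
    glue r a b = glue t a b :=
  le_antisymm (glue_le h (glue_rel t a b)) (glue_le h' (glue_rel r a b))

theorem classCount_glue [Finite D] {r : Setoid D} {a b : D} (h : ¬ r a b) :
    classCount r = classCount (glue r a b) + 1 := by
  classical
  have e : {q : Quotient r // q ≠ Quotient.mk r b} ≃ Quotient (glue r a b) := by
    refine Equiv.ofBijective
      (fun q => Quotient.map' (s₁ := r) (s₂ := glue r a b) id (fun _ _ h => Or.inl h) q.1) ⟨?_, ?_⟩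
    · rintro ⟨q, hq⟩ ⟨q', hq'⟩ hqq
      induction q using Quotient.inductionOn with | _ x
      induction q' using Quotient.inductionOn with | _ y
      have hx : ¬ r x b := fun h => hq (Quotient.sound h)
      have hy : ¬ r y b := fun h => hq' (Quotient.sound h)
      have : glue r a b x y := Quotient.exact hqq
      refine Subtype.ext (Quotient.sound ?_)
      rcases this with g | ⟨_, g'⟩ | ⟨g, _⟩
      · exact g
      · exact absurd (r.symm g') hy
      · exact absurd g hx
    · intro q
      induction q using Quotient.inductionOn with | _ x
      by_cases hx : r x b
      · exact ⟨⟨Quotient.mk r a, fun h' => h (Quotient.exact h')⟩,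
          Quotient.sound (Or.inr (Or.inl ⟨r.refl a, r.symm hx⟩))⟩
      · exact ⟨⟨Quotient.mk r x, fun h' => hx (Quotient.exact h')⟩, rfl⟩
  rw [classCount, classCount, ← Nat.card_congr e, ← Finite.card_option]
  exact Nat.card_congr (Equiv.optionSubtypeNe (Quotient.mk r b)).symm

/-- Merging two classes lowers the number of classes by one, unless they are equal. -/
theorem classCount_eq [Finite D] (r : Setoid D) (a b : D) [Decidable (r a b)] :
    classCount r = classCount (glue r a b) + if r a b then 0 else 1 := by
  split_ifs with h
  · rw [glue_eq_self h, add_zero]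
  · exact classCount_glue h

/-- A weight that is at least one on every class bounds the number of classes. -/
theorem classCount_le_sum [Fintype D] [DecidableEq D] (r : Setoid D) (w : D → ℚ)
    (h : ∀ d, ∃ s : Finset D, 1 ≤ ∑ x ∈ s, w x ∧ (∀ x ∈ s, r d x) ∧
      ∀ x, r d x → x ∉ s → 0 ≤ w x) :
    (classCount r : ℚ) ≤ ∑ d, w d := by
  classical
  rw [← Finset.sum_fiberwise Finset.univ (fun d => Quotient.mk r d) w, classCount,
    Nat.card_eq_fintype_card, ← Finset.card_univ, Finset.card_eq_sum_ones, Nat.cast_sum]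
  refine Finset.sum_le_sum fun q _ => ?_
  induction q using Quotient.inductionOn with | _ d
  obtain ⟨s, hs, hs', hs''⟩ := h d
  rw [Nat.cast_one]
  refine hs.trans (Finset.sum_le_sum_of_subset_of_nonneg ?_ ?_)
  · intro x hx
    simpa using Quotient.sound (r.symm (hs' x hx))
  · intro x hx hxs
    refine hs'' x ?_ hxs
    exact r.symm (Quotient.exact (by simpa using hx))

/-- A weight that is at most one on every class bounds the number of classes from below. -/
theorem sum_le_classCount [Fintype D] [DecidableEq D] (r : Setoid D) (w : D → ℚ)
    (h : ∀ d, ∃ s : Finset D, ∑ x ∈ s, w x ≤ 1 ∧ (∀ x ∈ s, r d x) ∧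
      ∀ x, r d x → x ∉ s → w x = 0) :
    ∑ d, w d ≤ (classCount r : ℚ) := by
  classical
  rw [← Finset.sum_fiberwise Finset.univ (fun d => Quotient.mk r d) w, classCount,
    Nat.card_eq_fintype_card, ← Finset.card_univ, Finset.card_eq_sum_ones, Nat.cast_sum]
  refine Finset.sum_le_sum fun q _ => ?_
  induction q using Quotient.inductionOn with | _ d
  obtain ⟨s, hs, hs', hs''⟩ := h d
  rw [Nat.cast_one]
  refine le_trans (le_of_eq (Finset.sum_subset ?_ ?_).symm) hs
  · intro x hx
    simpa using Quotient.sound (r.symm (hs' x hx))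
  · intro x hx hxs
    refine hs'' x ?_ hxs
    exact r.symm (Quotient.exact (by simpa using hx))

end SetoidCount

namespace Equiv.Perm

variable {D : Type*}

theorem SameCycle.setoid_le {f : Perm D} {t : Setoid D} (h : ∀ x, t x (f x)) :
    SameCycle.setoid f ≤ t := by
  have key : ∀ (n : ℕ) x, t x ((f ^ n) x) := by
    intro n
    induction n with
    | zero => exact fun x => t.refl x
    | succ n ih =>
      intro x
      rw [pow_succ', mul_apply]
      exact t.trans (ih x) (h _)
  rintro x y ⟨n, rfl⟩
  cases n with
  | ofNat n => simpa using key n x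
  | negSucc n =>
    have := key (n + 1) ((f ^ (Int.negSucc n)) x)
    rw [zpow_negSucc, ← mul_apply, mul_inv_cancel, one_apply] at this
    rw [zpow_negSucc]
    exact t.symm this

theorem SameCycle.setoid_apply (f : Perm D) (x : D) : SameCycle.setoid f x (f x) := ⟨1, by simp⟩

theorem SameCycle.setoid_inv (f : Perm D) : SameCycle.setoid f⁻¹ = SameCycle.setoid f :=
  Setoid.ext fun _ _ => sameCycle_inv

theorem SameCycle.eq_or_eq_of_involutive {f : Perm D} (hf : ∀ d, f (f d) = d) {x y : D}
    (h : SameCycle f x y) : y = x ∨ y = f x := by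
  have hsq : f * f = 1 := Equiv.ext hf
  obtain ⟨n, rfl⟩ := h
  rcases Int.even_or_odd' n with ⟨m, rfl | rfl⟩
  · left; rw [zpow_mul, zpow_two, hsq, one_zpow, one_apply]
  · right; rw [zpow_add, zpow_mul, zpow_two, hsq, one_zpow, one_mul, zpow_one]

variable [Finite D] [DecidableEq D]

/-- If `a` and `b` lie in the same cycle of `f`, then multiplying by their transposition splits this
cycle. -/
theorem SameCycle.not_mul_swap {f : Perm D} {a b : D} (hab : a ≠ b) (h : SameCycle f a b) :
    ¬ SameCycle (f * swap a b) a b := by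
  intro h'
  have hex : ∃ n, (f ^ n) a = b := h.exists_nat_pow_eq
  set k := Nat.find hex with hk
  have hkb : (f ^ k) a = b := Nat.find_spec hex
  have hk0 : 0 < k := by
    rcases Nat.eq_zero_or_pos k with h0 | h0
    · rw [h0] at hkb; exact absurd hkb hab
    · exact h0
  have hne : ∀ i, 0 < i → i ≤ k → (f ^ i) a ≠ a := by
    intro i hi hik hia
    have : (f ^ (k - i)) a = b := by
      rw [← hkb]
      conv_rhs => rw [show k = (k - i) + i by omega, pow_add, mul_apply, hia]
    have := Nat.find_min' hex this
    omega
  -- the orbit of `b` under the new permutation never reaches `a`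
  have key : ∀ m, ∃ i, 0 < i ∧ i ≤ k ∧ ((f * swap a b) ^ m) b = (f ^ i) a := by
    intro m
    induction m with
    | zero => exact ⟨k, hk0, le_rfl, by simpa using hkb.symm⟩
    | succ m ih =>
      obtain ⟨i, hi, hik, hm⟩ := ih
      rw [pow_succ', mul_apply, hm]
      rcases eq_or_lt_of_le hik with rfl | hlt
      · exact ⟨1, one_pos, hk0, by rw [hkb]; simp⟩
      · refine ⟨i + 1, by omega, hlt, ?_⟩
        have h1 : (f ^ i) a ≠ b := fun hib => absurd (Nat.find_min' hex hib) (by omega)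
        rw [mul_apply, swap_apply_of_ne_of_ne (hne i hi hik) h1, pow_succ', mul_apply]
  obtain ⟨m, hm⟩ := h'.symm.exists_nat_pow_eq
  obtain ⟨i, hi, hik, hm'⟩ := key m
  exact hne i hi hik (hm'.symm.trans hm)

/-- If `a` and `b` lie in different cycles of `f`, then multiplying by their transposition joins
them. -/
theorem SameCycle.mul_swap_of_not {f : Perm D} {a b : D} (h : ¬ SameCycle f a b) :
    SameCycle (f * swap a b) a b := by
  have hex : ∃ n, 0 < n ∧ (f ^ n) b = b := ⟨orderOf f, orderOf_pos f, by simp [pow_orderOf_eq_one]⟩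
  obtain ⟨hk0, hkb⟩ := Nat.find_spec hex
  -- the new permutation runs from `a` through the whole old cycle of `b`, until it reaches `b`
  have key : ∀ i, 0 < i → i ≤ Nat.find hex → ((f * swap a b) ^ i) a = (f ^ i) b := by
    intro i
    induction i with
    | zero => intro h; omega
    | succ i ih =>
      intro _ hik
      rcases Nat.eq_zero_or_pos i with rfl | hi
      · simp
      · rw [pow_succ', mul_apply, ih hi (by omega), pow_succ' f, mul_apply, mul_apply,
          swap_apply_of_ne_of_ne]
        · exact fun hia => h (SameCycle.symm ⟨i, by simpa using hia⟩)
        · intro hib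
          have := Nat.find_min' hex ⟨hi, hib⟩
          omega
  exact ⟨Nat.find hex, by simpa [hkb] using key _ hk0 le_rfl⟩

theorem sameCycle_mul_swap_iff {f : Perm D} {a b : D} (hab : a ≠ b) :
    SameCycle (f * swap a b) a b ↔ ¬ SameCycle f a b :=
  ⟨fun h h' => h'.not_mul_swap hab h, SameCycle.mul_swap_of_not⟩

omit [Finite D] in
theorem setoid_mul_swap_le (f : Perm D) (a b : D) :
    SameCycle.setoid (f * swap a b) ≤ glue (SameCycle.setoid f) a b := by
  refine SameCycle.setoid_le fun x => ?_
  rw [mul_apply]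
  refine Setoid.trans' _ ?_ (le_glue _ a b (SameCycle.setoid_apply f _))
  rcases eq_or_ne x a with rfl | hxa
  · rw [swap_apply_left]; exact glue_rel _ _ _
  · rcases eq_or_ne x b with rfl | hxb
    · rw [swap_apply_right]; exact Setoid.symm' _ (glue_rel _ _ _)
    · rw [swap_apply_of_ne_of_ne hxa hxb]

omit [Finite D] in
/-- Once `a` and `b` are identified, the cycles of `f * swap a b` and of `f` agree. -/
theorem glue_setoid_mul_swap (f : Perm D) (a b : D) :
    glue (SameCycle.setoid (f * swap a b)) a b = glue (SameCycle.setoid f) a b := by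
  refine glue_eq_glue (setoid_mul_swap_le f a b) ?_
  have := setoid_mul_swap_le (f * swap a b) a b
  rwa [mul_assoc, swap_mul_self, mul_one] at this

end Equiv.Perm

open Equiv.Perm in
/-- For the combinatorial map with vertex permutation `σ` and edge permutation `α`: the number
`V - E + F - 2 C`, that is, minus twice the genus. -/
noncomputable def eulerDefect {D : Type*} (σ α : Equiv.Perm D) : ℤ :=
  classCount (SameCycle.setoid σ) - classCount (SameCycle.setoid α) +
    classCount (SameCycle.setoid (σ⁻¹ * α)) -
    2 * classCount (SameCycle.setoid σ ⊔ SameCycle.setoid α)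

section Euler

open Equiv Equiv.Perm

variable {D : Type*} (σ α : Perm D)

theorem setoid_face_le :
    SameCycle.setoid (σ⁻¹ * α) ≤ SameCycle.setoid σ ⊔ SameCycle.setoid α := by
  refine SameCycle.setoid_le fun x => ?_
  have h1 : SameCycle.setoid α x (α x) := SameCycle.setoid_apply α x
  have h2 : SameCycle.setoid σ (σ⁻¹ (α x)) (α x) := by
    simpa using SameCycle.setoid_apply σ (σ⁻¹ (α x))
  exact Setoid.trans' _ (le_sup_right (a := SameCycle.setoid σ) h1)
    (le_sup_left (b := SameCycle.setoid α) (Setoid.symm' _ h2))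

variable [Finite D] [DecidableEq D]

open Classical in
/-- The effect of multiplying the vertex permutation by a transposition on the numbers of vertices,
faces, and components. -/
theorem classCount_mul_swap {a b : D} (hab : a ≠ b) :
    ((classCount (SameCycle.setoid (σ * swap a b)) : ℤ) =
      classCount (SameCycle.setoid σ) + (if SameCycle σ a b then 1 else -1)) ∧
    ((classCount (SameCycle.setoid ((σ * swap a b)⁻¹ * α)) : ℤ) =
      classCount (SameCycle.setoid (σ⁻¹ * α)) + (if SameCycle (σ⁻¹ * α) a b then 1 else -1)) ∧
    (SameCycle σ a b ∨ SameCycle (σ⁻¹ * α) a b →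
      (classCount (SameCycle.setoid (σ * swap a b) ⊔ SameCycle.setoid α) : ℤ) =
        classCount (SameCycle.setoid σ ⊔ SameCycle.setoid α) +
          if (SameCycle.setoid (σ * swap a b) ⊔ SameCycle.setoid α) a b then 0 else 1) := by
  classical
  have gen : ∀ f : Perm D, (classCount (SameCycle.setoid (f * swap a b)) : ℤ) =
      classCount (SameCycle.setoid f) + (if SameCycle f a b then 1 else -1) := by
    intro f
    rw [classCount_eq (SameCycle.setoid (f * swap a b)) a b, glue_setoid_mul_swap,
      classCount_eq (SameCycle.setoid f) a b]
    have h1 : (SameCycle.setoid (f * swap a b)) a b ↔ ¬ SameCycle f a b :=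
      sameCycle_mul_swap_iff hab
    have h2 : (SameCycle.setoid f) a b ↔ SameCycle f a b := Iff.rfl
    by_cases h : SameCycle f a b
    · simp [h1, h2, h]
    · simp [h1, h2, h]
  refine ⟨gen σ, ?_, ?_⟩
  -- for the faces, the general formula is applied to the inverse of the face permutation
  · have := gen (σ⁻¹ * α)⁻¹
    rw [show (σ⁻¹ * α)⁻¹ * swap a b = ((σ * swap a b)⁻¹ * α)⁻¹ by simp [mul_assoc],
      SameCycle.setoid_inv, SameCycle.setoid_inv] at this
    simpa only [sameCycle_inv] using this
  · intro h
    have hR : (SameCycle.setoid σ ⊔ SameCycle.setoid α) a b := by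
      rcases h with h | h
      · exact le_sup_left (b := SameCycle.setoid α) h
      · exact setoid_face_le σ α h
    have hg : glue (SameCycle.setoid (σ * swap a b) ⊔ SameCycle.setoid α) a b =
        SameCycle.setoid σ ⊔ SameCycle.setoid α := by
      rw [← glue_eq_self hR]
      refine glue_eq_glue (sup_le ?_ ?_) (sup_le ?_ ?_)
      · exact (setoid_mul_swap_le σ a b).trans (glue_le (le_sup_left.trans (le_glue _ a b))
          (glue_rel _ a b))
      · exact le_sup_right.trans (le_glue _ a b)
      · exact (le_glue _ a b).trans ((glue_setoid_mul_swap σ a b).symm.le.trans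
          (glue_le (le_sup_left.trans (le_glue _ a b)) (glue_rel _ a b)))
      · exact le_sup_right.trans (le_glue _ a b)
    rw [classCount_eq (SameCycle.setoid (σ * swap a b) ⊔ SameCycle.setoid α) a b, hg]
    push_cast
    rfl

/-- Splitting a vertex, and joining two corners of the same face, does not raise the genus. -/
theorem eulerDefect_le_mul_swap {a b : D} (h : SameCycle σ a b ∨ SameCycle (σ⁻¹ * α) a b) :
    eulerDefect σ α ≤ eulerDefect (σ * swap a b) α := by
  classical
  rcases eq_or_ne a b with rfl | hab
  · rw [swap_self]; exact le_rfl
  obtain ⟨h1, h2, h3⟩ := classCount_mul_swap σ α hab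
  rw [eulerDefect, eulerDefect, h1, h2, h3 h]
  -- the defect can only drop if the number of components rises by one, and then `a` and `b` lie at
  -- a common vertex and at a common face, so that vertices and faces both increase by one
  have key : (SameCycle.setoid (σ * swap a b) ⊔ SameCycle.setoid α) a b ∨
      (SameCycle σ a b ∧ SameCycle (σ⁻¹ * α) a b) := by
    by_cases hs : SameCycle σ a b
    · by_cases hf : SameCycle (σ⁻¹ * α) a b
      · exact Or.inr ⟨hs, hf⟩
      · left
        apply setoid_face_le
        have := SameCycle.mul_swap_of_not (f := (σ⁻¹ * α)⁻¹) (mt sameCycle_inv.1 hf)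
        rw [show (σ⁻¹ * α)⁻¹ * swap a b = ((σ * swap a b)⁻¹ * α)⁻¹ by simp [mul_assoc]] at this
        exact sameCycle_inv.1 this
    · exact Or.inl (le_sup_left (b := SameCycle.setoid α) (SameCycle.mul_swap_of_not hs))
  rcases key with hk | ⟨hs, hf⟩
  · rw [if_pos hk]
    rcases h with h | h <;> rw [if_pos h] <;> split_ifs <;> omega
  · rw [if_pos hs, if_pos hf]
    split_ifs <;> omega

/-- Cutting a dart off its vertex does not raise the genus. -/
theorem eulerDefect_le_swap_mul (a : D) :
    eulerDefect σ α ≤ eulerDefect (swap a (σ a) * σ) α := by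
  rw [swap_mul_eq_mul_swap, ← mul_apply σ⁻¹ σ, inv_mul_cancel, one_apply]
  exact eulerDefect_le_mul_swap σ α (Or.inl ⟨1, by simp⟩)

theorem eulerDefect_le_mul_swap_face (a : D) :
    eulerDefect σ α ≤ eulerDefect (σ * swap a (σ⁻¹ (α a))) α :=
  eulerDefect_le_mul_swap σ α (Or.inr ⟨1, by simp⟩)

omit [DecidableEq D] in
/-- Cutting an arbitrary set of darts off their vertices does not raise the genus. -/
theorem eulerDefect_le_of_forall {σ τ : Perm D} (h : ∀ d, τ d = σ d ∨ τ d = d) :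
    eulerDefect σ α ≤ eulerDefect τ α := by
  classical
  induction hn : {d | σ d ≠ τ d}.ncard using Nat.strong_induction_on generalizing σ with
  | _ n ih =>
    by_cases heq : σ = τ
    · rw [heq]
    · obtain ⟨d, hd⟩ : ∃ d, σ d ≠ τ d := by
        by_contra! hall
        exact heq (Equiv.ext hall)
      have hτd : τ d = d := (h d).resolve_left (Ne.symm hd)
      have hval : ∀ e, (swap d (σ d) * σ) e = if e = d then d else if σ e = d then σ d else σ e := by
        intro e
        rw [mul_apply]
        split_ifs with h1 h2
        · rw [h1, swap_apply_right]
        · rw [h2, swap_apply_left]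
        · exact swap_apply_of_ne_of_ne h2 fun h3 => h1 (σ.injective h3)
      have hfix : ∀ e, e ≠ d → σ e = d → τ e = e := by
        intro e he hed
        rcases h e with h' | h'
        · exact absurd (τ.injective (h'.trans (hed.trans hτd.symm))) he
        · exact h'
      -- cutting `d` off leaves fewer darts at which the permutation differs from `τ`
      refine (eulerDefect_le_swap_mul σ α d).trans (ih _ ?_ ?_ rfl)
      · rw [← hn]
        refine Set.ncard_lt_ncard ⟨?_, ?_⟩ (Set.toFinite _)
        · intro e he heσ
          refine he ?_
          rw [hval]
          split_ifs with h1 h2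
          · rw [h1, hτd]
          · exact absurd (heσ.trans (hfix e h1 h2)) (fun h3 => h1 (h3 ▸ h2))
          · exact heσ
        · intro hsub
          have : (swap d (σ d) * σ) d ≠ τ d := hsub hd
          rw [hval, if_pos rfl, hτd] at this
          exact this rfl
      · intro e
        rw [hval]
        split_ifs with h1 h2
        · left; rw [h1, hτd]
        · right; exact hfix e h1 h2
        · exact h e

omit [DecidableEq D] in
/-- The genus is not negative. -/
theorem eulerDefect_nonpos (hα : ∀ d, α (α d) = d) : eulerDefect σ α ≤ 0 := by
  classical
  have := Fintype.ofFinite D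
  -- cutting off all darts leaves isolated edges: the faces are then the edges, the components too,
  -- and there are at most twice as many vertices as edges
  refine (eulerDefect_le_of_forall α (τ := 1) fun _ => Or.inr rfl).trans ?_
  have h1 : SameCycle.setoid (1 : Perm D) ≤ SameCycle.setoid α :=
    SameCycle.setoid_le fun x => Setoid.refl' _ _
  have h2 : (classCount (SameCycle.setoid (1 : Perm D)) : ℚ) ≤ ∑ _ : D, (1 : ℚ) :=
    classCount_le_sum _ _ fun d => ⟨{d}, by simp, by simp, fun _ _ _ => zero_le_one⟩
  have h3 : ∑ _ : D, (1 / 2 : ℚ) ≤ (classCount (SameCycle.setoid α) : ℚ) := by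
    refine sum_le_classCount _ _ fun d => ⟨{d, α d}, ?_, ?_, ?_⟩
    · rw [Finset.sum_const]
      have : (({d, α d} : Finset D).card : ℚ) ≤ 2 := by exact_mod_cast Finset.card_le_two
      rw [nsmul_eq_mul]
      linarith
    · intro x hx
      rcases Finset.mem_insert.1 hx with rfl | hx
      · rfl
      · rw [Finset.mem_singleton.1 hx]; exact SameCycle.setoid_apply α d
    · intro x hx hx'
      refine absurd ?_ hx'
      simpa using SameCycle.eq_or_eq_of_involutive hα hx
  rw [eulerDefect, sup_eq_right.2 h1, inv_one, one_mul]
  simp only [Finset.sum_const, nsmul_eq_mul] at h2 h3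
  have h4 : (classCount (SameCycle.setoid (1 : Perm D)) : ℚ) ≤
      2 * classCount (SameCycle.setoid α) := by linarith
  have h5 : classCount (SameCycle.setoid (1 : Perm D)) ≤ 2 * classCount (SameCycle.setoid α) := by
    exact_mod_cast h4
  omega

end Euler

/-! ### Corners of a non-elliptic web at the cut line -/

namespace Web

variable {n : ℕ}

open Equiv Equiv.Perm

open scoped Classical in
/-- The part of a web below a line that crosses it transversally: `A` is the set of the darts of
this part, `bl` lists the darts that start at the line from left to right, and `σ` is the vertex
permutation of the part, where the line is collapsed to one vertex and the darts outside of `A` are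
cut off from their vertices (so that their edges form isolated components).  The part is planar. -/
structure IsLowerPart (u : Web n) (A : Set u.Dart) (bl : List u.Dart) (σ : Perm u.Dart) :
    Prop where
  nodup : bl.Nodup
  mem_of_mem : ∀ d ∈ bl, d ∈ A
  opp_mem : ∀ d ∈ A, u.opp d ∈ A
  notMem_range : ∀ d ∈ A, d ∉ bl → d ∉ Set.range u.bd
  rot_mem : ∀ d ∈ A, d ∉ bl → u.rot d ∈ A
  rot_notMem : ∀ d ∈ A, d ∉ bl → u.rot d ∉ bl
  eq_rot : ∀ d ∈ A, d ∉ bl → σ d = u.rot d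
  eq_self : ∀ d, d ∉ A → σ d = d
  eq_formPerm : ∀ d ∈ bl, σ d = bl.formPerm d
  euler : 0 ≤ eulerDefect σ u.opp

/-- The consecutive boundary darts `b₁`, `b₂` belong to the same arc, or to edges that end at a
common trivalent vertex, or to opposite legs of an `H` with the signs `+`, `-`. -/
def IsCorner (u : Web n) (bl : List u.Dart) (b₁ b₂ : u.Dart) : Prop :=
  u.opp b₁ = b₂ ∨
  (u.opp b₁ ∉ bl ∧ u.opp b₂ ∉ bl ∧ u.rot (u.opp b₂) = u.opp b₁) ∨
  (u.opp b₁ ∉ bl ∧ u.opp b₂ ∉ bl ∧ u.out b₁ = false ∧ u.out b₂ = true ∧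
    ∃ c, c ∉ bl ∧ u.opp c ∉ bl ∧ u.rot c = u.opp b₁ ∧ u.rot (u.opp b₂) = u.opp c)

namespace IsLowerPart

variable {u : Web n} {A : Set u.Dart} {bl : List u.Dart} {σ : Perm u.Dart}

theorem rot_rot_rot (h : u.IsLowerPart A bl σ) {d : u.Dart} (hA : d ∈ A) (hd : d ∉ bl) :
    u.rot (u.rot (u.rot d)) = d := (u.trivalent d (h.notMem_range d hA hd)).1

theorem rot_ne (h : u.IsLowerPart A bl σ) {d : u.Dart} (hA : d ∈ A) (hd : d ∉ bl) :
    u.rot d ≠ d := (u.trivalent d (h.notMem_range d hA hd)).2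

theorem out_rot (h : u.IsLowerPart A bl σ) {d : u.Dart} (hA : d ∈ A) (hd : d ∉ bl) :
    u.out (u.rot d) = u.out d := u.out_rot d (h.notMem_range d hA hd)

theorem apply_mem_bl (h : u.IsLowerPart A bl σ) {d : u.Dart} (hd : d ∈ bl) : σ d ∈ bl := by
  classical
  rw [h.eq_formPerm d hd]
  exact List.formPerm_apply_mem_of_mem hd

theorem inv_mem_bl (h : u.IsLowerPart A bl σ) {d : u.Dart} (hd : d ∈ bl) : σ⁻¹ d ∈ bl := by
  classical
  have h1 : (bl.formPerm)⁻¹ d ∈ bl := by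
    rw [← List.formPerm_mem_iff_mem, ← mul_apply, mul_inv_cancel]; exact hd
  have h2 : σ ((bl.formPerm)⁻¹ d) = d := by
    rw [h.eq_formPerm _ h1]; exact (bl.formPerm).apply_symm_apply d
  rwa [show σ⁻¹ d = (bl.formPerm)⁻¹ d from Perm.inv_eq_iff_eq.2 h2.symm]

theorem inv_eq (h : u.IsLowerPart A bl σ) {d : u.Dart} (hA : d ∈ A) (hd : d ∉ bl) :
    σ⁻¹ d = u.rot (u.rot d) := by
  refine Perm.inv_eq_iff_eq.2 ?_
  rw [h.eq_rot _ (h.rot_mem _ (h.rot_mem d hA hd) (h.rot_notMem d hA hd))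
    (h.rot_notMem _ (h.rot_mem d hA hd) (h.rot_notMem d hA hd)), h.rot_rot_rot hA hd]

theorem apply_mem_iff (h : u.IsLowerPart A bl σ) (d : u.Dart) : σ d ∈ A ↔ d ∈ A := by
  constructor
  · intro hd
    by_contra hA
    rw [h.eq_self d hA] at hd
    exact hA hd
  · intro hA
    by_cases hd : d ∈ bl
    · exact h.mem_of_mem _ (h.apply_mem_bl hd)
    · rw [h.eq_rot d hA hd]; exact h.rot_mem d hA hd

theorem opp_mem_iff (h : u.IsLowerPart A bl σ) (d : u.Dart) : u.opp d ∈ A ↔ d ∈ A :=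
  ⟨fun hd => by simpa [u.opp_opp] using h.opp_mem _ hd, h.opp_mem d⟩

theorem face_mem_iff (h : u.IsLowerPart A bl σ) (d : u.Dart) : (σ⁻¹ * u.opp) d ∈ A ↔ d ∈ A := by
  rw [← h.apply_mem_iff, mul_apply, show σ (σ⁻¹ (u.opp d)) = u.opp d from σ.apply_symm_apply _,
    h.opp_mem_iff]

theorem mem_iff_of_connected (h : u.IsLowerPart A bl σ) {x y : u.Dart}
    (hxy : (SameCycle.setoid σ ⊔ SameCycle.setoid u.opp) x y) : x ∈ A ↔ y ∈ A := by
  have : SameCycle.setoid σ ⊔ SameCycle.setoid u.opp ≤ Setoid.ker (fun x => x ∈ A) :=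
    sup_le (SameCycle.setoid_le fun x => propext (h.apply_mem_iff x).symm)
      (SameCycle.setoid_le fun x => propext (h.opp_mem_iff x).symm)
  exact iff_of_eq (this hxy)

theorem face_mem_bl (h : u.IsLowerPart A bl σ) {d : u.Dart} (hd : u.opp d ∈ bl) :
    (σ⁻¹ * u.opp) d ∈ bl ∧ σ ((σ⁻¹ * u.opp) d) = u.opp d :=
  ⟨h.inv_mem_bl hd, σ.apply_symm_apply _⟩

/-- Walking along a face inside the part: the next dart of the face, with alternating orientation
because every vertex is a source or a sink. -/
theorem face_inner (h : u.IsLowerPart A bl σ) {d : u.Dart} (hA : d ∈ A) (hd : u.opp d ∉ bl) :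
    (σ⁻¹ * u.opp) d = u.face d ∧ (σ⁻¹ * u.opp) d ∈ A ∧ (σ⁻¹ * u.opp) d ∉ bl ∧
      u.out ((σ⁻¹ * u.opp) d) = !(u.out d) ∧ u.rot ((σ⁻¹ * u.opp) d) = u.opp d := by
  have hA' := h.opp_mem d hA
  have h1 := h.rot_mem _ hA' hd
  have h2 := h.rot_notMem _ hA' hd
  rw [mul_apply, h.inv_eq hA' hd]
  refine ⟨?_, h.rot_mem _ h1 h2, h.rot_notMem _ h1 h2, ?_, h.rot_rot_rot hA' hd⟩
  · rw [face, mul_apply, eq_comm]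
    exact Perm.inv_eq_iff_eq.2 (h.rot_rot_rot hA' hd).symm
  · rw [h.out_rot h1 h2, h.out_rot hA' hd, u.out_opp]

theorem sameCycle_of_mem (h : u.IsLowerPart A bl σ) {d e : u.Dart} (hd : d ∈ bl) (he : e ∈ bl) :
    SameCycle σ d e := by
  classical
  have hc := (h.nodup.isCycleOn_formPerm).2 hd he
  have : Finite u.Dart := u.fin
  obtain ⟨i, rfl⟩ := hc.exists_nat_pow_eq
  refine ⟨i, ?_⟩
  have : ∀ i : ℕ, (σ ^ i) d = (bl.formPerm ^ i) d ∧ (bl.formPerm ^ i) d ∈ bl := by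
    intro i
    induction i with
    | zero => exact ⟨rfl, hd⟩
    | succ i ih =>
      rw [pow_succ', mul_apply, ih.1, pow_succ', mul_apply, h.eq_formPerm _ ih.2]
      exact ⟨rfl, List.formPerm_apply_mem_of_mem ih.2⟩
  simpa using (this i).1

theorem _root_.Equiv.Perm.injOn_pow_apply {D : Type*} {f : Perm D} {b : D} {m : ℕ}
    (h : ∀ k, 0 < k → k ≤ m → (f ^ k) b ≠ b) :
    Set.InjOn (fun k => (f ^ k) b) (Finset.range (m + 1) : Set ℕ) := by
  have key : ∀ i j, i < j → j ≤ m → (f ^ i) b ≠ (f ^ j) b := by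
    intro i j hij hj he
    refine h (j - i) (by omega) (by omega) ((f ^ i).injective ?_)
    rw [← mul_apply, ← pow_add, show i + (j - i) = j by omega, he]
  intro i hi j hj he
  simp only [Finset.coe_range, Set.mem_Iio] at hi hj
  rcases lt_trichotomy i j with hl | hl | hl
  · exact absurd he (key i j hl (by omega))
  · exact hl
  · exact absurd he.symm (key j i hl (by omega))

/-- In a non-elliptic web, a face that does not touch the boundary has at least six sides. -/
theorem face_pow_ne (h : u.IsLowerPart A bl σ) (hu : u.NonElliptic) {d : u.Dart} (hA : d ∈ A)
    (hd : ∀ k : ℕ, ((σ⁻¹ * u.opp) ^ k) d ∉ bl) :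
    ∀ k, 0 < k → k ≤ 5 → ((σ⁻¹ * u.opp) ^ k) d ≠ d := by
  have hmem : ∀ k : ℕ, ((σ⁻¹ * u.opp) ^ k) d ∈ A := by
    intro k
    induction k with
    | zero => exact hA
    | succ k ih => rw [pow_succ', mul_apply, h.face_mem_iff]; exact ih
  have hopp : ∀ k : ℕ, u.opp (((σ⁻¹ * u.opp) ^ k) d) ∉ bl := by
    intro k hk
    have := (h.face_mem_bl hk).1
    rw [← mul_apply, ← pow_succ'] at this
    exact hd _ this
  have hout : ∀ k : ℕ, u.out (((σ⁻¹ * u.opp) ^ (k + 1)) d) = !(u.out (((σ⁻¹ * u.opp) ^ k) d)) := by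
    intro k
    rw [pow_succ', mul_apply]
    exact (h.face_inner (hmem k) (hopp k)).2.2.2.1
  have hface : ∀ k : ℕ, ((σ⁻¹ * u.opp) ^ k) d = (u.face ^ k) d := by
    intro k
    induction k with
    | zero => rfl
    | succ k ih =>
      rw [pow_succ', mul_apply, (h.face_inner (hmem k) (hopp k)).1, ih, pow_succ', mul_apply]
  have hne := hu d fun k => by
    rw [← hface]
    exact h.notMem_range _ (hmem k) (hd k)
  -- an odd number of sides contradicts the alternating orientation
  intro k hk hk' he
  have h0 : ((σ⁻¹ * u.opp) ^ 0) d = d := rfl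
  have o1 := hout 0
  have o2 := hout 1
  have o3 := hout 2
  have o4 := hout 3
  have o5 := hout 4
  rw [h0] at o1
  interval_cases k
  · rw [he] at o1; simp at o1
  · rw [hface] at he; exact hne.1 he
  · rw [o2, o1] at o3; rw [he] at o3; simp at o3
  · rw [hface] at he; exact hne.2 he
  · rw [o4, o3, o2, o1] at o5; rw [he] at o5; simp at o5

/-- The discrete Gauss--Bonnet inequality: if the face at the corner of the boundary dart `b` has at
least `μ b` trivalent vertices, then the sum of all `3 - μ b` is at least six. -/
theorem six_le_sum [DecidableEq u.Dart] (h : u.IsLowerPart A bl σ) (hu : u.NonElliptic)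
    (hA : A.Nonempty) (μ : u.Dart → ℕ)
    (hμ : ∀ b ∈ bl, ∀ k, 0 < k → k ≤ μ b → ((σ⁻¹ * u.opp) ^ k) b ≠ b)
    (hc : ∀ b ∈ bl, ∀ b' ∈ bl, SameCycle (σ⁻¹ * u.opp) b b' → b = b') :
    6 ≤ ∑ b ∈ bl.toFinset, (3 - (μ b : ℚ)) := by
  classical
  have := u.fin
  have := Fintype.ofFinite u.Dart
  obtain ⟨r, hrA, hr⟩ : ∃ r ∈ A, bl ≠ [] → r ∈ bl := by
    by_cases hb : bl = []
    · exact ⟨hA.some, hA.some_mem, fun h' => absurd hb h'⟩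
    · obtain ⟨r, hr⟩ := List.exists_mem_of_ne_nil bl hb
      exact ⟨r, h.mem_of_mem r hr, fun _ => hr⟩
  have hbl : ∀ d, d ∈ bl → r ∈ bl := fun d hd => hr (List.ne_nil_of_mem hd)
  -- Every vertex, edge, face, and component distributes its count among its darts.  The root vertex
  -- and its component are counted at `r`.  A dart outside of `A` belongs to an isolated edge with two
  -- vertices, one face, and one component, and so contributes nothing in total.
  let wV : u.Dart → ℚ := fun d =>
    if d ∈ A then (if d ∈ bl then (if d = r then 1 else 0) else 1 / 3) else 1
  let wF : u.Dart → ℚ := fun d =>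
    if d ∈ A then (if d ∈ bl then 1 - μ d / 6 else 1 / 6) else 1 / 2
  let wC : u.Dart → ℚ := fun d => if d ∈ A then (if d = r then 1 else 0) else 1 / 2
  have wV0 : ∀ d, 0 ≤ wV d := by
    intro d
    simp only [wV]
    split_ifs <;> norm_num
  -- the number of vertices
  have hV : (classCount (SameCycle.setoid σ) : ℚ) ≤ ∑ d, wV d := by
    refine classCount_le_sum _ _ fun d => ?_
    by_cases hdA : d ∈ A
    · by_cases hdb : d ∈ bl
      · refine ⟨{r}, ?_, ?_, fun x _ _ => wV0 x⟩
        · simp [wV, hbl d hdb, hrA]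
        · intro x hx
          rw [Finset.mem_singleton.1 hx]
          exact h.sameCycle_of_mem hdb (hbl d hdb)
      · have a1 := h.rot_mem d hdA hdb
        have b1 := h.rot_notMem d hdA hdb
        have a2 := h.rot_mem _ a1 b1
        have b2 := h.rot_notMem _ a1 b1
        have n1 := h.rot_ne hdA hdb
        have n2 : u.rot (u.rot d) ≠ d := fun he => by
          have := h.rot_rot_rot hdA hdb
          rw [he] at this
          exact n1 this
        have n3 : u.rot (u.rot d) ≠ u.rot d := fun he => n1 (u.rot.injective he)
        refine ⟨{d, u.rot d, u.rot (u.rot d)}, ?_, ?_, fun x _ _ => wV0 x⟩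
        · rw [Finset.sum_insert (by simp [n1.symm, n2.symm]), Finset.sum_insert (by simp [n3.symm]),
            Finset.sum_singleton]
          simp only [wV, hdA, hdb, a1, b1, a2, b2, if_true, if_false]
          norm_num
        · have s1 : SameCycle.setoid σ d (u.rot d) := by
            rw [← h.eq_rot d hdA hdb]; exact SameCycle.setoid_apply σ d
          have s2 : SameCycle.setoid σ (u.rot d) (u.rot (u.rot d)) := by
            rw [← h.eq_rot _ a1 b1]; exact SameCycle.setoid_apply σ _
          intro x hx
          simp only [Finset.mem_insert, Finset.mem_singleton] at hx
          rcases hx with rfl | rfl | rfl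
          · exact Setoid.refl' _ _
          · exact s1
          · exact Setoid.trans' _ s1 s2
    · exact ⟨{d}, by simp [wV, hdA], by simp, fun x _ _ => wV0 x⟩
  -- the number of edges
  have hE : ∑ _d : u.Dart, (1 / 2 : ℚ) ≤ classCount (SameCycle.setoid u.opp) := by
    refine sum_le_classCount _ _ fun d => ⟨{d, u.opp d}, ?_, ?_, ?_⟩
    · rw [Finset.sum_pair (u.opp_ne d).symm]; norm_num
    · intro x hx
      rcases Finset.mem_insert.1 hx with rfl | hx
      · exact Setoid.refl' _ _
      · rw [Finset.mem_singleton.1 hx]; exact SameCycle.setoid_apply _ d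
    · intro x hx hx'
      exact absurd (by simpa using SameCycle.eq_or_eq_of_involutive u.opp_opp hx) hx'
  -- the number of faces
  have hfA : ∀ {x y}, SameCycle (σ⁻¹ * u.opp) x y → (x ∈ A ↔ y ∈ A) := fun {x y} hxy =>
    h.mem_iff_of_connected (setoid_face_le σ u.opp hxy)
  have hF : (classCount (SameCycle.setoid (σ⁻¹ * u.opp)) : ℚ) ≤ ∑ d, wF d := by
    refine classCount_le_sum _ _ fun d => ?_
    by_cases hdA : d ∈ A
    · by_cases hex : ∃ b ∈ bl, SameCycle (σ⁻¹ * u.opp) d b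
      · obtain ⟨b, hb, hdb⟩ := hex
        have hbA := h.mem_of_mem b hb
        have hinj := injOn_pow_apply (hμ b hb)
        have hcyc : ∀ k : ℕ, SameCycle (σ⁻¹ * u.opp) b (((σ⁻¹ * u.opp) ^ k) b) :=
          fun k => ⟨k, by simp⟩
        -- a face at the line: its corner `b` and the `μ b` next darts
        refine ⟨(Finset.range (μ b + 1)).image fun k => ((σ⁻¹ * u.opp) ^ k) b, ?_, ?_, ?_⟩
        · rw [Finset.sum_image hinj, Finset.sum_range_succ']
          have : ∀ k ∈ Finset.range (μ b), wF (((σ⁻¹ * u.opp) ^ (k + 1)) b) = 1 / 6 := by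
            intro k hk
            have h1 : ((σ⁻¹ * u.opp) ^ (k + 1)) b ∈ A := (hfA (hcyc (k + 1))).1 hbA
            have h2 : ((σ⁻¹ * u.opp) ^ (k + 1)) b ∉ bl := fun hk' =>
              hμ b hb (k + 1) (by omega) (by have := Finset.mem_range.1 hk; omega)
                (hc b hb _ hk' (hcyc _)).symm
            simp only [wF, if_pos h1, if_neg h2]
          rw [Finset.sum_congr rfl this]
          simp only [wF, pow_zero, one_apply, if_pos hbA, if_pos hb, Finset.sum_const,
            Finset.card_range, nsmul_eq_mul]
          linarith
        · intro x hx
          obtain ⟨k, _, rfl⟩ := Finset.mem_image.1 hx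
          exact hdb.trans (hcyc k)
        · intro x hx hxs
          have hxA : x ∈ A := (hfA hx).1 hdA
          have hxb : x ∉ bl := fun hxb => hxs <| Finset.mem_image.2
            ⟨0, by simp, by simpa using hc b hb x hxb (hdb.symm.trans hx)⟩
          simp only [wF, if_pos hxA, if_neg hxb]
          norm_num
      -- an inner face: six darts of weight `1 / 6`
      · push Not at hex
        have hcyc : ∀ k : ℕ, SameCycle (σ⁻¹ * u.opp) d (((σ⁻¹ * u.opp) ^ k) d) :=
          fun k => ⟨k, by simp⟩
        have hinj := injOn_pow_apply
          (h.face_pow_ne hu hdA fun k hk => hex _ hk (hcyc k))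
        have hval : ∀ x, SameCycle (σ⁻¹ * u.opp) d x → wF x = 1 / 6 := fun x hx => by
          simp only [wF, if_pos ((hfA hx).1 hdA), if_neg fun hxb => hex x hxb hx]
        refine ⟨(Finset.range 6).image fun k => ((σ⁻¹ * u.opp) ^ k) d, ?_, ?_, ?_⟩
        · rw [Finset.sum_image hinj, Finset.sum_congr rfl fun k _ => hval _ (hcyc k)]
          norm_num
        · intro x hx
          obtain ⟨k, _, rfl⟩ := Finset.mem_image.1 hx
          exact hcyc k
        · intro x hx _
          rw [hval x hx]; norm_num
    · have hoA : u.opp d ∉ A := fun h' => hdA ((h.opp_mem_iff d).1 h')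
      refine ⟨{d, u.opp d}, ?_, ?_, ?_⟩
      · rw [Finset.sum_pair (u.opp_ne d).symm]
        simp only [wF, if_neg hdA, if_neg hoA]; norm_num
      · intro x hx
        rcases Finset.mem_insert.1 hx with rfl | hx
        · exact Setoid.refl' _ _
        · rw [Finset.mem_singleton.1 hx]
          refine ⟨1, ?_⟩
          rw [zpow_one, mul_apply]
          exact Perm.inv_eq_iff_eq.2 (h.eq_self _ hoA).symm
      · intro x hx _
        have hxA : x ∉ A := fun h' => hdA ((hfA hx).2 h')
        simp only [wF, if_neg hxA]; norm_num
  -- the number of components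
  have hC : ∑ d, wC d ≤ classCount (SameCycle.setoid σ ⊔ SameCycle.setoid u.opp) := by
    refine sum_le_classCount _ _ fun d => ?_
    by_cases hdA : d ∈ A
    · have hval : ∀ x, (SameCycle.setoid σ ⊔ SameCycle.setoid u.opp) d x → x ≠ r → wC x = 0 := by
        intro x hx hxr
        simp only [wC, if_pos ((h.mem_iff_of_connected hx).1 hdA), if_neg hxr]
      by_cases hdr : (SameCycle.setoid σ ⊔ SameCycle.setoid u.opp) d r
      · refine ⟨{r}, by simp [wC, hrA], by simpa using hdr, fun x hx hxr => hval x hx ?_⟩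
        simpa using hxr
      · refine ⟨∅, by simp, by simp, fun x hx _ => hval x hx ?_⟩
        rintro rfl
        exact hdr hx
    · have hoA : u.opp d ∉ A := fun h' => hdA ((h.opp_mem_iff d).1 h')
      refine ⟨{d, u.opp d}, ?_, ?_, ?_⟩
      · rw [Finset.sum_pair (u.opp_ne d).symm]
        simp only [wC, if_neg hdA, if_neg hoA]; norm_num
      · intro x hx
        rcases Finset.mem_insert.1 hx with rfl | hx
        · exact Setoid.refl' _ _
        · rw [Finset.mem_singleton.1 hx]
          exact le_sup_right (a := SameCycle.setoid σ) (SameCycle.setoid_apply u.opp d)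
      · intro x hx hxs
        have hle : SameCycle.setoid σ ⊔ SameCycle.setoid u.opp ≤
            Setoid.ker (fun x => x = d ∨ x = u.opp d) := by
          refine sup_le (SameCycle.setoid_le fun x => propext ?_)
            (SameCycle.setoid_le fun x => propext ?_)
          · by_cases hxA : x ∈ A
            · have hx' := (h.apply_mem_iff x).2 hxA
              constructor
              · rintro (rfl | rfl)
                · exact absurd hxA hdA
                · exact absurd hxA hoA
              · rintro (he | he)
                · exact absurd (he ▸ hx') hdA
                · exact absurd (he ▸ hx') hoA
            · rw [h.eq_self x hxA]
          · constructor
            · rintro (rfl | rfl)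
              · exact Or.inr rfl
              · exact Or.inl (u.opp_opp d)
            · rintro (he | he)
              · right; rw [← he, u.opp_opp]
              · left; exact u.opp.injective he
        have := (iff_of_eq (hle hx)).1 (Or.inl rfl)
        exact absurd (by simpa using this) hxs
  have heuler : (0 : ℚ) ≤ classCount (SameCycle.setoid σ) - classCount (SameCycle.setoid u.opp) +
      classCount (SameCycle.setoid (σ⁻¹ * u.opp)) -
      2 * classCount (SameCycle.setoid σ ⊔ SameCycle.setoid u.opp) := by
    have := h.euler
    rw [eulerDefect] at this
    have := (Int.cast_nonneg (R := ℚ)) this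
    push_cast at this
    exact this
  have htot : 0 ≤ ∑ d, (wV d - 1 / 2 + wF d - 2 * wC d) := by
    rw [Finset.sum_sub_distrib, Finset.sum_add_distrib, Finset.sum_sub_distrib, ← Finset.mul_sum]
    linarith
  -- the local contributions; the `- 1` at `r` comes from `V - 2 C` of the component of the line
  have hpt : ∀ d, wV d - 1 / 2 + wF d - 2 * wC d ≤
      (if d ∈ bl.toFinset then (3 - (μ d : ℚ)) / 6 else 0) - if d = r then 1 else 0 := by
    intro d
    simp only [List.mem_toFinset]
    by_cases hdA : d ∈ A
    · by_cases hdb : d ∈ bl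
      · simp only [wV, wF, wC, if_pos hdA, if_pos hdb]
        split_ifs <;> linarith
      · simp only [wV, wF, wC, if_pos hdA, if_neg hdb]
        split_ifs <;> linarith
    · have hdb : d ∉ bl := fun h' => hdA (h.mem_of_mem d h')
      have hdr : d ≠ r := fun h' => hdA (h' ▸ hrA)
      simp only [wV, wF, wC, if_neg hdA, if_neg hdb, if_neg hdr]
      norm_num
  have := htot.trans (Finset.sum_le_sum fun d _ => hpt d)
  rw [Finset.sum_sub_distrib, Finset.sum_ite_mem, Finset.univ_inter, ← Finset.sum_div,
    Finset.sum_ite_eq' Finset.univ r, if_pos (Finset.mem_univ r)] at this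
  linarith

/-- There is no non-elliptic web without boundary apart from the empty one. -/
theorem eq_empty (h : u.IsLowerPart A [] σ) (hu : u.NonElliptic) : A = ∅ := by
  classical
  by_contra hA
  have := h.six_le_sum hu (Set.nonempty_iff_ne_empty.2 hA) (fun _ => 0) (by simp) (by simp)
  norm_num at this

/-- If no corner can be peeled off, the face at a corner is large. -/
theorem face_pow_ne_of_not_isCorner (h : u.IsLowerPart A bl σ)
    (hc : ∀ b ∈ bl, ∀ b' ∈ bl, SameCycle (σ⁻¹ * u.opp) b b' → b = b') {b : u.Dart} (hb : b ∈ bl)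
    (hn : ¬ u.IsCorner bl b (σ b)) :
    ∀ k, 0 < k → k ≤ 3 + (if u.out (σ b) then 1 else 0) - (if u.out b then 1 else 0) →
      ((σ⁻¹ * u.opp) ^ k) b ≠ b := by
  set f := σ⁻¹ * u.opp with hf
  -- if the face of `b` comes back to the line, it does so at the right neighbour of `b`
  have hret : ∀ k : ℕ, u.opp ((f ^ k) b) ∈ bl → σ b = u.opp ((f ^ k) b) := by
    intro k hk
    have hk' : (f ^ (k + 1)) b ∈ bl := by rw [pow_succ', mul_apply]; exact (h.face_mem_bl hk).1
    have h1 : b = (f ^ (k + 1)) b := hc b hb _ hk' ⟨(k + 1 : ℕ), by rw [zpow_natCast]⟩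
    conv_lhs => rw [h1, pow_succ', mul_apply]
    exact σ.apply_symm_apply _
  have hbA := h.mem_of_mem b hb
  -- otherwise `b` and its neighbour form an arc
  have h0 : u.opp b ∉ bl := by
    intro h0
    exact hn (Or.inl (hret 0 h0).symm)
  obtain ⟨-, A1, B1, O1, R1⟩ := h.face_inner hbA h0
  rw [← hf] at A1 B1 O1 R1
  -- otherwise they form a fork
  have h1 : u.opp (f b) ∉ bl := by
    intro h1
    have e1 := hret 1 (by rwa [pow_one])
    rw [pow_one] at e1
    refine hn (Or.inr (Or.inl ⟨h0, ?_, ?_⟩))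
    · rw [e1, u.opp_opp]; exact B1
    · rw [e1, u.opp_opp, R1]
  obtain ⟨-, A2, B2, O2, R2⟩ := h.face_inner A1 h1
  rw [← hf] at A2 B2 O2 R2
  -- if the face returns after two vertices, then `b` and its neighbour are legs of an `H`, so that
  -- their signs are `-`, `+`
  have h2 : u.opp (f (f b)) ∈ bl → u.out b = true ∧ u.out (σ b) = false := by
    intro h2
    have e2 := hret 2 (by rwa [pow_two, mul_apply])
    rw [pow_two, mul_apply] at e2
    have o : u.out (σ b) = !(u.out b) := by rw [e2, u.out_opp, O2, O1, Bool.not_not]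
    cases hob : u.out b
    · rw [hob] at o
      refine absurd (Or.inr (Or.inr ⟨h0, ?_, hob, o, f b, B1, h1, R1, ?_⟩)) hn
      · rw [e2, u.opp_opp]; exact B2
      · rw [e2, u.opp_opp, R2]
    · rw [hob] at o
      exact ⟨rfl, o⟩
  intro k hk hk' he
  have hk4 : k ≤ 4 := by
    refine hk'.trans ?_
    split_ifs <;> omega
  have n1 : f b ≠ b := fun h' => B1 (by rwa [h'])
  have n2 : f (f b) ≠ b := fun h' => B2 (by rwa [h'])
  interval_cases k
  · exact n1 (by simpa using he)
  · exact n2 (by simpa [pow_two] using he)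
  · have h3 : u.opp (f (f b)) ∈ bl := by
      by_contra h3
      have B3 := (h.face_inner A2 h3).2.2.1
      rw [← hf, show f (f (f b)) = b by simpa [pow_succ'] using he] at B3
      exact B3 hb
    rw [(h2 h3).1, (h2 h3).2] at hk'
    simp at hk'
  · by_cases h3 : u.opp (f (f b)) ∈ bl
    · rw [(h2 h3).1, (h2 h3).2] at hk'
      simp at hk'
    · obtain ⟨-, A3, B3, O3, R3⟩ := h.face_inner A2 h3
      rw [← hf] at A3 B3 O3 R3
      -- a face with three vertices joins two legs of equal signs
      have h4 : u.opp (f (f (f b))) ∈ bl := by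
        by_contra h4
        have B4 := (h.face_inner A3 h4).2.2.1
        rw [← hf, show f (f (f (f b))) = b by simpa [pow_succ'] using he] at B4
        exact B4 hb
      have e3 := hret 3 (by simpa [pow_succ'] using h4)
      rw [show (f ^ 3) b = f (f (f b)) by simp [pow_succ']] at e3
      have o : u.out (σ b) = u.out b := by rw [e3, u.out_opp, O3, O2, O1]; simp
      rw [o] at hk'
      split_ifs at hk' <;> omega

end IsLowerPart

end Web

theorem List.formPerm_apply_append {D : Type*} [DecidableEq D] {p s : List D} {x y : D}
    (h : (p ++ x :: y :: s).Nodup) : (p ++ x :: y :: s).formPerm x = y := by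
  have hr : p ++ x :: y :: s ~r x :: y :: (s ++ p) := by
    simpa using List.isRotated_append (l := p) (l' := x :: y :: s)
  rw [List.formPerm_eq_of_isRotated h hr]
  exact List.formPerm_apply_head x y _ (hr.nodup_iff.1 h)

theorem List.formPerm_append_cons {D : Type*} [DecidableEq D] (m t : List D) (b : D) :
    (m ++ b :: t).formPerm = (m ++ [b]).formPerm * (b :: t).formPerm := by
  induction m with
  | nil => simp
  | cons x m ih =>
    cases m with
    | nil => simp [List.formPerm_cons_cons]
    | cons y m =>
      simp only [List.cons_append, List.formPerm_cons_cons] at ih ⊢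
      rw [ih, mul_assoc]

namespace Web

variable {n : ℕ}

open Equiv Equiv.Perm

namespace IsLowerPart

variable {u : Web n} {A : Set u.Dart} {bl : List u.Dart} {σ : Perm u.Dart}

theorem apply_append (h : u.IsLowerPart A bl σ) {p s : List u.Dart} {x y : u.Dart}
    (hl : bl = p ++ x :: y :: s) : σ x = y := by
  classical
  rw [h.eq_formPerm x (by simp [hl]), hl, List.formPerm_apply_append (hl ▸ h.nodup)]

/-- If all corners at the line belong to different faces, then one of them can be peeled off:  The
corners with the signs `-`, `+` and those with the signs `+`, `-` alternate, so the positive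
contributions to the Gauss--Bonnet sum are compensated, up to those at the outer corner. -/
theorem exists_isCorner_of_injective (h : u.IsLowerPart A bl σ) (hu : u.NonElliptic)
    (hbl : bl ≠ []) (hc : ∀ b ∈ bl, ∀ b' ∈ bl, SameCycle (σ⁻¹ * u.opp) b b' → b = b') :
    ∃ p b₁ b₂ s, bl = p ++ b₁ :: b₂ :: s ∧ u.IsCorner bl b₁ b₂ := by
  classical
  by_contra! hno
  set e := bl.getLast hbl with he
  have heb : e ∈ bl := List.getLast_mem hbl
  have hn : ∀ b ∈ bl, b ≠ e → ¬ u.IsCorner bl b (σ b) := by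
    intro b hb hbe
    obtain ⟨p, t, hl⟩ := List.append_of_mem hb
    cases t with
    | nil =>
      refine absurd ?_ hbe
      rw [he]; simp [hl]
    | cons y s =>
      rw [h.apply_append hl]
      exact hno p b y s hl
  -- the corner of `b` contributes at most `o b - o (σ b)`, except for the outer corner after the
  -- last dart `e`, which contributes at most `4`; the differences cancel in the cyclic sum, and
  -- `4 < 6`
  let o : u.Dart → ℚ := fun d => if u.out d then 1 else 0
  have key := h.six_le_sum hu ⟨e, h.mem_of_mem e heb⟩
    (fun b => if b = e then 0 else 3 + (if u.out (σ b) then 1 else 0) - (if u.out b then 1 else 0))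
    (by
      intro b hb
      by_cases hbe : b = e
      · rw [if_pos hbe]; intro k hk hk'; omega
      · rw [if_neg hbe]
        exact h.face_pow_ne_of_not_isCorner hc hb (hn b hb hbe)) hc
  have hval : ∀ b ∈ bl.toFinset, (3 - ((if b = e then 0 else 3 + (if u.out (σ b) then 1 else 0) -
      (if u.out b then 1 else 0) : ℕ) : ℚ)) ≤ (o b - o (σ b)) + if b = e then 4 else 0 := by
    intro b _
    simp only [o]
    by_cases h1 : b = e
    · simp only [if_pos h1]
      split_ifs <;> norm_num
    · simp only [if_neg h1]
      split_ifs <;> norm_num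
  have hperm : ∑ b ∈ bl.toFinset, o (σ b) = ∑ b ∈ bl.toFinset, o b := by
    refine Finset.sum_nbij σ ?_ σ.injective.injOn ?_ fun _ _ => rfl
    · intro b hb
      simpa using h.apply_mem_bl (by simpa using hb)
    · intro b hb
      exact ⟨σ⁻¹ b, by simpa using h.inv_mem_bl (by simpa using hb), σ.apply_symm_apply b⟩
  have := key.trans (Finset.sum_le_sum hval)
  rw [Finset.sum_add_distrib, Finset.sum_sub_distrib, hperm, sub_self, zero_add,
    Finset.sum_ite_eq' _ e] at this
  split_ifs at this <;> norm_num at this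

/-- If two corners at the line belong to the same face, then the part of the web between them is
separated from the rest. -/
theorem exists_lowerPart_of_sameCycle (h : u.IsLowerPart A bl σ) {p m s : List u.Dart}
    {b b' : u.Dart} (hl : bl = p ++ b :: (m ++ b' :: s))
    (hc : SameCycle (σ⁻¹ * u.opp) b b') :
    ∃ A' σ', u.IsLowerPart A' (m ++ [b']) σ' ∧ A' ⊆ A ∧ ∀ d ∈ A', d ∈ bl → d ∈ m ++ [b'] := by
  classical
  have := u.fin
  have hnd := h.nodup
  -- rotating the root so that it starts at `b`
  have hr : bl ~r b :: (m ++ b' :: (s ++ p)) := by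
    rw [hl]
    simpa using List.isRotated_append (l := p) (l' := b :: (m ++ b' :: s))
  have hnd' : (b :: (m ++ b' :: (s ++ p))).Nodup := hr.nodup_iff.1 hnd
  set t := s ++ p with ht
  have hσ : ∀ d ∈ bl, σ d = (b :: (m ++ b' :: t)).formPerm d := fun d hd => by
    rw [h.eq_formPerm d hd, List.formPerm_eq_of_isRotated hnd hr]
  have hmem : ∀ d, d ∈ bl ↔ d ∈ b :: (m ++ b' :: t) := fun d => hr.mem_iff
  have hI : ∀ d ∈ m ++ [b'], d ∈ bl := by
    intro d hd
    rw [hmem]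
    simp only [List.mem_append, List.mem_cons] at hd ⊢
    tauto
  have hb : b ∈ bl := (hmem b).2 List.mem_cons_self
  have hb' : b' ∈ bl := hI b' (by simp)
  have hbb' : b ≠ b' := by
    rintro rfl
    simp at hnd'
  have hbI : b ∉ m ++ [b'] := by
    simp only [List.nodup_cons, List.mem_append, List.mem_cons] at hnd' ⊢
    tauto
  have hndI : (m ++ [b']).Nodup := by
    have : (m ++ [b'] ++ t).Nodup := by simpa using (List.nodup_cons.1 hnd').2
    exact (List.nodup_append.1 this).1
  -- the vertex permutation after the root has been split
  set τ := σ * swap b b' with hτ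
  -- the darts of `m ++ [b']` form one of the two cycles of the split root
  have hτI : ∀ d ∈ m ++ [b'], τ d = (m ++ [b']).formPerm d := by
    obtain ⟨c, I, hcI⟩ : ∃ c I, m ++ [b'] = c :: I := by
      cases m with
      | nil => exact ⟨b', [], rfl⟩
      | cons c m => exact ⟨c, m ++ [b'], rfl⟩
    have hcI' : m ++ b' :: t = c :: (I ++ t) := by
      rw [show m ++ b' :: t = (m ++ [b']) ++ t by simp, hcI, List.cons_append]
    have hlast : (m ++ [b']).formPerm b' = c := by
      rw [hcI]
      conv_lhs => rw [show b' = (c :: I).getLast (List.cons_ne_nil c I) by simp [← hcI]]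
      exact List.formPerm_apply_getLast c I
    have hfp : (b :: (m ++ b' :: t)).formPerm =
        swap b c * ((m ++ [b']).formPerm * (b' :: t).formPerm) := by
      rw [← List.formPerm_append_cons, hcI', List.formPerm_cons_cons]
    intro d hd
    rcases eq_or_ne d b' with rfl | hdb
    · rw [hτ, mul_apply, swap_apply_right, hσ b hb, hlast, hcI']
      exact List.formPerm_apply_head b c _ (hcI' ▸ hnd')
    · have hdb0 : d ≠ b := fun h' => hbI (h' ▸ hd)
      have hdt : d ∉ b' :: t := by
        have hdm : d ∈ m := by simpa [hdb] using hd
        have := (List.nodup_append.1 (List.nodup_cons.1 hnd').2).2.2 d hdm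
        exact fun h' => this d h' rfl
      rw [hτ, mul_apply, swap_apply_of_ne_of_ne hdb0 hdb, hσ d (hI d hd), hfp, mul_apply, mul_apply,
        List.formPerm_apply_of_notMem hdt]
      refine swap_apply_of_ne_of_ne ?_ ?_
      · exact fun h' => hbI (h' ▸ List.formPerm_apply_mem_of_mem hd)
      · rw [← hlast]
        exact fun h' => hdb ((m ++ [b']).formPerm.injective h')
  have hτt : ∀ d, d ≠ b → d ≠ b' → τ d = σ d := fun d h1 h2 => by
    rw [hτ, mul_apply, swap_apply_of_ne_of_ne h1 h2]
  have hτeuler : 0 ≤ eulerDefect τ u.opp :=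
    h.euler.trans (eulerDefect_le_mul_swap σ u.opp (Or.inr hc))
  -- the two parts of the root belong to different components
  set R := SameCycle.setoid τ ⊔ SameCycle.setoid u.opp with hR
  -- vertices and faces both increase by one, so the genus would become negative otherwise
  have hsep : ¬ R b b' := by
    intro hbR
    obtain ⟨h1, h2, h3⟩ := classCount_mul_swap σ u.opp hbb'
    have hs := h.sameCycle_of_mem hb hb'
    have h3 := h3 (Or.inl hs)
    rw [if_pos hs] at h1
    rw [if_pos hc] at h2
    rw [if_pos hbR] at h3
    have h4 := eulerDefect_nonpos τ u.opp u.opp_opp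
    have h5 := h.euler
    rw [eulerDefect] at h4 h5
    rw [← hτ] at h1 h2 h3
    omega
  have hτR : ∀ d, R d (τ d) := fun d =>
    le_sup_left (b := SameCycle.setoid u.opp) (SameCycle.setoid_apply τ d)
  -- the other darts of the root stay connected to `b`
  have htR : ∀ q z r, t = q ++ z :: r → R b z := by
    intro q
    induction q using List.reverseRecOn with
    | nil =>
      intro z r hq
      have : τ b = z := by
        rw [hτ, mul_apply, swap_apply_left, hσ b' hb', hq]
        exact List.formPerm_apply_append (p := b :: m) (by rw [hq] at hnd'; exact hnd')
      rw [← this]; exact hτR b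
    | append_singleton q y ih =>
      intro z r hq
      have hy := ih y (z :: r) (by simpa using hq)
      have hyt : y ∈ t := by simp [hq]
      have e1 : y ≠ b := by
        rintro rfl
        have := (List.nodup_cons.1 hnd').1
        simp [hyt] at this
      have e2 : y ≠ b' := by
        rintro rfl
        have := (List.nodup_append.1 (List.nodup_cons.1 hnd').2).2.1
        simp [hyt] at this
      have : τ y = z := by
        rw [hτt y e1 e2, hσ y ((hmem y).2 (by simp [hyt])), hq]
        have := List.formPerm_apply_append (p := b :: (m ++ b' :: q)) (x := y) (y := z) (s := r)
          (by rw [hq] at hnd'; simpa using hnd')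
        simpa using this
      exact Setoid.trans' _ hy (this ▸ hτR y)
  have hsub : ∀ d, R b' d → d ∈ bl → d ∈ m ++ [b'] := by
    intro d hd hdb
    rw [hmem] at hdb
    simp only [List.mem_cons, List.mem_append] at hdb ⊢
    rcases hdb with rfl | hdm | rfl | hdt
    · exact absurd (Setoid.symm' _ hd) hsep
    · exact Or.inl hdm
    · simp
    · obtain ⟨q, r, hqr⟩ := List.append_of_mem hdt
      exact absurd (Setoid.trans' _ (htR q d r hqr) (Setoid.symm' _ hd)) hsep
  have hIR : ∀ d ∈ m ++ [b'], R b' d := by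
    intro d hd
    obtain ⟨i, hi⟩ := (hndI.isCycleOn_formPerm.2 (show b' ∈ m ++ [b'] by simp) hd).exists_nat_pow_eq
    have : ∀ i : ℕ, R b' (((m ++ [b']).formPerm ^ i) b') ∧
        ((m ++ [b']).formPerm ^ i) b' ∈ m ++ [b'] := by
      intro i
      induction i with
      | zero => exact ⟨Setoid.refl' _ _, by simp⟩
      | succ i ih =>
        rw [pow_succ', mul_apply]
        refine ⟨?_, List.formPerm_apply_mem_of_mem ih.2⟩
        rw [← hτI _ ih.2]
        exact Setoid.trans' _ ih.1 (hτR _)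
    exact hi ▸ (this i).1
  have hAR : ∀ d, R b' d → d ∈ A := by
    have hτA : ∀ d, τ d ∈ A ↔ d ∈ A := by
      intro d
      rw [hτ, mul_apply, h.apply_mem_iff]
      rcases eq_or_ne d b with rfl | h1
      · rw [swap_apply_left]; exact iff_of_true (h.mem_of_mem _ hb') (h.mem_of_mem _ hb)
      · rcases eq_or_ne d b' with rfl | h2
        · rw [swap_apply_right]; exact iff_of_true (h.mem_of_mem _ hb) (h.mem_of_mem _ hb')
        · rw [swap_apply_of_ne_of_ne h1 h2]
    have hle : R ≤ Setoid.ker (fun x => x ∈ A) :=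
      sup_le (SameCycle.setoid_le fun x => propext (hτA x).symm)
        (SameCycle.setoid_le fun x => propext (h.opp_mem_iff x).symm)
    intro d hd
    exact (iff_of_eq (hle hd)).1 (h.mem_of_mem _ hb')
  have hRτ : ∀ d, R b' (τ d) ↔ R b' d := fun d =>
    ⟨fun h' => Setoid.trans' _ h' (Setoid.symm' _ (hτR d)), fun h' => Setoid.trans' _ h' (hτR d)⟩
  -- the new part is the component of `b'`, and all other darts are cut off
  let ρ : Perm u.Dart := ofSubtype (τ.subtypePerm hRτ)
  have hρ1 : ∀ d, R b' d → ρ d = τ d := fun d hd => ofSubtype_apply_of_mem _ hd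
  have hρ2 : ∀ d, ¬ R b' d → ρ d = d := fun d hd => ofSubtype_apply_of_not_mem _ hd
  have hnb : ∀ d, R b' d → d ∉ m ++ [b'] → d ∈ A ∧ d ∉ bl ∧ τ d = σ d := by
    intro d hd hdm
    have : d ∉ bl := fun h' => hdm (hsub d hd h')
    exact ⟨hAR d hd, this, hτt d (fun h' => this (h' ▸ hb)) (fun h' => this (h' ▸ hb'))⟩
  refine ⟨{d | R b' d}, ρ, ⟨hndI, hIR, ?_, ?_, ?_, ?_, ?_, fun d hd => hρ2 d hd, ?_, ?_⟩, hAR, hsub⟩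
  · intro d hd
    exact Setoid.trans' _ hd
      (le_sup_right (a := SameCycle.setoid τ) (SameCycle.setoid_apply u.opp d))
  · intro d hd hdm
    exact h.notMem_range d (hnb d hd hdm).1 (hnb d hd hdm).2.1
  · intro d hd hdm
    obtain ⟨h1, h2, h3⟩ := hnb d hd hdm
    rw [← h.eq_rot d h1 h2, ← h3]
    exact (hRτ d).2 hd
  · intro d hd hdm
    obtain ⟨h1, h2, h3⟩ := hnb d hd hdm
    exact fun h' => h.rot_notMem d h1 h2 (hI _ h')
  · intro d hd hdm
    obtain ⟨h1, h2, h3⟩ := hnb d hd hdm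
    rw [hρ1 d hd, h3, h.eq_rot d h1 h2]
  · intro d hd
    rw [hρ1 d (hIR d hd), hτI d hd]
  · refine hτeuler.trans (eulerDefect_le_of_forall u.opp fun d => ?_)
    by_cases hd : R b' d
    · exact Or.inl (hρ1 d hd)
    · exact Or.inr (hρ2 d hd)

/-- Every lower part of a non-elliptic web that touches the line has a corner that can be peeled
off. -/
theorem exists_isCorner (hu : u.NonElliptic) (h : u.IsLowerPart A bl σ) (hbl : bl ≠ []) :
    ∃ p b₁ b₂ s, bl = p ++ b₁ :: b₂ :: s ∧ u.IsCorner bl b₁ b₂ := by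
  classical
  induction hk : bl.length using Nat.strong_induction_on generalizing A bl σ with
  | _ k ih =>
    by_cases hc : ∀ b ∈ bl, ∀ b' ∈ bl, SameCycle (σ⁻¹ * u.opp) b b' → b = b'
    · exact h.exists_isCorner_of_injective hu hbl hc
    · push Not at hc
      obtain ⟨b, hb, b', hb', hcyc, hne⟩ := hc
      obtain ⟨p, m, s, b, b', hl, hcyc⟩ : ∃ p m s b b', bl = p ++ b :: (m ++ b' :: s) ∧
          SameCycle (σ⁻¹ * u.opp) b b' := by
        obtain ⟨p, t, hl⟩ := List.append_of_mem hb
        rw [hl, List.mem_append, List.mem_cons] at hb'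
        rcases hb' with hb' | rfl | hb'
        · obtain ⟨q, r, hqr⟩ := List.append_of_mem hb'
          exact ⟨q, r, t, b', b, by simp [hl, hqr], hcyc.symm⟩
        · exact absurd rfl hne
        · obtain ⟨q, r, hqr⟩ := List.append_of_mem hb'
          exact ⟨p, q, r, b, b', by simp [hl, hqr], hcyc⟩
      -- a corner of the separated part, which has a shorter line, is a corner of the whole part
      obtain ⟨A', σ', h', hA', hsub⟩ := h.exists_lowerPart_of_sameCycle hl hcyc
      obtain ⟨p', b₁, b₂, s', hl', hcor⟩ := ih (m ++ [b']).length (by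
        rw [← hk, hl]; simp; omega) h' (by simp) rfl
      refine ⟨p ++ b :: p', b₁, b₂, s' ++ s, ?_, ?_⟩
      · rw [hl, show m ++ b' :: s = (m ++ [b']) ++ s by simp, hl']; simp
      · have m1 : b₁ ∈ A' := h'.mem_of_mem b₁ (by simp [hl'])
        have m2 : b₂ ∈ A' := h'.mem_of_mem b₂ (by simp [hl'])
        have tr : ∀ d ∈ A', d ∉ m ++ [b'] → d ∉ bl := fun d hd hdm h'' => hdm (hsub d hd h'')
        rcases hcor with h1 | ⟨h1, h2, h3⟩ | ⟨h1, h2, h3, h4, c, h5, h6, h7, h8⟩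
        · exact Or.inl h1
        · exact Or.inr (Or.inl ⟨tr _ (h'.opp_mem _ m1) h1, tr _ (h'.opp_mem _ m2) h2, h3⟩)
        · have mc : c ∈ A' := by
            have e1 := h'.opp_mem _ m1
            have : c = u.rot (u.rot (u.opp b₁)) := by
              refine (u.rot.injective ?_).symm
              rw [h7]
              exact h'.rot_rot_rot e1 h1
            rw [this]
            exact h'.rot_mem _ (h'.rot_mem _ e1 h1) (h'.rot_notMem _ e1 h1)
          exact Or.inr (Or.inr ⟨tr _ (h'.opp_mem _ m1) h1, tr _ (h'.opp_mem _ m2) h2, h3, h4, c,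
            tr _ mc h5, tr _ (h'.opp_mem _ mc) h6, h7, h8⟩)

end IsLowerPart

end Web

/-! ### Cutting webs along lines -/

section Agrees

open Equiv Equiv.Perm

variable {D : Type*} [DecidableEq D]

/-- The permutation `σ` permutes the elements of the list `l` cyclically. -/
def AgreesWith (σ : Perm D) (l : List D) : Prop := l.Nodup ∧ ∀ d ∈ l, σ d = l.formPerm d

theorem AgreesWith.isRotated {σ : Perm D} {l l' : List D} (h : AgreesWith σ l) (hr : l ~r l') :
    AgreesWith σ l' :=
  ⟨hr.nodup_iff.1 h.1, fun d hd => by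
    rw [h.2 d (hr.mem_iff.2 hd), List.formPerm_eq_of_isRotated h.1 hr]⟩

theorem AgreesWith.append_comm {σ : Perm D} {l l' : List D} (h : AgreesWith σ (l ++ l')) :
    AgreesWith σ (l' ++ l) := h.isRotated List.isRotated_append

variable [Finite D] {α : Perm D}

/-- Cutting off some consecutive darts of a vertex. -/
theorem AgreesWith.exists_cut {σ : Perm D} {c l : List D} (h : AgreesWith σ (c ++ l)) :
    ∃ σ' : Perm D, eulerDefect σ α ≤ eulerDefect σ' α ∧ AgreesWith σ' l ∧ (∀ d ∈ c, σ' d = d) ∧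
      ∀ d ∉ c ++ l, σ' d = σ d := by
  induction c generalizing σ with
  | nil => exact ⟨σ, le_rfl, h, by simp, fun _ _ => rfl⟩
  | cons a c ih =>
    rw [List.cons_append] at h
    have hnd := List.nodup_cons.1 h.1
    have hmem : ∀ d, σ d ∈ a :: (c ++ l) → d ∈ a :: (c ++ l) := by
      intro d hd
      set e := (a :: (c ++ l)).formPerm⁻¹ (σ d) with he
      have h1 : (a :: (c ++ l)).formPerm e = σ d :=
        (a :: (c ++ l)).formPerm.apply_symm_apply (σ d)
      have h2 : e ∈ a :: (c ++ l) := by rw [← List.formPerm_mem_iff_mem, h1]; exact hd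
      rwa [← σ.injective ((h.2 e h2).trans h1)]
    -- cutting off the first dart `a`
    have hag : AgreesWith (swap a (σ a) * σ) (c ++ l) := by
      refine ⟨hnd.2, fun d hd => ?_⟩
      rw [mul_apply, h.2 d (List.mem_cons_of_mem _ hd), h.2 a List.mem_cons_self]
      cases hcl : c ++ l with
      | nil => rw [hcl] at hd; simp at hd
      | cons x t =>
        rw [hcl] at h hd
        rw [List.formPerm_apply_head a x t h.1, List.formPerm_cons_cons, mul_apply, swap_apply_self]
    obtain ⟨σ', h1, h2, h3, h4⟩ := ih hag
    have hout : ∀ d, d ≠ a → σ d ≠ a → (swap a (σ a) * σ) d = σ d := fun d h5 h6 => by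
      rw [mul_apply, swap_apply_of_ne_of_ne h6 fun h7 => h5 (σ.injective h7)]
    refine ⟨σ', (eulerDefect_le_swap_mul σ α a).trans h1, h2, ?_, ?_⟩
    · intro d hd
      rcases List.mem_cons.1 hd with rfl | hd
      · rw [h4 d hnd.1, mul_apply, swap_apply_right]
      · exact h3 d hd
    · intro d hd
      have hda : d ≠ a := fun h' => hd (by simp [h'])
      rw [h4 d fun h' => hd (List.mem_cons_of_mem _ h')]
      refine hout d hda fun h' => hd ?_
      exact hmem d (by simp [h'])

/-- Pulling a trivalent vertex with the darts `v₁`, `v₂`, `v₃` into the vertex of `b`, along the edge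
between `b` and `v₁`; this edge becomes a loop. -/
theorem AgreesWith.exists_merge {σ : Perm D} {b v₁ v₂ v₃ : D} {t : List D}
    (h : AgreesWith σ (b :: t)) (hb : α b = v₁) (h1 : σ v₁ = v₂) (h2 : σ v₂ = v₃)
    (h3 : σ v₃ = v₁) (hnd : (b :: v₁ :: v₂ :: v₃ :: t).Nodup) :
    ∃ σ' : Perm D, eulerDefect σ α ≤ eulerDefect σ' α ∧
      AgreesWith σ' (b :: v₁ :: v₂ :: v₃ :: t) ∧
      ∀ d ∉ b :: v₁ :: v₂ :: v₃ :: t, σ' d = σ d := by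
  have hv3 : σ⁻¹ (α b) = v₃ := Perm.inv_eq_iff_eq.2 (by rw [h3, hb])
  refine ⟨σ * swap b v₃, ?_, ⟨hnd, ?_⟩, ?_⟩
  · rw [← hv3]; exact eulerDefect_le_mul_swap_face σ α b
  · have hnd' := hnd
    simp only [List.nodup_cons, List.mem_cons, not_or] at hnd'
    obtain ⟨⟨n1, n2, n3, n4⟩, ⟨n5, n6, n7⟩, ⟨n8, n9⟩, n10, n11⟩ := hnd'
    intro d hd
    rw [mul_apply]
    rcases eq_or_ne d b with rfl | hdb
    · rw [swap_apply_left, h3, List.formPerm_apply_head _ _ _ hnd]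
    rcases eq_or_ne d v₃ with rfl | hd3
    · rw [swap_apply_right, h.2 b List.mem_cons_self]
      cases t with
      | nil =>
        rw [List.formPerm_singleton, one_apply]
        exact (List.formPerm_cons_concat_apply_last b d [v₁, v₂]).symm
      | cons c t =>
        rw [List.formPerm_apply_head b c t h.1]
        exact (List.formPerm_apply_append (p := [b, v₁, v₂]) hnd).symm
    rw [swap_apply_of_ne_of_ne hdb hd3]
    rcases eq_or_ne d v₁ with rfl | hd1
    · rw [h1]; exact (List.formPerm_apply_append (p := [b]) hnd).symm
    rcases eq_or_ne d v₂ with rfl | hd2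
    · rw [h2]; exact (List.formPerm_apply_append (p := [b, v₁]) hnd).symm
    have hdt : d ∈ t := by simpa [hdb, hd1, hd2, hd3] using hd
    rw [h.2 d (List.mem_cons_of_mem _ hdt)]
    cases t with
    | nil => simp at hdt
    | cons c t =>
      simp only [List.formPerm_cons_cons b, List.formPerm_cons_cons v₁,
        List.formPerm_cons_cons v₂, List.formPerm_cons_cons v₃, mul_apply]
      have he := List.formPerm_apply_mem_of_mem hdt
      generalize (c :: t).formPerm d = e at he
      rcases eq_or_ne e c with rfl | hec
      · simp only [swap_apply_right]
      · have m1 : e ≠ b := fun h' => n4 (by rw [← h']; simpa using he)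
        have m2 : e ≠ v₁ := fun h' => n7 (by rw [← h']; simpa using he)
        have m3 : e ≠ v₂ := fun h' => n9 (by rw [← h']; simpa using he)
        have m4 : e ≠ v₃ := fun h' => n10 (by rw [← h']; simpa using he)
        rw [swap_apply_of_ne_of_ne m1 hec, swap_apply_of_ne_of_ne m4 hec,
          swap_apply_of_ne_of_ne m3 m4, swap_apply_of_ne_of_ne m2 m3, swap_apply_of_ne_of_ne m1 m2]
  · intro d hd
    simp only [List.mem_cons, not_or] at hd
    rw [mul_apply, swap_apply_of_ne_of_ne hd.1 hd.2.2.2.1]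

end Agrees

namespace Web

variable {n : ℕ}

open Equiv Equiv.Perm

section Whole

theorem _root_.orbitRel_zpowers_eq {D : Type*} (σ : Perm D) :
    MulAction.orbitRel (Subgroup.zpowers σ) D = SameCycle.setoid σ := by
  refine Setoid.ext fun x y => ?_
  rw [MulAction.orbitRel_apply]
  constructor
  · rintro ⟨⟨_, k, rfl⟩, rfl⟩
    exact SameCycle.symm ⟨k, rfl⟩
  · intro h
    obtain ⟨k, rfl⟩ := SameCycle.symm h
    exact ⟨⟨σ ^ k, k, rfl⟩, rfl⟩

theorem _root_.orbitRel_closure_pair_eq {D : Type*} (σ τ : Perm D) :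
    MulAction.orbitRel (Subgroup.closure ({σ, τ} : Set (Perm D))) D =
      SameCycle.setoid σ ⊔ SameCycle.setoid τ := by
  refine le_antisymm ?_ (sup_le (SameCycle.setoid_le fun x => ?_) (SameCycle.setoid_le fun x => ?_))
  · have key : ∀ g ∈ Subgroup.closure ({σ, τ} : Set (Perm D)), ∀ y,
        (SameCycle.setoid σ ⊔ SameCycle.setoid τ) y (g y) := by
      intro g hg
      induction hg using Subgroup.closure_induction with
      | mem g hg =>
        intro y
        rcases hg with rfl | rfl
        · exact le_sup_left (b := SameCycle.setoid τ) (SameCycle.setoid_apply g y)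
        · exact le_sup_right (a := SameCycle.setoid σ) (SameCycle.setoid_apply g y)
      | one => exact fun y => Setoid.refl' _ _
      | mul g g' _ _ h h' => exact fun y => Setoid.trans' _ (h' y) (h (g' y))
      | inv g _ h =>
        intro y
        have := h (g⁻¹ y)
        rw [show g (g⁻¹ y) = y from g.apply_symm_apply y] at this
        exact Setoid.symm' _ this
    rintro x y ⟨⟨g, hg⟩, rfl⟩
    exact Setoid.symm' _ (key g hg y)
  · refine Setoid.symm' _ ⟨⟨σ, Subgroup.subset_closure (by simp)⟩, rfl⟩
  · refine Setoid.symm' _ ⟨⟨τ, Subgroup.subset_closure (by simp)⟩, rfl⟩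

theorem eulerDefect_rot (u : Web n) : eulerDefect u.rot u.opp = 0 := by
  have h := u.planar
  unfold MulAction.orbitRel.Quotient at h
  rw [orbitRel_zpowers_eq, orbitRel_zpowers_eq, orbitRel_zpowers_eq, orbitRel_closure_pair_eq] at h
  rw [eulerDefect]
  unfold classCount
  omega

theorem isLowerPart_univ (u : Web n) :
    u.IsLowerPart Set.univ (List.ofFn u.bd) u.rot := by
  classical
  have hmem : ∀ d, d ∉ List.ofFn u.bd → d ∉ Set.range u.bd := fun d hd h' => hd (by
    rw [List.mem_ofFn]; exact h')
  have hnd : (List.ofFn u.bd).Nodup := List.nodup_ofFn.2 u.bd_injective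
  refine ⟨hnd, fun _ _ => trivial, fun _ _ => trivial,
    fun d _ hd => hmem d hd, fun _ _ _ => trivial, ?_, fun _ _ _ => rfl,
    fun d hd => absurd trivial hd, ?_, u.eulerDefect_rot.ge⟩
  · intro d _ hd h'
    refine hd ?_
    rw [List.mem_ofFn] at h' ⊢
    obtain ⟨p, hp⟩ := h'
    refine ⟨(finRotate n).symm p, u.rot.injective ?_⟩
    rw [u.rot_bd, Equiv.apply_symm_apply, hp]
  · intro d hd
    obtain ⟨p, rfl⟩ := List.mem_ofFn.1 hd
    have h1 := List.formPerm_apply_getElem (List.ofFn u.bd) hnd p (by simp)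
    simp only [List.getElem_ofFn, List.length_ofFn, Fin.eta] at h1
    rw [h1, u.rot_bd]
    congr 1
    cases n with
    | zero => exact p.elim0
    | succ n => rw [finRotate_apply]; exact Fin.ext (by simp [Fin.val_add])

/-- Every dart of a non-elliptic web is connected to the boundary. -/
theorem induction_on_connected (u : Web n) (hu : u.NonElliptic) {P : u.Dart → Prop}
    (hbd : ∀ p, P (u.bd p)) (hrot : ∀ d, P d → P (u.rot d)) (hopp : ∀ d, P d → P (u.opp d))
    (d : u.Dart) : P d := by
  classical
  have := u.fin
  have hbd' : ∀ d, ¬ P d → d ∉ Set.range u.bd := by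
    rintro d hd ⟨p, rfl⟩
    exact hd (hbd p)
  have hrot' : ∀ d, ¬ P (u.rot d) ↔ ¬ P d := by
    intro d
    refine not_congr ⟨fun h => ?_, hrot d⟩
    by_contra hd
    refine hd ?_
    rw [← (u.trivalent d (hbd' d hd)).1]
    exact hrot _ (hrot _ h)
  let ρ : Perm u.Dart := ofSubtype (u.rot.subtypePerm (p := fun d => ¬ P d) hrot')
  have hρ1 : ∀ d, ¬ P d → ρ d = u.rot d := fun d hd =>
    ofSubtype_apply_of_mem (p := fun d => ¬ P d) _ hd
  have hρ2 : ∀ d, ¬ ¬ P d → ρ d = d := fun d hd =>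
    ofSubtype_apply_of_not_mem (p := fun d => ¬ P d) _ hd
  -- the components that do not touch the boundary form a closed non-elliptic web, which is empty
  have h : u.IsLowerPart {d | ¬ P d} [] ρ := by
    refine ⟨List.nodup_nil, by simp, ?_, fun d hd _ => hbd' d hd, fun d hd _ => (hrot' d).2 hd,
      by simp, fun d hd _ => hρ1 d hd, hρ2, by simp, ?_⟩
    · intro d hd h'
      exact hd (u.opp_opp d ▸ hopp _ h')
    · rw [← u.eulerDefect_rot]
      refine eulerDefect_le_of_forall u.opp fun d => ?_
      by_cases hd : P d
      · exact Or.inr (hρ2 d (not_not.2 hd))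
      · exact Or.inl (hρ1 d hd)
  have := h.eq_empty hu
  by_contra hd
  have hd' : d ∈ {d | ¬ P d} := hd
  rw [this] at hd'
  exact hd'

end Whole

namespace IsLowerPart

variable {u : Web n} {A : Set u.Dart} {p s : List u.Dart} {b₁ b₂ : u.Dart} {σ : Perm u.Dart}

theorem agreesWith [DecidableEq u.Dart] {bl : List u.Dart} (h : u.IsLowerPart A bl σ) :
    AgreesWith σ bl :=
  ⟨h.nodup, fun d hd => by rw [h.eq_formPerm d hd]; congr!⟩

/-- Cutting off an arc. -/
theorem exists_of_arc (h : u.IsLowerPart A (p ++ b₁ :: b₂ :: s) σ) (h₁ : u.opp b₁ = b₂) :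
    ∃ σ', u.IsLowerPart (A \ {b₁, b₂}) (p ++ s) σ' := by
  classical
  have := u.fin
  have hag : AgreesWith σ ([b₁, b₂] ++ (s ++ p)) := by
    simpa using h.agreesWith.append_comm
  obtain ⟨σ', e1, e2, e3, e4⟩ := hag.exists_cut (α := u.opp)
  have hbl : ∀ d ∈ A \ {b₁, b₂}, d ∉ p ++ s → d ∉ p ++ b₁ :: b₂ :: s := by
    rintro d ⟨-, hd⟩ hd'
    simp only [Set.mem_insert_iff, Set.mem_singleton_iff] at hd
    simp only [List.mem_append, List.mem_cons] at hd' ⊢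
    tauto
  have hbl' : ∀ d, d ∉ p ++ b₁ :: b₂ :: s → d ∉ p ++ s ∧ d ≠ b₁ ∧ d ≠ b₂ := by
    intro d hd
    simp only [List.mem_append, List.mem_cons] at hd ⊢
    tauto
  have hσ' : ∀ d, d ∉ p ++ b₁ :: b₂ :: s → σ' d = σ d := by
    intro d hd
    refine e4 d ?_
    simp only [List.mem_append, List.mem_cons, List.not_mem_nil] at hd ⊢
    tauto
  have e5 := e2.append_comm
  have hnd := hag.1
  simp only [List.nodup_append, List.mem_cons] at hnd
  refine ⟨σ', e5.1, ?_, ?_, ?_, ?_, ?_, ?_, ?_, ?_, h.euler.trans e1⟩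
  · intro d hd
    refine ⟨h.mem_of_mem d ?_, ?_⟩
    · simp only [List.mem_append, List.mem_cons] at hd ⊢; tauto
    · have := hnd.2.2
      rintro (rfl | rfl)
      · exact this d (Or.inl rfl) d (List.mem_append.2 (List.mem_append.1 hd).symm) rfl
      · exact this d (Or.inr (Or.inl rfl)) d (List.mem_append.2 (List.mem_append.1 hd).symm) rfl
  · rintro d ⟨hdA, hd⟩
    refine ⟨h.opp_mem d hdA, fun h' => hd ?_⟩
    rcases h' with h' | h'
    · right; rw [← h₁, ← h', u.opp_opp]; rfl
    · left; rw [← h₁] at h'; exact u.opp.injective h'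
  · exact fun d hd hd' => h.notMem_range d hd.1 (hbl d hd hd')
  · intro d hd hd'
    have h1 := hbl' _ (h.rot_notMem d hd.1 (hbl d hd hd'))
    exact ⟨h.rot_mem d hd.1 (hbl d hd hd'), by simp [h1.2]⟩
  · exact fun d hd hd' => (hbl' _ (h.rot_notMem d hd.1 (hbl d hd hd'))).1
  · intro d hd hd'
    rw [hσ' d (hbl d hd hd'), h.eq_rot d hd.1 (hbl d hd hd')]
  · intro d hd
    by_cases hdc : d ∈ [b₁, b₂]
    · exact e3 d hdc
    · have hdA : d ∉ A := fun h' => hd ⟨h', by simpa using hdc⟩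
      rw [hσ' d fun h' => hdA (h.mem_of_mem d h'), h.eq_self d hdA]
  · exact fun d hd => e5.2 d hd

/-- Cutting below a trivalent vertex that is joined to the line by two consecutive edges. -/
theorem exists_of_fork (h : u.IsLowerPart A (p ++ b₁ :: b₂ :: s) σ)
    (h₁ : u.opp b₁ ∉ p ++ b₁ :: b₂ :: s) (h₂ : u.opp b₂ ∉ p ++ b₁ :: b₂ :: s)
    (h₃ : u.rot (u.opp b₂) = u.opp b₁) :
    ∃ σ', u.IsLowerPart (A \ {b₁, b₂, u.opp b₁, u.opp b₂}) (p ++ u.rot (u.opp b₁) :: s) σ' := by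
  classical
  have := u.fin
  have hb₁ : b₁ ∈ A := h.mem_of_mem b₁ (by simp)
  have hb₂ : b₂ ∈ A := h.mem_of_mem b₂ (by simp)
  have hx := h.opp_mem b₁ hb₁
  have hy := h.opp_mem b₂ hb₂
  have hz := h.rot_mem _ hx h₁
  have hz' := h.rot_notMem _ hx h₁
  have hzy : u.rot (u.rot (u.opp b₁)) = u.opp b₂ := by
    rw [← h₃, h.rot_rot_rot hy h₂]
  have hxy : u.opp b₁ ≠ u.opp b₂ := fun h' => h.rot_ne hy h₂ (h₃.trans h')
  have hzx : u.rot (u.opp b₁) ≠ u.opp b₁ := h.rot_ne hx h₁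
  have hzy' : u.rot (u.opp b₁) ≠ u.opp b₂ := fun h' => h.rot_ne hz hz' (hzy.trans h'.symm)
  have ebl : ∀ d, d ∉ p ++ b₁ :: b₂ :: s ↔ (d ∉ p ∧ d ∉ s) ∧ d ≠ b₁ ∧ d ≠ b₂ := by
    intro d
    simp only [List.mem_append, List.mem_cons]
    tauto
  -- the vertex has the darts `x`, `z`, `y` in counterclockwise order, and `z` points down
  generalize hxe : u.opp b₁ = x at *
  generalize hye : u.opp b₂ = y at *
  generalize hze : u.rot x = z at *
  have hag : AgreesWith σ (b₁ :: b₂ :: (s ++ p)) := by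
    simpa using h.agreesWith.append_comm
  have hnd : (b₁ :: x :: z :: y :: b₂ :: (s ++ p)).Nodup := by
    have := hag.1
    rw [ebl] at h₁ h₂ hz'
    simp only [List.nodup_cons, List.mem_cons, List.mem_append, not_or] at this ⊢
    simp only [ne_eq] at *
    refine ⟨⟨Ne.symm h₁.2.1, Ne.symm hz'.2.1, Ne.symm h₂.2.1, this.1⟩, ⟨Ne.symm hzx, hxy, h₁.2.2, h₁.1.2, h₁.1.1⟩,
      ⟨hzy', hz'.2.2, hz'.1.2, hz'.1.1⟩, ⟨h₂.2.2, h₂.1.2, h₂.1.1⟩, this.2⟩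
  -- the vertex is pulled into the line along the edge of `b₁`, and then the darts of the two edges
  -- above it are cut off, which leaves `z` between `p` and `s`
  obtain ⟨σ₁, e1, a1, o1⟩ := hag.exists_merge (α := u.opp) hxe ((h.eq_rot x hx h₁).trans hze)
    ((h.eq_rot z hz hz').trans hzy) ((h.eq_rot y hy h₂).trans h₃) hnd
  have a1' : AgreesWith σ₁ ([y, b₂] ++ ((s ++ p) ++ [b₁, x, z])) := by
    have := AgreesWith.append_comm (l := [b₁, x, z]) (l' := y :: b₂ :: (s ++ p)) a1
    simpa using this
  obtain ⟨σ₂, e2, a2, f2, o2⟩ := a1'.exists_cut (α := u.opp)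
  have a2' : AgreesWith σ₂ ([b₁, x] ++ (z :: (s ++ p))) := a2.append_comm
  obtain ⟨σ₃, e3, a3, f3, o3⟩ := a2'.exists_cut (α := u.opp)
  have a3' : AgreesWith σ₃ (p ++ z :: s) := by
    have := AgreesWith.append_comm (l := z :: s) (l' := p) (by simpa using a3)
    exact this
  have hout : ∀ d, d ∉ p ++ b₁ :: b₂ :: s → d ≠ x → d ≠ y → d ≠ z → σ₃ d = σ d := by
    intro d hd d1 d2 d3
    rw [ebl] at hd
    rw [o3, o2, o1]
    · simp only [List.mem_cons, List.mem_append, not_or]; tauto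
    · simp only [List.mem_cons, List.mem_append, not_or, List.not_mem_nil]; tauto
    · simp only [List.mem_cons, List.mem_append, not_or, List.not_mem_nil]; tauto
  have hfix : ∀ d, d = b₁ ∨ d = b₂ ∨ d = x ∨ d = y → σ₃ d = d := by
    have hnd' := hnd
    simp only [List.nodup_cons, List.mem_cons, List.mem_append, not_or] at hnd'
    intro d hd
    by_cases hdc : d ∈ [b₁, x]
    · exact f3 d hdc
    · have hd' : d = b₂ ∨ d = y := by
        simp only [List.mem_cons, List.not_mem_nil] at hdc; tauto
      rw [o3, f2]
      · rcases hd' with rfl | rfl <;> simp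
      · rcases hd' with rfl | rfl
        · simp only [List.mem_cons, List.mem_append, not_or, List.not_mem_nil]
          refine ⟨⟨hnd'.1.2.2.2.1 ∘ Eq.symm, hnd'.2.1.2.2.1 ∘ Eq.symm, not_false⟩, hnd'.2.2.1.2.1 ∘ Eq.symm, hnd'.2.2.2.2.1⟩
        · simp only [List.mem_cons, List.mem_append, not_or, List.not_mem_nil]
          refine ⟨⟨hnd'.1.2.2.1 ∘ Eq.symm, hnd'.2.1.2.1 ∘ Eq.symm, not_false⟩, hnd'.2.2.1.1 ∘ Eq.symm, hnd'.2.2.2.1.2⟩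
  have hbl : ∀ d ∈ A \ {b₁, b₂, x, y}, d ∉ p ++ z :: s →
      d ∉ p ++ b₁ :: b₂ :: s ∧ d ≠ x ∧ d ≠ y ∧ d ≠ z := by
    rintro d ⟨-, hd⟩ hd'
    simp only [Set.mem_insert_iff, Set.mem_singleton_iff, not_or] at hd
    simp only [List.mem_append, List.mem_cons, not_or] at hd'
    rw [ebl]
    tauto
  refine ⟨σ₃, a3'.1, ?_, ?_, ?_, ?_, ?_, ?_, ?_, ?_, h.euler.trans (e1.trans (e2.trans e3))⟩
  · intro d hd
    rw [ebl] at h₁ h₂ hz'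
    have := hag.1
    simp only [List.nodup_cons, List.mem_cons, List.mem_append, not_or] at this hd
    simp only [Set.mem_sdiff, Set.mem_insert_iff, Set.mem_singleton_iff, not_or]
    have hmem : d = z ∨ d ∈ p ∨ d ∈ s := by tauto
    rcases hmem with rfl | hmem
    · exact ⟨hz, hz'.2.1, hz'.2.2, hzx, hzy'⟩
    · refine ⟨h.mem_of_mem d ?_, ?_, ?_, ?_, ?_⟩
      · simp only [List.mem_append, List.mem_cons]; tauto
      · rintro rfl; tauto
      · rintro rfl; tauto
      · rintro rfl; tauto
      · rintro rfl; tauto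
  · rintro d ⟨hdA, hd⟩
    simp only [Set.mem_insert_iff, Set.mem_singleton_iff, not_or] at hd
    refine ⟨h.opp_mem d hdA, ?_⟩
    simp only [Set.mem_insert_iff, Set.mem_singleton_iff, not_or]
    refine ⟨fun h' => hd.2.2.1 ?_, fun h' => hd.2.2.2 ?_, fun h' => hd.1 ?_, fun h' => hd.2.1 ?_⟩
    · rw [← hxe, ← h', u.opp_opp]
    · rw [← hye, ← h', u.opp_opp]
    · exact u.opp.injective (h'.trans hxe.symm)
    · exact u.opp.injective (h'.trans hye.symm)
  · exact fun d hd hd' => h.notMem_range d hd.1 (hbl d hd hd').1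
  · intro d hd hd'
    obtain ⟨g1, g2, g3, g4⟩ := hbl d hd hd'
    have g5 := h.rot_notMem d hd.1 g1
    rw [ebl] at g5
    refine ⟨h.rot_mem d hd.1 g1, ?_⟩
    simp only [Set.mem_insert_iff, Set.mem_singleton_iff, not_or]
    exact ⟨g5.2.1, g5.2.2, fun h' => g3 (u.rot.injective (h'.trans h₃.symm)),
      fun h' => g4 (u.rot.injective (h'.trans hzy.symm))⟩
  · intro d hd hd'
    obtain ⟨g1, g2, g3, g4⟩ := hbl d hd hd'
    have g5 := h.rot_notMem d hd.1 g1
    rw [ebl] at g5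
    have g6 : u.rot d ≠ z := fun h' => g2 (u.rot.injective (h'.trans hze.symm))
    simp only [List.mem_append, List.mem_cons, not_or]
    tauto
  · intro d hd hd'
    obtain ⟨g1, g2, g3, g4⟩ := hbl d hd hd'
    rw [hout d g1 g2 g3 g4, h.eq_rot d hd.1 g1]
  · intro d hd
    by_cases hdc : d = b₁ ∨ d = b₂ ∨ d = x ∨ d = y
    · exact hfix d hdc
    · have hdA : d ∉ A := fun h' => hd ⟨h', by simpa using hdc⟩
      rw [hout d (fun h' => hdA (h.mem_of_mem d h')), h.eq_self d hdA]
      · rintro rfl; exact hdA hx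
      · rintro rfl; exact hdA hy
      · rintro rfl; exact hdA hz
  · exact fun d hd => a3'.2 d hd

end IsLowerPart

end Web

namespace Web

variable {n : ℕ}

open Equiv Equiv.Perm

namespace IsLowerPart

variable {u : Web n} {A : Set u.Dart} {p s : List u.Dart} {b₁ b₂ : u.Dart} {σ : Perm u.Dart}

set_option maxHeartbeats 1000000 in
/-- Cutting through the middle of an `H`, whose rung is the edge of `c`. -/
theorem exists_of_rung (h : u.IsLowerPart A (p ++ b₁ :: b₂ :: s) σ) {c : u.Dart}
    (h₁ : u.opp b₁ ∉ p ++ b₁ :: b₂ :: s) (h₂ : u.opp b₂ ∉ p ++ b₁ :: b₂ :: s)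
    (ho₁ : u.out b₁ = false) (ho₂ : u.out b₂ = true)
    (hc : c ∉ p ++ b₁ :: b₂ :: s) (hc' : u.opp c ∉ p ++ b₁ :: b₂ :: s)
    (h₃ : u.rot c = u.opp b₁) (h₄ : u.rot (u.opp b₂) = u.opp c) :
    ∃ σ', u.IsLowerPart (A \ {b₁, b₂, u.opp b₁, u.opp b₂, c, u.opp c})
      (p ++ u.rot (u.opp b₁) :: u.rot (u.opp c) :: s) σ' := by
  classical
  have := u.fin
  have hb₁ : b₁ ∈ A := h.mem_of_mem b₁ (by simp)
  have hb₂ : b₂ ∈ A := h.mem_of_mem b₂ (by simp)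
  have hx := h.opp_mem b₁ hb₁
  have hy := h.opp_mem b₂ hb₂
  have ha := h.rot_mem _ hx h₁
  have ha' := h.rot_notMem _ hx h₁
  have hac : u.rot (u.rot (u.opp b₁)) = c := by
    refine u.rot.injective ?_
    rw [h.rot_rot_rot hx h₁, h₃]
  have hcA : c ∈ A := hac ▸ h.rot_mem _ ha ha'
  have hcA' := h.opp_mem c hcA
  have hb := h.rot_mem _ hcA' hc'
  have hb' := h.rot_notMem _ hcA' hc'
  have hby : u.rot (u.rot (u.opp c)) = u.opp b₂ := by
    rw [← h₄, h.rot_rot_rot hy h₂]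
  have ox : u.out (u.opp b₁) = true := by rw [u.out_opp, ho₁]; rfl
  have oy : u.out (u.opp b₂) = false := by rw [u.out_opp, ho₂]; rfl
  have oa : u.out (u.rot (u.opp b₁)) = true := by rw [h.out_rot hx h₁, ox]
  have oc : u.out c = true := by rw [← hac, h.out_rot ha ha', oa]
  have oc' : u.out (u.opp c) = false := by rw [u.out_opp, oc]; rfl
  have ob : u.out (u.rot (u.opp c)) = false := by rw [h.out_rot hcA' hc', oc']
  have n1 : u.rot (u.opp b₁) ≠ u.opp b₁ := h.rot_ne hx h₁
  have n2 : u.rot (u.opp b₁) ≠ c := fun h' => h.rot_ne ha ha' (hac.trans h'.symm)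
  have n3 : u.opp b₁ ≠ c := fun h' => h.rot_ne hcA hc (h₃.trans h')
  have n4 : u.opp c ≠ u.opp b₂ := fun h' => h.rot_ne hy h₂ (h₄.trans h')
  have n5 : u.rot (u.opp c) ≠ u.opp c := h.rot_ne hcA' hc'
  have n6 : u.rot (u.opp c) ≠ u.opp b₂ := fun h' => h.rot_ne hb hb' (hby.trans h'.symm)
  have ebl : ∀ d, d ∉ p ++ b₁ :: b₂ :: s ↔ (d ∉ p ∧ d ∉ s) ∧ d ≠ b₁ ∧ d ≠ b₂ := by
    intro d
    simp only [List.mem_append, List.mem_cons]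
    tauto
  -- the upper ends `b₁`, `b₂` of the `H`, its left vertex with the darts `x`, `a`, `c`, and its right
  -- vertex with the darts `y`, `c'`, `b`, in counterclockwise order; `a` and `b` point down
  generalize hxe : u.opp b₁ = x at *
  generalize hye : u.opp b₂ = y at *
  generalize hae : u.rot x = a at *
  generalize hce : u.opp c = c' at *
  generalize hbe : u.rot c' = b at *
  -- the left vertex is a source and the right one a sink, so their darts are different
  have hne : ∀ {d e}, u.out d = true → u.out e = false → d ≠ e := by
    intro d e hd he hde
    rw [hde, he] at hd
    exact Bool.noConfusion hd
  have nxy := hne ox oy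
  have nxc' := hne ox oc'
  have nxb := hne ox ob
  have nay := hne oa oy
  have nac' := hne oa oc'
  have nab := hne oa ob
  have ncy := hne oc oy
  have ncc' := hne oc oc'
  have ncb := hne oc ob
  have hag : AgreesWith σ (b₁ :: b₂ :: (s ++ p)) := by
    simpa using h.agreesWith.append_comm
  have hnd0 := hag.1
  have g₁ := (ebl _).1 h₁
  have g₂ := (ebl _).1 h₂
  have ga := (ebl _).1 ha'
  have gb := (ebl _).1 hb'
  have gc := (ebl _).1 hc
  have gc' := (ebl _).1 hc'
  simp only [List.nodup_cons, List.mem_cons, List.mem_append, not_or] at hnd0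
  obtain ⟨⟨n7, n8, n9⟩, ⟨n10, n11⟩, n12⟩ := hnd0
  have hnd : (b₁ :: x :: a :: c :: b₂ :: (s ++ p)).Nodup := by
    simp only [List.nodup_cons, List.mem_cons, List.mem_append, not_or]
    grind
  -- the left vertex is pulled into the line along `b₁`, and the darts of this edge are cut off
  obtain ⟨σ₁, e1, a1, o1⟩ := hag.exists_merge (α := u.opp) hxe ((h.eq_rot x hx h₁).trans hae)
    ((h.eq_rot a ha ha').trans hac) ((h.eq_rot c hcA hc).trans h₃) hnd
  obtain ⟨σ₂, e2, a2, f2, o2⟩ :=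
    AgreesWith.exists_cut (α := u.opp) (c := [b₁, x]) (l := a :: c :: b₂ :: (s ++ p)) a1
  have a2' : AgreesWith σ₂ (b₂ :: (s ++ p ++ [a, c])) :=
    AgreesWith.append_comm (l := [a, c]) (l' := b₂ :: (s ++ p)) a2
  have hold : ∀ d, d ∈ A → d ∉ p ++ b₁ :: b₂ :: s → d ≠ x → d ≠ a → d ≠ c → σ₂ d = u.rot d := by
    intro d hdA hd d1 d2 d3
    have hd' := (ebl d).1 hd
    rw [o2, o1, h.eq_rot d hdA hd]
    · simp only [List.mem_cons, List.mem_append, not_or]; tauto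
    · simp only [List.mem_cons, List.mem_append, not_or, List.not_mem_nil]; tauto
  have hnd2 : (b₂ :: y :: c' :: b :: (s ++ p ++ [a, c])).Nodup := by
    have := a2'.1
    simp only [List.nodup_cons, List.mem_cons, List.mem_append, not_or, List.not_mem_nil] at this ⊢
    grind
  -- the same for the right vertex; the rung is cut off as well, which leaves `a` and `b`
  obtain ⟨σ₃, e3, a3, o3⟩ := a2'.exists_merge (α := u.opp) hye
    ((hold y hy h₂ nxy.symm nay.symm ncy.symm).trans h₄)
    ((hold c' hcA' hc' nxc'.symm nac'.symm ncc'.symm).trans hbe)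
    ((hold b hb hb' nxb.symm nab.symm ncb.symm).trans hby) hnd2
  have a3' : AgreesWith σ₃ ([c, b₂, y, c'] ++ (b :: (s ++ p) ++ [a])) := by
    have := AgreesWith.append_comm (l := b₂ :: y :: c' :: b :: (s ++ p ++ [a])) (l' := [c])
      (by simpa using a3)
    simpa using this
  obtain ⟨σ₄, e4, a4, f4, o4⟩ := a3'.exists_cut (α := u.opp)
  have a4' : AgreesWith σ₄ (p ++ a :: b :: s) := by
    have := AgreesWith.append_comm (l := b :: s) (l' := p ++ [a]) (by simpa using a4)
    simpa using this
  have hout : ∀ d, d ∉ p ++ b₁ :: b₂ :: s → d ≠ x → d ≠ y → d ≠ a → d ≠ b → d ≠ c → d ≠ c' →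
      σ₄ d = σ d := by
    intro d hd d1 d2 d3 d4 d5 d6
    rw [ebl] at hd
    rw [o4, o3, o2, o1]
    · simp only [List.mem_cons, List.mem_append, not_or]; tauto
    · simp only [List.mem_cons, List.mem_append, not_or, List.not_mem_nil]; tauto
    · simp only [List.mem_cons, List.mem_append, not_or, List.not_mem_nil]; tauto
    · simp only [List.mem_cons, List.mem_append, not_or, List.not_mem_nil]; tauto
  have hfix : ∀ d, d = b₁ ∨ d = b₂ ∨ d = x ∨ d = y ∨ d = c ∨ d = c' → σ₄ d = d := by
    intro d hd
    by_cases hdc : d ∈ [c, b₂, y, c']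
    · exact f4 d hdc
    · have hd' : d = b₁ ∨ d = x := by
        simp only [List.mem_cons, List.not_mem_nil] at hdc; tauto
      rw [o4, o3, f2]
      · rcases hd' with rfl | rfl <;> simp
      · simp only [List.mem_cons, List.mem_append, not_or, List.not_mem_nil]
        rcases hd' with rfl | rfl <;> grind
      · simp only [List.mem_cons, List.mem_append, not_or, List.not_mem_nil]
        rcases hd' with rfl | rfl <;> grind
  have hbl : ∀ d ∈ A \ {b₁, b₂, x, y, c, c'}, d ∉ p ++ a :: b :: s →
      d ∉ p ++ b₁ :: b₂ :: s ∧ d ≠ x ∧ d ≠ y ∧ d ≠ a ∧ d ≠ b ∧ d ≠ c ∧ d ≠ c' := by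
    rintro d ⟨-, hd⟩ hd'
    simp only [Set.mem_insert_iff, Set.mem_singleton_iff, not_or] at hd
    simp only [List.mem_append, List.mem_cons, not_or] at hd'
    rw [ebl]
    tauto
  refine ⟨σ₄, a4'.1, ?_, ?_, ?_, ?_, ?_, ?_, ?_, ?_,
    h.euler.trans (e1.trans (e2.trans (e3.trans e4)))⟩
  · intro d hd
    simp only [List.mem_cons, List.mem_append] at hd
    simp only [Set.mem_sdiff, Set.mem_insert_iff, Set.mem_singleton_iff, not_or]
    have hmem : d = a ∨ d = b ∨ d ∈ p ∨ d ∈ s := by tauto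
    rcases hmem with rfl | rfl | hmem
    · exact ⟨ha, ga.2.1, ga.2.2, n1, nay, n2, nac'⟩
    · exact ⟨hb, gb.2.1, gb.2.2, nxb.symm, n6, ncb.symm, n5⟩
    · refine ⟨h.mem_of_mem d ?_, ?_⟩
      · simp only [List.mem_append, List.mem_cons]; tauto
      · refine ⟨?_, ?_, ?_, ?_, ?_, ?_⟩ <;> (rintro rfl; tauto)
  · rintro d ⟨hdA, hd⟩
    simp only [Set.mem_insert_iff, Set.mem_singleton_iff, not_or] at hd
    refine ⟨h.opp_mem d hdA, ?_⟩
    simp only [Set.mem_insert_iff, Set.mem_singleton_iff, not_or]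
    refine ⟨fun h' => hd.2.2.1 ?_, fun h' => hd.2.2.2.1 ?_, fun h' => hd.1 ?_, fun h' => hd.2.1 ?_,
      fun h' => hd.2.2.2.2.2 ?_, fun h' => hd.2.2.2.2.1 ?_⟩
    · rw [← hxe, ← h', u.opp_opp]
    · rw [← hye, ← h', u.opp_opp]
    · exact u.opp.injective (h'.trans hxe.symm)
    · exact u.opp.injective (h'.trans hye.symm)
    · rw [← hce, ← h', u.opp_opp]
    · exact u.opp.injective (h'.trans hce.symm)
  · exact fun d hd hd' => h.notMem_range d hd.1 (hbl d hd hd').1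
  · intro d hd hd'
    obtain ⟨g1, g2, g3, g4, g5, g6, g7⟩ := hbl d hd hd'
    have g8 := h.rot_notMem d hd.1 g1
    rw [ebl] at g8
    refine ⟨h.rot_mem d hd.1 g1, ?_⟩
    simp only [Set.mem_insert_iff, Set.mem_singleton_iff, not_or]
    exact ⟨g8.2.1, g8.2.2, fun h' => g6 (u.rot.injective (h'.trans h₃.symm)),
      fun h' => g5 (u.rot.injective (h'.trans hby.symm)),
      fun h' => g4 (u.rot.injective (h'.trans hac.symm)),
      fun h' => g3 (u.rot.injective (h'.trans h₄.symm))⟩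
  · intro d hd hd'
    obtain ⟨g1, g2, g3, g4, g5, g6, g7⟩ := hbl d hd hd'
    have g8 := h.rot_notMem d hd.1 g1
    rw [ebl] at g8
    have g9 : u.rot d ≠ a := fun h' => g2 (u.rot.injective (h'.trans hae.symm))
    have g10 : u.rot d ≠ b := fun h' => g7 (u.rot.injective (h'.trans hbe.symm))
    simp only [List.mem_append, List.mem_cons, not_or]
    tauto
  · intro d hd hd'
    obtain ⟨g1, g2, g3, g4, g5, g6, g7⟩ := hbl d hd hd'
    rw [hout d g1 g2 g3 g4 g5 g6 g7, h.eq_rot d hd.1 g1]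
  · intro d hd
    by_cases hdc : d = b₁ ∨ d = b₂ ∨ d = x ∨ d = y ∨ d = c ∨ d = c'
    · exact hfix d hdc
    · have hdA : d ∉ A := fun h' => hd ⟨h', by simpa using hdc⟩
      rw [hout d (fun h' => hdA (h.mem_of_mem d h')), h.eq_self d hdA] <;>
        (rintro rfl; contradiction)
  · exact fun d hd => a4'.2 d hd

end IsLowerPart

end Web

/-! ### The local structure of ladder diagrams -/

theorem LDart.opp_opp (d : LDart) : d.opp.opp = d := by cases d <;> simp [LDart.opp]

namespace FString

variable {n ℓ : ℕ} {w : FString}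

theorem label_zero (ℓ : ℕ) (w : FString) (p : ℕ) :
    label ℓ w 0 p = if 1 ≤ p ∧ p ≤ ℓ then 3 else 0 := rfl

theorem label_succ (ℓ : ℕ) (w : FString) {k : ℕ} (hk : k < w.length) (p : ℕ) :
    label ℓ w (k + 1) p =
      if p = (step w (k + 1)).1 then label ℓ w k p - (step w (k + 1)).2
      else if p = (step w (k + 1)).1 + 1 then label ℓ w k p + (step w (k + 1)).2
      else label ℓ w k p := by
  have hs : step w (k + 1) = w[k] := by
    simp [step, List.getD_eq_getElem?_getD, hk]
  rw [hs, label, label, List.take_succ_eq_append_getElem hk, List.foldl_append]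
  rfl

theorem label_of_length_le (ℓ : ℕ) (w : FString) {k : ℕ} (hk : w.length ≤ k) :
    label ℓ w k = label ℓ w w.length := by
  rw [label, label, List.take_of_length_le hk, List.take_length]

theorem label_append (ℓ : ℕ) (w : FString) (s : ℕ × ℕ) {k : ℕ} (hk : k ≤ w.length) :
    label ℓ (w ++ [s]) k = label ℓ w k := by
  rw [label, label, List.take_append_of_le_length hk]

theorem step_append (w : FString) (s : ℕ × ℕ) {k : ℕ} (hk : 1 ≤ k) (hk' : k ≤ w.length) :
    step (w ++ [s]) k = step w k := by
  rw [step, step, List.getD_append _ _ _ _ (by omega)]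

theorem step_append_last (w : FString) (s : ℕ × ℕ) : step (w ++ [s]) (w.length + 1) = s := by
  simp [step, List.getD_eq_getElem?_getD]

theorem step_mem {k : ℕ} (hk : 1 ≤ k) (hk' : k ≤ w.length) : step w k ∈ w := by
  have h : k - 1 < w.length := by omega
  simp [step, List.getD_eq_getElem?_getD, h]

theorem present_vert {p k : ℕ} {b : Bool} :
    present n ℓ w (.vert p k b) = true ↔
      (1 ≤ p ∧ p ≤ n ∧ k ≤ w.length) ∧ (label ℓ w k p = 1 ∨ label ℓ w k p = 2) := by
  rw [present, Bool.and_eq_true, decide_eq_true_eq, decide_eq_true_eq]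
  rfl

theorem present_rung {k : ℕ} {b : Bool} :
    present n ℓ w (.rung k b) = true ↔
      (1 ≤ k ∧ k ≤ w.length) ∧ ((step w k).2 = 1 ∨ (step w k).2 = 2) := by
  rw [present, Bool.and_eq_true, decide_eq_true_eq, decide_eq_true_eq, dartLabel]
  norm_cast

theorem present_opp (d : LDart) : present n ℓ w d.opp = present n ℓ w d := by
  cases d <;> rfl

theorem mem_star {v : Option (ℕ × ℕ)} {d : LDart} :
    d ∈ star n ℓ w v ↔ present n ℓ w d = true ∧ base w d = v := by
  cases v with
  | none =>
    simp only [star, List.mem_filter, List.mem_map, List.mem_range]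
    constructor
    · rintro ⟨⟨p, hp, rfl⟩, h⟩
      exact ⟨h, by simp [base]⟩
    · rintro ⟨h, hb⟩
      refine ⟨?_, h⟩
      match d with
      | .vert p k true =>
        have hk : k = w.length := by
          by_contra hk
          simp [base, hk] at hb
        have hp := (present_vert.1 h).1
        exact ⟨p - 1, by omega, by rw [hk, Nat.sub_add_cancel hp.1]⟩
      | .vert p k false => simp [base] at hb
      | .rung k true => simp [base] at hb
      | .rung k false => simp [base] at hb
  | some v =>
    obtain ⟨p, k⟩ := v
    simp only [star, List.mem_filter, Bool.and_eq_true, decide_eq_true_eq]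
    constructor
    · rintro ⟨-, h⟩; exact h
    · rintro ⟨h, hb⟩
      refine ⟨?_, h, hb⟩
      match d with
      | .vert q m false =>
        simp only [base, Option.some.injEq, Prod.mk.injEq] at hb
        simp [hb]
      | .vert q m true =>
        by_cases hm : m = w.length
        · simp [base, hm] at hb
        · simp only [base, if_neg hm, Option.some.injEq, Prod.mk.injEq] at hb
          obtain ⟨rfl, rfl⟩ := hb
          simp
      | .rung m true =>
        simp only [base, Option.some.injEq, Prod.mk.injEq] at hb
        simp [hb]
      | .rung m false =>
        simp only [base, Option.some.injEq, Prod.mk.injEq] at hb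
        simp [hb]

theorem nodup_star (v : Option (ℕ × ℕ)) : (star n ℓ w v).Nodup := by
  cases v with
  | none =>
    refine (List.Nodup.map ?_ List.nodup_range).filter _
    intro p q h
    simpa using h
  | some v =>
    refine List.Nodup.filter _ ?_
    simp

/-- The label of a segment of a post is `1` or `2`, so that the segment is not erased. -/
def IsThin (n ℓ : ℕ) (w : FString) (k p : ℕ) : Prop :=
  (1 ≤ p ∧ p ≤ n) ∧ (label ℓ w k p = 1 ∨ label ℓ w k p = 2)

open Classical in
/-- The darts at the point of post `p` on a rung level, in terms of labels: up, left, down, right. -/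
theorem star_succ {k : ℕ} (hk : k < w.length) (p : ℕ) :
    star n ℓ w (some (p, k + 1)) =
      (if IsThin n ℓ w (k + 1) p then [.vert p (k + 1) false] else []) ++
      (if p = (step w (k + 1)).1 + 1 ∧ ((step w (k + 1)).2 = 1 ∨ (step w (k + 1)).2 = 2) then
        [.rung (k + 1) true] else []) ++
      (if IsThin n ℓ w k p then [.vert p k true] else []) ++
      (if p = (step w (k + 1)).1 ∧ ((step w (k + 1)).2 = 1 ∨ (step w (k + 1)).2 = 2) then
        [.rung (k + 1) false] else []) := by
  have h1 : (present n ℓ w (.vert p (k + 1) false) &&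
      decide (base w (.vert p (k + 1) false) = some (p, k + 1))) =
      decide (IsThin n ℓ w (k + 1) p) := by
    rw [Bool.eq_iff_iff, Bool.and_eq_true, present_vert, decide_eq_true_eq, decide_eq_true_eq]
    simp only [base, IsThin]
    constructor
    · rintro ⟨⟨h, h'⟩, -⟩; exact ⟨⟨h.1, h.2.1⟩, h'⟩
    · rintro ⟨h, h'⟩; exact ⟨⟨⟨h.1, h.2, by omega⟩, h'⟩, trivial⟩
  have h2 : (present n ℓ w (.vert p k true) &&
      decide (base w (.vert p k true) = some (p, k + 1))) = decide (IsThin n ℓ w k p) := by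
    rw [Bool.eq_iff_iff, Bool.and_eq_true, present_vert, decide_eq_true_eq, decide_eq_true_eq]
    simp only [base, IsThin, if_neg hk.ne]
    constructor
    · rintro ⟨⟨h, h'⟩, -⟩; exact ⟨⟨h.1, h.2.1⟩, h'⟩
    · rintro ⟨h, h'⟩; exact ⟨⟨⟨h.1, h.2, by omega⟩, h'⟩, trivial⟩
  have h3 : (present n ℓ w (.rung (k + 1) true) &&
      decide (base w (.rung (k + 1) true) = some (p, k + 1))) =
      decide (p = (step w (k + 1)).1 + 1 ∧
        ((step w (k + 1)).2 = 1 ∨ (step w (k + 1)).2 = 2)) := by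
    rw [Bool.eq_iff_iff, Bool.and_eq_true, present_rung, decide_eq_true_eq, decide_eq_true_eq]
    simp only [base, Option.some.injEq, Prod.mk.injEq]
    constructor
    · rintro ⟨⟨-, h⟩, h', -⟩; exact ⟨h'.symm, h⟩
    · rintro ⟨h, h'⟩; exact ⟨⟨⟨by omega, by omega⟩, h'⟩, h.symm, trivial⟩
  have h4 : (present n ℓ w (.rung (k + 1) false) &&
      decide (base w (.rung (k + 1) false) = some (p, k + 1))) =
      decide (p = (step w (k + 1)).1 ∧
        ((step w (k + 1)).2 = 1 ∨ (step w (k + 1)).2 = 2)) := by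
    rw [Bool.eq_iff_iff, Bool.and_eq_true, present_rung, decide_eq_true_eq, decide_eq_true_eq]
    simp only [base, Option.some.injEq, Prod.mk.injEq]
    constructor
    · rintro ⟨⟨-, h⟩, h', -⟩; exact ⟨h'.symm, h⟩
    · rintro ⟨h, h'⟩; exact ⟨⟨⟨by omega, by omega⟩, h'⟩, h.symm, trivial⟩
  rw [star, Nat.add_sub_cancel, List.filter_cons, List.filter_cons, List.filter_cons,
    List.filter_cons, List.filter_nil, h1, h2, h3, h4]
  simp only [decide_eq_true_eq]
  split_ifs <;> rfl

/-- Away from the rung levels of the diagram there are no darts. -/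
theorem exists_succ_of_mem_star {p k : ℕ} {d : LDart} (hd : d ∈ star n ℓ w (some (p, k))) :
    ∃ m, k = m + 1 ∧ m < w.length := by
  obtain ⟨h, hb⟩ := mem_star.1 hd
  match d with
  | .vert q m false =>
    simp only [base, Option.some.injEq, Prod.mk.injEq] at hb
    obtain ⟨rfl, rfl⟩ := hb
    obtain ⟨⟨h1, h2, h3⟩, h4⟩ := present_vert.1 h
    cases m with
    | zero =>
      rw [label_zero] at h4
      split_ifs at h4 <;> omega
    | succ m => exact ⟨m, rfl, by omega⟩
  | .vert q m true =>
    obtain ⟨⟨h1, h2, h3⟩, h4⟩ := present_vert.1 h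
    by_cases hm : m = w.length
    · simp [base, hm] at hb
    · simp only [base, if_neg hm, Option.some.injEq, Prod.mk.injEq] at hb
      exact ⟨m, hb.2.symm, by omega⟩
  | .rung m b =>
    obtain ⟨⟨h1, h2⟩, -⟩ := present_rung.1 h
    have : m = k := by
      cases b <;> simp only [base, Option.some.injEq, Prod.mk.injEq] at hb <;> exact hb.2
    exact ⟨m - 1, by omega, by omega⟩

theorem next_mem_star {v : Option (ℕ × ℕ)} {d : LDart} (hd : d ∈ star n ℓ w v) :
    next n ℓ w d ∈ star n ℓ w v := by
  rw [next, (mem_star.1 hd).2]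
  exact List.formPerm_apply_mem_of_mem hd

theorem base_next (d : LDart) : base w (next n ℓ w d) = base w d := by
  by_cases hd : d ∈ star n ℓ w (base w d)
  · exact (mem_star.1 (next_mem_star hd)).2
  · rw [next, List.formPerm_apply_of_notMem hd]

theorem present_next {d : LDart} (hd : present n ℓ w d = true) :
    present n ℓ w (next n ℓ w d) = true :=
  (mem_star.1 (next_mem_star (mem_star.2 ⟨hd, rfl⟩))).1

theorem Smooth.next {d : LDart} (h : Smooth n ℓ w d) : Smooth n ℓ w (next n ℓ w d) := by
  rw [Smooth, base_next]; exact h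

theorem Smooth.next_next {d : LDart} (h : Smooth n ℓ w d) :
    FString.next n ℓ w (FString.next n ℓ w d) = d := by
  obtain ⟨x, y, hxy⟩ := List.length_eq_two.1 h.2
  rw [FString.next, base_next, FString.next, hxy, List.formPerm_pair]
  simp

theorem next_of_star_eq_pair {x y d : LDart} (h : star n ℓ w (base w d) = [x, y]) :
    next n ℓ w d = Equiv.swap x y d := by
  rw [next, h, List.formPerm_pair]

/-! ### Strands -/

theorem Strand.symm {x y : LDart} (h : Strand n ℓ w x y) : Strand n ℓ w y x := by
  -- moving segments one by one from the end of the first strand to the reversed one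
  have key : ∀ {x y t}, Strand n ℓ w x y → Strand n ℓ w t y.opp → Strand n ℓ w t x := by
    intro x y t h ht
    induction h with
    | edge => rwa [LDart.opp_opp] at ht
    | @cont y h hy ih =>
      rw [LDart.opp_opp] at ht
      have := Strand.cont ht hy.next
      rw [hy.next_next] at this
      exact ih this
  exact key h (Strand.edge y)

theorem Strand.trans_smooth {x y z : LDart} (h : Strand n ℓ w x y) (hy : Smooth n ℓ w y)
    (hz : next n ℓ w y = z) : Strand n ℓ w x z.opp :=
  hz ▸ Strand.cont h hy

/-- The second segment of a strand, seen from its beginning. -/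
theorem Strand.cases_head {a t : LDart} (h : Strand n ℓ w a t) :
    t = a.opp ∨ (Smooth n ℓ w a.opp ∧ Strand n ℓ w (next n ℓ w a.opp) t) := by
  induction h with
  | edge => exact Or.inl rfl
  | @cont y h hy ih =>
    rcases ih with rfl | ⟨h1, h2⟩
    · exact Or.inr ⟨hy, Strand.edge _⟩
    · exact Or.inr ⟨h1, Strand.cont h2 hy⟩

/-- From any point of a strand one can run on to its end. -/
theorem Strand.to_end {x y t : LDart} (h : Strand n ℓ w x y) (ht : Strand n ℓ w x t)
    (hs : ¬ Smooth n ℓ w t) : Strand n ℓ w y.opp t := by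
  induction h with
  | edge => rwa [LDart.opp_opp]
  | @cont y h hy ih =>
    rw [LDart.opp_opp]
    rcases ih.cases_head with h' | ⟨-, h'⟩
    · rw [LDart.opp_opp] at h'
      exact absurd (h' ▸ hy) hs
    · rwa [LDart.opp_opp] at h'

/-- A strand has only one end. -/
theorem Strand.end_unique {x t t' : LDart} (h : Strand n ℓ w x t) (h' : Strand n ℓ w x t')
    (ht : ¬ Smooth n ℓ w t) (ht' : ¬ Smooth n ℓ w t') : t = t' := by
  rcases (h'.to_end h ht).cases_head with h1 | ⟨h1, -⟩
  · rwa [LDart.opp_opp] at h1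
  · rw [LDart.opp_opp] at h1
    exact absurd h1 ht'

theorem IsVertex.not_smooth {d : LDart} (h : IsVertex n ℓ w d) : ¬ Smooth n ℓ w d := by
  rintro ⟨h1, h2⟩
  rcases h with h | h
  · exact h1 h
  · omega

/-! ### Adding a rung on top of a ladder diagram -/

/-- The level of a dart is that of the rungs and of the segments above it. -/
def dartLevel : LDart → ℕ
  | .vert _ k _ => k
  | .rung k _ => k

theorem present_append {s : ℕ × ℕ} {d : LDart} (hd : dartLevel d ≤ w.length) :
    present n ℓ (w ++ [s]) d = present n ℓ w d := by
  rw [Bool.eq_iff_iff]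
  cases d with
  | vert p k b =>
    simp only [dartLevel] at hd
    rw [present_vert, present_vert, label_append ℓ w s hd]
    simp only [List.length_append, List.length_singleton]
    have : (k ≤ w.length + 1) ↔ k ≤ w.length := by omega
    rw [this]
  | rung k b =>
    simp only [dartLevel] at hd
    rw [present_rung, present_rung]
    simp only [List.length_append, List.length_singleton]
    rcases Nat.eq_zero_or_pos k with rfl | hk
    · simp
    · rw [step_append w s hk hd]
      have : (k ≤ w.length + 1) ↔ k ≤ w.length := by omega
      rw [this]

theorem dartLevel_le_of_present {d : LDart} (hd : present n ℓ w d = true) :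
    dartLevel d ≤ w.length := by
  cases d with
  | vert p k b => exact (present_vert.1 hd).1.2.2
  | rung k b => exact (present_rung.1 hd).1.2

theorem base_append {s : ℕ × ℕ} {d : LDart} (hd : present n ℓ w d = true)
    (hb : base w d ≠ none) : base (w ++ [s]) d = base w d := by
  match d with
  | .vert p k false => rfl
  | .vert p k true =>
    have h1 := (present_vert.1 hd).1.2.2
    have h2 : k ≠ w.length := fun h => hb (by simp [base, h])
    simp only [base, if_neg h2, List.length_append, List.length_singleton]
    rw [if_neg (by omega)]
  | .rung k true =>
    have h1 := (present_rung.1 hd).1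
    simp only [base, step_append w s h1.1 h1.2]
  | .rung k false =>
    have h1 := (present_rung.1 hd).1
    simp only [base, step_append w s h1.1 h1.2]

theorem star_append {s : ℕ × ℕ} {p k : ℕ} (hk : k < w.length) :
    star n ℓ (w ++ [s]) (some (p, k + 1)) = star n ℓ w (some (p, k + 1)) := by
  classical
  have e1 : ∀ m, m ≤ w.length → (IsThin n ℓ (w ++ [s]) m p ↔ IsThin n ℓ w m p) := by
    intro m hm
    rw [IsThin, IsThin, label_append ℓ w s hm]
  rw [star_succ hk, star_succ (by simp; omega), step_append w s (by omega) (by omega)]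
  simp only [e1 k (by omega), e1 (k + 1) (by omega)]

theorem star_append_of_mem {s : ℕ × ℕ} {v : Option (ℕ × ℕ)} (hv : v ≠ none) {d : LDart}
    (hd : d ∈ star n ℓ w v) : star n ℓ (w ++ [s]) v = star n ℓ w v := by
  cases v with
  | none => exact absurd rfl hv
  | some v =>
    obtain ⟨p, k⟩ := v
    obtain ⟨m, rfl, hm⟩ := exists_succ_of_mem_star hd
    exact star_append hm

theorem next_append {s : ℕ × ℕ} {d : LDart} (hd : present n ℓ w d = true)
    (hb : base w d ≠ none) : next n ℓ (w ++ [s]) d = next n ℓ w d := by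
  rw [next, next, base_append hd hb, star_append_of_mem hb (mem_star.2 ⟨hd, rfl⟩)]

theorem length_star_append {s : ℕ × ℕ} {d : LDart} (hd : present n ℓ w d = true)
    (hb : base w d ≠ none) :
    (star n ℓ (w ++ [s]) (base (w ++ [s]) d)).length = (star n ℓ w (base w d)).length := by
  rw [base_append hd hb, star_append_of_mem hb (mem_star.2 ⟨hd, rfl⟩)]

theorem Strand.present {x y : LDart} (h : Strand n ℓ w x y)
    (hx : FString.present n ℓ w x = true) : FString.present n ℓ w y = true := by
  induction h with
  | edge => rwa [present_opp]
  | cont h hy ih => rw [present_opp]; exact present_next ih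

theorem Strand.append {s : ℕ × ℕ} {x y : LDart} (h : Strand n ℓ w x y)
    (hx : FString.present n ℓ w x = true) : Strand n ℓ (w ++ [s]) x y := by
  induction h with
  | edge => exact Strand.edge x
  | @cont y h hy ih =>
    have hp := h.present hx
    rw [← next_append (s := s) hp hy.1]
    refine Strand.cont ih ⟨?_, ?_⟩
    · rw [base_append hp hy.1]; exact hy.1
    · rw [length_star_append hp hy.1]; exact hy.2

theorem out_append {s : ℕ × ℕ} {d : LDart} (hd : present n ℓ w d = true) :
    out ℓ (w ++ [s]) d = out ℓ w d := by
  have hl := dartLevel_le_of_present hd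
  have h : dartLabel ℓ (w ++ [s]) d = dartLabel ℓ w d := by
    cases d with
    | vert p k b => exact congrFun (label_append ℓ w s hl) p
    | rung k b => exact congrArg (fun x => ((x.2 : ℕ) : ℤ)) (step_append w s (present_rung.1 hd).1.1 hl)
  cases d <;> simp only [out, h]

end FString

/-! ### Drawing the lower part of a web as a ladder -/

namespace FString

variable {n ℓ m : ℕ}

/-- `e` identifies the part of the web `u` with the darts `A`, cut off by a line that is crossed by
the darts `β p` at the posts `p`, with the ladder diagram of `w`. -/
structure DrawsLower (n ℓ : ℕ) (w : FString) (u : Web m) (A : Set u.Dart) (β : ℕ → u.Dart)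
    (e : u.Dart → LDart) : Prop where
  valid : Valid n ℓ w
  pos : ∀ s ∈ w, 1 ≤ s.2
  injOn : Set.InjOn e A
  mem_iff : ∀ x, (∃ d ∈ A, e d = x) ↔ present n ℓ w x = true ∧ IsVertex n ℓ w x
  bd : ∀ p, IsThin n ℓ w w.length p → β p ∈ A ∧ e (β p) = .vert p w.length true
  rot : ∀ d ∈ A, base w (e d) ≠ none → u.rot d ∈ A ∧ next n ℓ w (e d) = e (u.rot d)
  opp : ∀ d ∈ A, u.opp d ∈ A ∧ Strand n ℓ w (e d) (e (u.opp d))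
  exists_strand : ∀ x, present n ℓ w x = true → ∃ d ∈ A, Strand n ℓ w (e d) x
  out : ∀ d ∈ A, u.out d = out ℓ w (e d)

theorem eq_vert_of_base_eq_none {w : FString} {x : LDart} (hx : present n ℓ w x = true)
    (hb : base w x = none) : ∃ p, IsThin n ℓ w w.length p ∧ x = .vert p w.length true := by
  match x with
  | .vert p k true =>
    have hk : k = w.length := by
      by_contra hk
      simp [base, hk] at hb
    subst hk
    obtain ⟨h1, h2⟩ := present_vert.1 hx
    exact ⟨p, ⟨⟨h1.1, h1.2.1⟩, h2⟩, rfl⟩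
  | .vert p k false => simp [base] at hb
  | .rung k true => simp [base] at hb
  | .rung k false => simp [base] at hb

theorem isThin_append_of_ne {w : FString} {i j p : ℕ} (h1 : p ≠ i) (h2 : p ≠ i + 1) :
    IsThin n ℓ (w ++ [(i, j)]) (w.length + 1) p ↔ IsThin n ℓ w w.length p := by
  rw [IsThin, IsThin, label_succ ℓ (w ++ [(i, j)]) (by simp), step_append_last, if_neg h1, if_neg h2,
    label_append ℓ w _ le_rfl]

theorem isThin_append_length {w : FString} {s : ℕ × ℕ} {p : ℕ} :
    IsThin n ℓ (w ++ [s]) w.length p ↔ IsThin n ℓ w w.length p := by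
  rw [IsThin, IsThin, label_append ℓ w _ le_rfl]

/-- A vertical segment continues smoothly past a rung that does not meet its post. -/
theorem strand_far {w : FString} {i j p : ℕ} (h1 : p ≠ i) (h2 : p ≠ i + 1)
    (hp : IsThin n ℓ w w.length p) {x : LDart}
    (hx : Strand n ℓ (w ++ [(i, j)]) x (.vert p w.length true)) :
    Strand n ℓ (w ++ [(i, j)]) x (.vert p (w.length + 1) true) := by
  classical
  have hb : base (w ++ [(i, j)]) (.vert p w.length true) = some (p, w.length + 1) := by
    simp [base]
  have hs : star n ℓ (w ++ [(i, j)]) (base (w ++ [(i, j)]) (.vert p w.length true)) =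
      [.vert p (w.length + 1) false, .vert p w.length true] := by
    rw [hb, star_succ (by simp), step_append_last]
    simp [(isThin_append_of_ne h1 h2).2 hp, isThin_append_length.2 hp, h1, h2]
  exact hx.trans_smooth (z := .vert p (w.length + 1) false) ⟨by simp [hb], by rw [hs]; rfl⟩
    (by rw [next_of_star_eq_pair hs, Equiv.swap_apply_right])

theorem formPerm_triple {D : Type*} [DecidableEq D] {x y z : D} (h : [x, y, z].Nodup) :
    [x, y, z].formPerm x = y ∧ [x, y, z].formPerm y = z ∧ [x, y, z].formPerm z = x :=
  ⟨List.formPerm_apply_head x y [z] h, List.formPerm_apply_append (p := [x]) h,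
    List.formPerm_cons_concat_apply_last x z [y]⟩

section Append

variable {w : FString} {u : Web m} {A₀ A : Set u.Dart} {β₀ β : ℕ → u.Dart}
  {e₀ e : u.Dart → LDart} {i j : ℕ} {v : ℕ → Option u.Dart}

/-- A drawing of a lower part of a web can be extended by a rung if the darts that lie between the
two lines fit to the rung.  If there is a trivalent vertex at the intersection of the new rung with
the post `r`, then `v r` is the first dart at this vertex. -/
theorem DrawsLower.append (D : DrawsLower n ℓ w u A₀ β₀ e₀) (hj : 1 ≤ j)
    (hval : Valid n ℓ (w ++ [(i, j)]))
    (e₁ : ∀ p, IsThin n ℓ (w ++ [(i, j)]) (w.length + 1) p → e (β p) = .vert p (w.length + 1) true)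
    (e₂ : ∀ d ∈ A₀, (∀ p, IsThin n ℓ (w ++ [(i, j)]) (w.length + 1) p → β p ≠ d) → e d = e₀ d)
    (hA₀ : A₀ ⊆ A) (hA : ∀ d ∈ A, u.opp d ∈ A)
    (hβ : ∀ p, IsThin n ℓ (w ++ [(i, j)]) (w.length + 1) p → β p ∈ A)
    (hβ₀ : ∀ p, IsThin n ℓ (w ++ [(i, j)]) (w.length + 1) p → β p ∈ A₀ →
      ∃ q, IsThin n ℓ w w.length q ∧ β p = β₀ q)
    (hfar : ∀ q, q ≠ i → q ≠ i + 1 → β q = β₀ q)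
    (hnear : ∀ q, q = i ∨ q = i + 1 → IsThin n ℓ w w.length q →
      (∃ p, IsThin n ℓ (w ++ [(i, j)]) (w.length + 1) p ∧ β p = β₀ q ∧
        ∀ x, Strand n ℓ (w ++ [(i, j)]) x (.vert q w.length true) →
          Strand n ℓ (w ++ [(i, j)]) x (.vert p (w.length + 1) true)) ∨
      ((∀ p, IsThin n ℓ (w ++ [(i, j)]) (w.length + 1) p → β p ≠ β₀ q) ∧
        ∃ r x, v r = some x ∧ (β₀ q = x ∨ β₀ q = u.rot x ∨ β₀ q = u.rot (u.rot x))))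
    (hnew : ∀ d ∈ A, d ∉ A₀ → (∃ p, IsThin n ℓ (w ++ [(i, j)]) (w.length + 1) p ∧ β p = d) ∨
      ∃ r x, v r = some x ∧ (d = x ∨ d = u.rot x ∨ d = u.rot (u.rot x)))
    (hv : ∀ r x, v r = some x → (x ∈ A ∧ u.rot x ∈ A ∧ u.rot (u.rot x) ∈ A) ∧
      u.rot (u.rot (u.rot x)) = x ∧
      star n ℓ (w ++ [(i, j)]) (some (r, w.length + 1)) = [e x, e (u.rot x), e (u.rot (u.rot x))])
    (hstar : ∀ r, (star n ℓ (w ++ [(i, j)]) (some (r, w.length + 1))).length = 3 → ∃ x, v r = some x)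
    (hopp : ∀ d ∈ A, d ∉ A₀ → Strand n ℓ (w ++ [(i, j)]) (e d) (e (u.opp d)))
    (hrung : j = 1 ∨ j = 2 → ∃ d ∈ A, ∃ b, Strand n ℓ (w ++ [(i, j)]) (e d) (.rung (w.length + 1) b))
    (hout : ∀ d ∈ A, d ∉ A₀ → u.out d = FString.out ℓ (w ++ [(i, j)]) (e d))
    (hout' : ∀ p, IsThin n ℓ (w ++ [(i, j)]) (w.length + 1) p →
      u.out (β p) = FString.out ℓ (w ++ [(i, j)]) (.vert p (w.length + 1) true)) :
    DrawsLower n ℓ (w ++ [(i, j)]) u A β e := by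
  set w' := w ++ [(i, j)] with hw'
  have hlen : w'.length = w.length + 1 := by simp [hw']
  have hpres₀ : ∀ d ∈ A₀, present n ℓ w (e₀ d) = true := fun d hd => ((D.mem_iff _).1 ⟨d, hd, rfl⟩).1
  have hinner : ∀ d ∈ A₀, base w (e₀ d) ≠ none → e d = e₀ d := by
    intro d hd hb
    refine e₂ d hd fun p hp hpd => hb ?_
    obtain ⟨q, hq, hpq⟩ := hβ₀ p hp (hpd ▸ hd)
    rw [← hpd, hpq, (D.bd q hq).2]
    simp [base]
  have hbdry : ∀ d ∈ A₀, base w (e₀ d) = none → ∃ q, IsThin n ℓ w w.length q ∧ d = β₀ q := by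
    intro d hd hb
    obtain ⟨q, hq, hdq⟩ := eq_vert_of_base_eq_none (hpres₀ d hd) hb
    exact ⟨q, hq, D.injOn hd (D.bd q hq).1 (hdq.trans (D.bd q hq).2.symm)⟩
  -- The darts of `A` are of three kinds: unchanged darts at inner vertices of the old diagram, darts
  -- at the new line, and darts at a trivalent vertex on the new rung.
  have hcl : ∀ d ∈ A, (d ∈ A₀ ∧ base w (e₀ d) ≠ none ∧ e d = e₀ d) ∨
      (∃ p, IsThin n ℓ w' (w.length + 1) p ∧ β p = d) ∨
      ∃ r x, v r = some x ∧ (d = x ∨ d = u.rot x ∨ d = u.rot (u.rot x)) := by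
    intro d hd
    by_cases hd₀ : d ∈ A₀
    · by_cases hb : base w (e₀ d) = none
      · obtain ⟨q, hq, rfl⟩ := hbdry d hd₀ hb
        by_cases hqi : q = i ∨ q = i + 1
        · rcases hnear q hqi hq with ⟨p, hp, hpq, -⟩ | ⟨-, r, x, hx, h⟩
          · exact Or.inr (Or.inl ⟨p, hp, hpq⟩)
          · exact Or.inr (Or.inr ⟨r, x, hx, h⟩)
        · push Not at hqi
          exact Or.inr (Or.inl ⟨q, (isThin_append_of_ne hqi.1 hqi.2).2 hq, hfar q hqi.1 hqi.2⟩)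
      · exact Or.inl ⟨hd₀, hb, hinner d hd₀ hb⟩
    · exact Or.inr (hnew d hd hd₀)
  have hvmem : ∀ r x d, v r = some x → (d = x ∨ d = u.rot x ∨ d = u.rot (u.rot x)) →
      e d ∈ star n ℓ w' (some (r, w.length + 1)) := by
    intro r x d hx hd
    rw [(hv r x hx).2.2]
    rcases hd with rfl | rfl | rfl <;> simp
  have hbaseI : ∀ d ∈ A₀, base w (e₀ d) ≠ none → ∃ q k, k < w.length ∧
      base w' (e₀ d) = some (q, k + 1) := by
    intro d hd hb
    rw [base_append (hpres₀ d hd) hb]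
    obtain ⟨⟨q, k⟩, hqk⟩ := Option.ne_none_iff_exists'.1 hb
    obtain ⟨k', rfl, hk'⟩ := exists_succ_of_mem_star (mem_star.2 ⟨hpres₀ d hd, hqk⟩)
    exact ⟨q, k', hk', hqk⟩
  have hbaseB : ∀ p, base w' (.vert p (w.length + 1) true) = none := by
    intro p; simp [base, hlen]
  -- all darts of the old part are joined to their old positions by strands
  have htrans : ∀ d ∈ A₀, ∀ x, Strand n ℓ w' x (e₀ d) → Strand n ℓ w' x (e d) := by
    intro d hd x hx
    by_cases hb : base w (e₀ d) = none
    · obtain ⟨q, hq, rfl⟩ := hbdry d hd hb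
      rw [(D.bd q hq).2] at hx
      by_cases hqi : q = i ∨ q = i + 1
      · rcases hnear q hqi hq with ⟨p, hp, hpq, h⟩ | ⟨h, -⟩
        · rw [← hpq, e₁ p hp]; exact h x hx
        · rw [e₂ _ hd h, (D.bd q hq).2]; exact hx
      · push Not at hqi
        rw [← hfar q hqi.1 hqi.2, e₁ q ((isThin_append_of_ne hqi.1 hqi.2).2 hq)]
        exact strand_far hqi.1 hqi.2 hq hx
    · rw [hinner d hd hb]; exact hx
  have hopp' : ∀ d ∈ A, Strand n ℓ w' (e d) (e (u.opp d)) := by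
    intro d hd
    by_cases hd₀ : d ∈ A₀
    · obtain ⟨h1, h2⟩ := D.opp d hd₀
      have h3 := htrans _ h1 _ (h2.append (s := (i, j)) (hpres₀ d hd₀))
      exact (htrans d hd₀ _ h3.symm).symm
    · exact hopp d hd hd₀
  have hvert : ∀ d ∈ A, present n ℓ w' (e d) = true ∧ IsVertex n ℓ w' (e d) := by
    intro d hd
    rcases hcl d hd with ⟨h1, h2, h3⟩ | ⟨p, hp, rfl⟩ | ⟨r, x, hx, h⟩
    · rw [h3]
      obtain ⟨h4, h5⟩ := (D.mem_iff _).1 ⟨d, h1, rfl⟩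
      refine ⟨?_, Or.inr ?_⟩
      · rw [hw', present_append (dartLevel_le_of_present h4)]; exact h4
      · rw [hw', length_star_append h4 h2]
        exact h5.resolve_left h2
    · rw [e₁ p hp]
      refine ⟨present_vert.2 ⟨⟨hp.1.1, hp.1.2, hlen.ge⟩, hp.2⟩, Or.inl (hbaseB p)⟩
    · have := hvmem r x d hx h
      refine ⟨(mem_star.1 this).1, Or.inr ?_⟩
      rw [(mem_star.1 this).2, (hv r x hx).2.2]
      rfl
  refine ⟨hval, ?_, ?_, ?_, ?_, ?_, fun d hd => ⟨hA d hd, hopp' d hd⟩, ?_, ?_⟩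
  · intro s hs
    rw [hw', List.mem_append, List.mem_singleton] at hs
    rcases hs with hs | rfl
    · exact D.pos s hs
    · exact hj
  -- injectivity: the three kinds of darts are based at points of different levels
  · intro d hd d' hd' hdd
    rcases hcl d hd with ⟨h1, h2, h3⟩ | ⟨p, hp, rfl⟩ | ⟨r, x, hx, h⟩ <;>
    rcases hcl d' hd' with ⟨h1', h2', h3'⟩ | ⟨p', hp', rfl⟩ | ⟨r', x', hx', h'⟩
    · rw [h3, h3'] at hdd; exact D.injOn h1 h1' hdd
    · rw [h3, e₁ p' hp'] at hdd
      obtain ⟨q, k, -, hb⟩ := hbaseI d h1 h2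
      rw [hdd, hbaseB] at hb
      exact absurd hb (by simp)
    · rw [h3] at hdd
      obtain ⟨q, k, hk, hb⟩ := hbaseI d h1 h2
      rw [hdd, (mem_star.1 (hvmem r' x' d' hx' h')).2] at hb
      simp only [Option.some.injEq, Prod.mk.injEq] at hb
      omega
    · rw [h3', e₁ p hp] at hdd
      obtain ⟨q, k, -, hb⟩ := hbaseI d' h1' h2'
      rw [← hdd, hbaseB] at hb
      exact absurd hb (by simp)
    · rw [e₁ p hp, e₁ p' hp'] at hdd
      have : p = p' := by simpa using hdd
      rw [this]
    · have := (mem_star.1 (hvmem r' x' d' hx' h')).2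
      rw [← hdd, e₁ p hp, hbaseB] at this
      exact absurd this (by simp)
    · rw [h3'] at hdd
      obtain ⟨q, k, hk, hb⟩ := hbaseI d' h1' h2'
      rw [← hdd, (mem_star.1 (hvmem r x d hx h)).2] at hb
      simp only [Option.some.injEq, Prod.mk.injEq] at hb
      omega
    · have := (mem_star.1 (hvmem r x d hx h)).2
      rw [hdd, e₁ p' hp', hbaseB] at this
      exact absurd this (by simp)
    · have hb := (mem_star.1 (hvmem r x d hx h)).2
      rw [hdd, (mem_star.1 (hvmem r' x' d' hx' h')).2] at hb
      simp only [Option.some.injEq, Prod.mk.injEq, and_true] at hb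
      subst hb
      rw [hx, Option.some.injEq] at hx'
      subst hx'
      have hnd := nodup_star (n := n) (ℓ := ℓ) (w := w') (some (r', w.length + 1))
      rw [(hv r' x hx).2.2] at hnd
      simp only [List.nodup_cons, List.mem_cons, List.not_mem_nil, or_false, not_or] at hnd
      obtain ⟨⟨n1, n2⟩, n3, -⟩ := hnd
      rcases h with rfl | rfl | rfl <;> rcases h' with rfl | rfl | rfl
      · rfl
      · exact absurd hdd n1
      · exact absurd hdd n2
      · exact absurd hdd.symm n1
      · rfl
      · exact absurd hdd n3
      · exact absurd hdd.symm n2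
      · exact absurd hdd.symm n3
      · rfl
  · intro x
    constructor
    · rintro ⟨d, hd, rfl⟩; exact hvert d hd
    · rintro ⟨hx, hxv⟩
      rcases hb : base w' x with _ | ⟨p, k⟩
      · obtain ⟨p, hp, rfl⟩ := eq_vert_of_base_eq_none hx hb
        rw [hlen] at hp ⊢
        exact ⟨β p, hβ p hp, e₁ p hp⟩
      · have hmem := mem_star.2 ⟨hx, hb⟩
        obtain ⟨k, rfl, hk⟩ := exists_succ_of_mem_star hmem
        have h3 : (star n ℓ w' (some (p, k + 1))).length = 3 := by
          rcases hxv with h | h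
          · rw [hb] at h; exact absurd h (by simp)
          · rwa [hb] at h
        rcases Nat.lt_or_ge k w.length with hkw | hkw
        -- a vertex of the old diagram
        · rw [hw', star_append hkw] at hmem h3
          obtain ⟨h4, h5⟩ := mem_star.1 hmem
          obtain ⟨d, hd, rfl⟩ := (D.mem_iff x).2 ⟨h4, Or.inr (by rw [h5]; exact h3)⟩
          exact ⟨d, hA₀ hd, hinner d hd (by rw [h5]; simp)⟩
        -- a vertex on the new rung
        · have : k = w.length := by omega
          subst this
          obtain ⟨y, hy⟩ := hstar p h3
          obtain ⟨⟨m1, m2, m3⟩, -, h⟩ := hv p y hy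
          rw [h] at hmem
          simp only [List.mem_cons, List.not_mem_nil, or_false] at hmem
          rcases hmem with rfl | rfl | rfl
          · exact ⟨_, m1, rfl⟩
          · exact ⟨_, m2, rfl⟩
          · exact ⟨_, m3, rfl⟩
  · rw [hlen]; exact fun p hp => ⟨hβ p hp, e₁ p hp⟩
  · intro d hd hb
    rcases hcl d hd with ⟨h1, h2, h3⟩ | ⟨p, hp, rfl⟩ | ⟨r, x, hx, h⟩
    · obtain ⟨h4, h5⟩ := D.rot d h1 h2
      have h6 : base w (e₀ (u.rot d)) ≠ none := by rw [← h5, base_next]; exact h2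
      refine ⟨hA₀ h4, ?_⟩
      rw [hinner _ h4 h6, h3, hw', next_append (hpres₀ d h1) h2, h5]
    · rw [e₁ p hp] at hb; exact absurd (hbaseB p) hb
    · have hb' := (mem_star.1 (hvmem r x d hx h)).2
      obtain ⟨⟨m1, m2, m3⟩, h4, h5⟩ := hv r x hx
      have hnd := nodup_star (n := n) (ℓ := ℓ) (w := w') (some (r, w.length + 1))
      rw [h5] at hnd
      obtain ⟨f1, f2, f3⟩ := formPerm_triple hnd
      rw [next, hb', h5]
      rcases h with rfl | rfl | rfl
      · exact ⟨m2, f1⟩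
      · exact ⟨m3, f2⟩
      · rw [h4]; exact ⟨m1, f3⟩
  · intro x hx
    by_cases hl : dartLevel x ≤ w.length
    · rw [hw', present_append hl] at hx
      obtain ⟨d, hd, hs⟩ := D.exists_strand x hx
      have h1 := htrans d hd _ (hs.append (s := (i, j)) (hpres₀ d hd)).symm
      exact ⟨d, hA₀ hd, h1.symm⟩
    · have hl' : dartLevel x = w.length + 1 := by
        have := dartLevel_le_of_present hx
        omega
      match x with
      | .vert p k b =>
        simp only [dartLevel] at hl'
        subst hl'
        have hp : IsThin n ℓ w' (w.length + 1) p :=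
          ⟨⟨(present_vert.1 hx).1.1, (present_vert.1 hx).1.2.1⟩, (present_vert.1 hx).2⟩
        cases b with
        | true =>
          refine ⟨u.opp (β p), hA _ (hβ p hp), ?_⟩
          rw [← e₁ p hp]
          exact (hopp' _ (hβ p hp)).symm
        | false =>
          refine ⟨β p, hβ p hp, ?_⟩
          rw [e₁ p hp]
          exact Strand.edge _
      | .rung k b =>
        simp only [dartLevel] at hl'
        subst hl'
        have hj' := (present_rung.1 hx).2
        rw [hw', step_append_last] at hj'
        obtain ⟨d, hd, b', hs⟩ := hrung hj'
        by_cases hbb : b = b'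
        · exact ⟨d, hd, hbb ▸ hs⟩
        · refine ⟨u.opp d, hA d hd, ?_⟩
          have := (hs.to_end (hopp' d hd) (hvert _ (hA d hd)).2.not_smooth).symm
          rwa [LDart.opp, show (!b') = b by cases b <;> cases b' <;> simp at hbb ⊢] at this
  · intro d hd
    have hold : d ∈ A₀ → e d = e₀ d → u.out d = FString.out ℓ w' (e d) := by
      intro h1 h2
      rw [h2, hw', out_append (hpres₀ d h1), D.out d h1]
    rcases hcl d hd with ⟨h1, h2, h3⟩ | ⟨p, hp, rfl⟩ | ⟨r, x, hx, h⟩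
    · exact hold h1 h3
    · rw [e₁ p hp]; exact hout' p hp
    · by_cases hd₀ : d ∈ A₀
      · refine hold hd₀ (e₂ d hd₀ fun p hp hpd => ?_)
        have := (mem_star.1 (hvmem r x d hx h)).2
        rw [← hpd, e₁ p hp, hbaseB] at this
        exact absurd this (by simp)
      · exact hout d hd hd₀

end Append

end FString

/-! ### The six kinds of rungs -/

namespace FString

variable {n ℓ m : ℕ} {w : FString} {i j : ℕ}

theorem label_append_left : label ℓ (w ++ [(i, j)]) (w.length + 1) i =
    label ℓ w w.length i - j := by
  rw [label_succ ℓ _ (by simp), step_append_last, if_pos rfl, label_append ℓ w _ le_rfl]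

theorem label_append_right : label ℓ (w ++ [(i, j)]) (w.length + 1) (i + 1) =
    label ℓ w w.length (i + 1) + j := by
  rw [label_succ ℓ _ (by simp), step_append_last, if_neg (by simp), if_pos rfl,
    label_append ℓ w _ le_rfl]

theorem label_append_far {p : ℕ} (h1 : p ≠ i) (h2 : p ≠ i + 1) :
    label ℓ (w ++ [(i, j)]) (w.length + 1) p = label ℓ w w.length p := by
  rw [label_succ ℓ _ (by simp), step_append_last, if_neg h1, if_neg h2, label_append ℓ w _ le_rfl]

theorem Valid.append (hv : Valid n ℓ w) (hi : 1 ≤ i) (hi' : i + 1 ≤ n)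
    (h1 : (j : ℤ) ≤ label ℓ w w.length i) (h2 : label ℓ w w.length (i + 1) + j ≤ 3) :
    Valid n ℓ (w ++ [(i, j)]) := by
  constructor
  · intro s hs
    rw [List.mem_append, List.mem_singleton] at hs
    rcases hs with hs | rfl
    · exact hv.1 s hs
    · exact Or.inr ⟨hi, hi'⟩
  · have key : ∀ p, 0 ≤ label ℓ (w ++ [(i, j)]) (w.length + 1) p ∧
        label ℓ (w ++ [(i, j)]) (w.length + 1) p ≤ 3 := by
      intro p
      have h3 := hv.2 w.length i
      have h4 := hv.2 w.length (i + 1)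
      have h5 := hv.2 w.length p
      rcases eq_or_ne p i with rfl | hp
      · rw [label_append_left]; omega
      · rcases eq_or_ne p (i + 1) with rfl | hp'
        · rw [label_append_right]; omega
        · rw [label_append_far hp hp']; exact h5
    intro k p
    rcases Nat.lt_or_ge w.length k with hk | hk
    · rw [label_of_length_le ℓ _ (by simp; omega)]
      simpa using key p
    · rw [label_append ℓ w _ hk]; exact hv.2 k p

open Classical in
theorem star_append_left : star n ℓ (w ++ [(i, j)]) (some (i, w.length + 1)) =
    (if IsThin n ℓ (w ++ [(i, j)]) (w.length + 1) i then [.vert i (w.length + 1) false] else []) ++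
    (if IsThin n ℓ w w.length i then [.vert i w.length true] else []) ++
    (if j = 1 ∨ j = 2 then [.rung (w.length + 1) false] else []) := by
  rw [star_succ (by simp), step_append_last]
  simp [isThin_append_length]

open Classical in
theorem star_append_right : star n ℓ (w ++ [(i, j)]) (some (i + 1, w.length + 1)) =
    (if IsThin n ℓ (w ++ [(i, j)]) (w.length + 1) (i + 1) then
      [.vert (i + 1) (w.length + 1) false] else []) ++
    (if j = 1 ∨ j = 2 then [.rung (w.length + 1) true] else []) ++
    (if IsThin n ℓ w w.length (i + 1) then [.vert (i + 1) w.length true] else []) := by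
  rw [star_succ (by simp), step_append_last]
  simp [isThin_append_length]

theorem out_vert_false (p k : ℕ) :
    FString.out ℓ w (.vert p k false) = !FString.out ℓ w (.vert p k true) := by
  rw [FString.out, FString.out, Bool.false_xor, Bool.true_xor, Bool.not_not]
  rfl

theorem length_star_append_far {p : ℕ} (h1 : p ≠ i) (h2 : p ≠ i + 1) :
    (star n ℓ (w ++ [(i, j)]) (some (p, w.length + 1))).length ≠ 3 := by
  classical
  rw [star_succ (by simp), step_append_last]
  simp only [h1, h2, false_and, if_false, List.append_nil]
  split_ifs <;> simp

theorem isThin_append_left (hi : 1 ≤ i) (hi' : i + 1 ≤ n) :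
    IsThin n ℓ (w ++ [(i, j)]) (w.length + 1) i ↔
      label ℓ w w.length i - j = 1 ∨ label ℓ w w.length i - j = 2 := by
  rw [IsThin, label_append_left]
  have : 1 ≤ i ∧ i ≤ n := ⟨hi, by omega⟩
  simp [this]

theorem isThin_append_right (hi' : i + 1 ≤ n) :
    IsThin n ℓ (w ++ [(i, j)]) (w.length + 1) (i + 1) ↔
      label ℓ w w.length (i + 1) + j = 1 ∨ label ℓ w w.length (i + 1) + j = 2 := by
  rw [IsThin, label_append_right]
  have : 1 ≤ i + 1 ∧ i + 1 ≤ n := ⟨by omega, hi'⟩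
  simp [this]

theorem isThin_iff {k p : ℕ} (hp : 1 ≤ p) (hp' : p ≤ n) :
    IsThin n ℓ w k p ↔ label ℓ w k p = 1 ∨ label ℓ w k p = 2 := by
  rw [IsThin]; simp [hp, hp']

theorem Smooth.of_star {x y d : LDart} {v : ℕ × ℕ} (hb : base w d = some v)
    (hs : star n ℓ w (some v) = [x, y]) : Smooth n ℓ w d :=
  ⟨by rw [hb]; simp, by rw [hb, hs]; rfl⟩

/-- A strand that arrives at a smooth point continues with the other dart at this point. -/
theorem Strand.cont_pair {x y z z' : LDart} {v : ℕ × ℕ} (h : Strand n ℓ w x y)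
    (hs : star n ℓ w (some v) = [y, z] ∨ star n ℓ w (some v) = [z, y]) (hz : z.opp = z') :
    Strand n ℓ w x z' := by
  subst hz
  have hy : y ∈ star n ℓ w (some v) := by rcases hs with hs | hs <;> simp [hs]
  have hb := (mem_star.1 hy).2
  rcases hs with hs | hs
  · exact h.trans_smooth (Smooth.of_star hb hs)
      (by rw [next_of_star_eq_pair (by rw [hb, hs]), Equiv.swap_apply_left])
  · exact h.trans_smooth (Smooth.of_star hb hs)
      (by rw [next_of_star_eq_pair (by rw [hb, hs]), Equiv.swap_apply_right])

open Classical in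
/-- Every assignment of positions to the new darts can be combined with the old positions. -/
theorem exists_extension {D : Type*} (T : ℕ → Prop) (k : ℕ) (β : ℕ → D)
    (hinj : ∀ p q, T p → T q → β p = β q → p = q) (A₀ : Set D) (e₀ extra : D → LDart) :
    ∃ e : D → LDart, (∀ p, T p → e (β p) = .vert p k true) ∧
      (∀ d ∈ A₀, (∀ p, T p → β p ≠ d) → e d = e₀ d) ∧
      ∀ d, d ∉ A₀ → (∀ p, T p → β p ≠ d) → e d = extra d := by
  -- boundary darts come first, so that an old dart at the line may move to a new position
  refine ⟨fun d => if h : ∃ p, T p ∧ β p = d then .vert h.choose k true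
    else if d ∈ A₀ then e₀ d else extra d, ?_, ?_, ?_⟩
  · intro p hp
    have h : ∃ q, T q ∧ β q = β p := ⟨p, hp, rfl⟩
    dsimp only
    rw [dif_pos h, hinj _ _ h.choose_spec.1 hp h.choose_spec.2]
  · intro d hd hp
    dsimp only
    rw [dif_neg (by push Not; exact hp), if_pos hd]
  · intro d hd hp
    dsimp only
    rw [dif_neg (by push Not; exact hp), if_neg hd]

/-- The lower part `A` of the web `u` fits to the labels at the top of the diagram of `w`: `β` gives
the darts at the posts with the labels `1` and `2`. -/
structure Fits (n ℓ : ℕ) (w : FString) (u : Web m) (A : Set u.Dart) (bl : List u.Dart)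
    (β : ℕ → u.Dart) : Prop where
  mem_iff : ∀ d, d ∈ bl ↔ ∃ p, IsThin n ℓ w w.length p ∧ β p = d
  inj : ∀ p q, IsThin n ℓ w w.length p → IsThin n ℓ w w.length q → β p = β q → p = q
  out : ∀ p, IsThin n ℓ w w.length p → (u.out (β p) = false ↔ label ℓ w w.length p = 1)
  lower : ∃ σ, u.IsLowerPart A bl σ

section Fits

variable {u : Web m} {A A₀ : Set u.Dart} {bl : List u.Dart} {β β₀ : ℕ → u.Dart}
  {e₀ : u.Dart → LDart}

theorem Fits.out_eq (h : Fits n ℓ (w ++ [(i, j)]) u A bl β) (p : ℕ)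
    (hp : IsThin n ℓ (w ++ [(i, j)]) (w.length + 1) p) :
    u.out (β p) = FString.out ℓ (w ++ [(i, j)]) (.vert p (w.length + 1) true) := by
  have := h.out p (by simpa using hp)
  rw [List.length_append, List.length_singleton] at this
  have h2 : FString.out ℓ (w ++ [(i, j)]) (.vert p (w.length + 1) true) =
      !decide (label ℓ (w ++ [(i, j)]) (w.length + 1) p = 1) := by
    rw [FString.out, Bool.true_xor]; rfl
  rw [h2]
  by_cases hl : label ℓ (w ++ [(i, j)]) (w.length + 1) p = 1
  · rw [this.2 hl]; simp [hl]
  · cases ho : u.out (β p)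
    · exact absurd (this.1 ho) hl
    · simp [hl]

variable (D : DrawsLower n ℓ w u A₀ β₀ e₀) (hj : 1 ≤ j) (hi : 1 ≤ i) (hi' : i + 1 ≤ n)
  (hf : Fits n ℓ (w ++ [(i, j)]) u A bl β) (hfar : ∀ q, q ≠ i → q ≠ i + 1 → β q = β₀ q)

include D hj hi hi' hf hfar

/-- Moving an edge, or an erased segment with label three, past an erased segment with label
zero. -/
theorem DrawsLower.append_zero (ha : label ℓ w w.length i = j) (ha' : j ≤ 3)
    (hb : label ℓ w w.length (i + 1) = 0) (hA : A₀ = A) (hβ : β (i + 1) = β₀ i) :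
    ∃ e, DrawsLower n ℓ (w ++ [(i, j)]) u A β e := by
  classical
  subst hA
  obtain ⟨e, e₁, e₂, -⟩ := exists_extension (IsThin n ℓ (w ++ [(i, j)]) (w.length + 1))
    (w.length + 1) β (by simpa using hf.inj) A₀ e₀ e₀
  obtain ⟨σ, hlow⟩ := hf.lower
  have t1 : ¬ IsThin n ℓ (w ++ [(i, j)]) (w.length + 1) i := by
    rw [isThin_append_left hi hi']; omega
  have t2 : IsThin n ℓ (w ++ [(i, j)]) (w.length + 1) (i + 1) ↔ j = 1 ∨ j = 2 := by
    rw [isThin_append_right hi']; omega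
  have t3 : IsThin n ℓ w w.length i ↔ j = 1 ∨ j = 2 := by
    rw [isThin_iff hi (by omega)]; omega
  have t4 : ¬ IsThin n ℓ w w.length (i + 1) := by
    rw [isThin_iff (by omega) hi']; omega
  have s1 := star_append_left (n := n) (ℓ := ℓ) (w := w) (i := i) (j := j)
  have s2 := star_append_right (n := n) (ℓ := ℓ) (w := w) (i := i) (j := j)
  simp only [t1, t2, t3, t4, if_false, List.nil_append, List.append_nil] at s1 s2
  -- the strand through the lower segment of the left post, the rung, and the upper segment of the
  -- right post
  have hT : j = 1 ∨ j = 2 → ∀ x, Strand n ℓ (w ++ [(i, j)]) x (.vert i w.length true) →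
      Strand n ℓ (w ++ [(i, j)]) x (.rung (w.length + 1) true) ∧
      Strand n ℓ (w ++ [(i, j)]) x (.vert (i + 1) (w.length + 1) true) := by
    intro hj' x hx
    rw [if_pos hj', if_pos hj'] at s1 s2
    have h1 : Strand n ℓ (w ++ [(i, j)]) x (.rung (w.length + 1) true) :=
      hx.cont_pair (Or.inl s1) rfl
    exact ⟨h1, h1.cont_pair (Or.inr s2) rfl⟩
  refine ⟨e, D.append hj (D.valid.append hi hi' ha.ge (by omega)) e₁ e₂ le_rfl hlow.opp_mem
    ?_ ?_ hfar ?_ (fun d hd hd' => absurd hd hd') (v := fun _ => none) (by simp) ?_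
    (fun d hd hd' => absurd hd hd') ?_ (fun d hd hd' => absurd hd hd') hf.out_eq⟩
  · intro p hp
    exact hlow.mem_of_mem _ ((hf.mem_iff _).2 ⟨p, by simpa using hp, rfl⟩)
  · intro p hp _
    rcases eq_or_ne p i with rfl | h1
    · exact absurd hp t1
    · rcases eq_or_ne p (i + 1) with rfl | h2
      · exact ⟨i, t3.2 (t2.1 hp), hβ⟩
      · exact ⟨p, (isThin_append_of_ne h1 h2).1 hp, hfar p h1 h2⟩
  · rintro q (rfl | rfl) hq
    · exact Or.inl ⟨q + 1, t2.2 (t3.1 hq), hβ, fun x hx => (hT (t3.1 hq) x hx).2⟩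
    · exact absurd hq t4
  · intro r hr
    exfalso
    rcases eq_or_ne r i with rfl | h1
    · rw [s1] at hr; split_ifs at hr <;> simp at hr
    · rcases eq_or_ne r (i + 1) with rfl | h2
      · rw [s2] at hr; split_ifs at hr <;> simp at hr
      · exact length_star_append_far h1 h2 hr
  · intro hj'
    have hm := (D.bd i (t3.2 hj')).1
    refine ⟨β (i + 1), hβ ▸ hm, false, ?_⟩
    rw [e₁ _ (t2.2 hj')]
    rw [if_pos hj', if_pos hj'] at s2
    have h3 : Strand n ℓ (w ++ [(i, j)]) (.vert (i + 1) (w.length + 1) true)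
        (.vert (i + 1) (w.length + 1) false) := Strand.edge _
    exact h3.cont_pair (Or.inl s2) rfl

/-- Moving an edge past an erased segment with label three. -/
theorem DrawsLower.append_three (ha : label ℓ w w.length i = 3) (hj' : j = 1 ∨ j = 2)
    (hb : label ℓ w w.length (i + 1) = 3 - j) (hA : A₀ = A) (hβ : β i = β₀ (i + 1)) :
    ∃ e, DrawsLower n ℓ (w ++ [(i, j)]) u A β e := by
  classical
  subst hA
  obtain ⟨e, e₁, e₂, -⟩ := exists_extension (IsThin n ℓ (w ++ [(i, j)]) (w.length + 1))
    (w.length + 1) β (by simpa using hf.inj) A₀ e₀ e₀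
  obtain ⟨σ, hlow⟩ := hf.lower
  have t1 : IsThin n ℓ (w ++ [(i, j)]) (w.length + 1) i := by
    rw [isThin_append_left hi hi']; omega
  have t2 : ¬ IsThin n ℓ (w ++ [(i, j)]) (w.length + 1) (i + 1) := by
    rw [isThin_append_right hi']; omega
  have t3 : ¬ IsThin n ℓ w w.length i := by
    rw [isThin_iff hi (by omega)]; omega
  have t4 : IsThin n ℓ w w.length (i + 1) := by
    rw [isThin_iff (by omega) hi']; omega
  have s1 := star_append_left (n := n) (ℓ := ℓ) (w := w) (i := i) (j := j)
  have s2 := star_append_right (n := n) (ℓ := ℓ) (w := w) (i := i) (j := j)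
  simp only [t1, t2, t3, t4, hj', if_false, if_true, List.nil_append, List.append_nil,
    List.cons_append] at s1 s2
  refine ⟨e, D.append hj (D.valid.append hi hi' (by omega) (by omega)) e₁ e₂ le_rfl hlow.opp_mem
    ?_ ?_ hfar ?_ (fun d hd hd' => absurd hd hd') (v := fun _ => none) (by simp) ?_
    (fun d hd hd' => absurd hd hd') ?_ (fun d hd hd' => absurd hd hd') hf.out_eq⟩
  · intro p hp
    exact hlow.mem_of_mem _ ((hf.mem_iff _).2 ⟨p, by simpa using hp, rfl⟩)
  · intro p hp _
    rcases eq_or_ne p i with rfl | h1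
    · exact ⟨p + 1, t4, hβ⟩
    · rcases eq_or_ne p (i + 1) with rfl | h2
      · exact absurd hp t2
      · exact ⟨p, (isThin_append_of_ne h1 h2).1 hp, hfar p h1 h2⟩
  · rintro q (rfl | rfl) hq
    · exact absurd hq t3
    · refine Or.inl ⟨i, t1, hβ, fun x hx => ?_⟩
      have h1 : Strand n ℓ (w ++ [(i, j)]) x (.rung (w.length + 1) false) :=
        hx.cont_pair (Or.inr s2) rfl
      exact h1.cont_pair (Or.inr s1) rfl
  · intro r hr
    exfalso
    rcases eq_or_ne r i with rfl | h1
    · rw [s1] at hr; simp at hr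
    · rcases eq_or_ne r (i + 1) with rfl | h2
      · rw [s2] at hr; simp at hr
      · exact length_star_append_far h1 h2 hr
  · intro _
    have hm := (D.bd _ t4).1
    refine ⟨β i, hβ ▸ hm, true, ?_⟩
    rw [e₁ _ t1]
    have h3 : Strand n ℓ (w ++ [(i, j)]) (.vert i (w.length + 1) true)
        (.vert i (w.length + 1) false) := Strand.edge _
    exact h3.cont_pair (Or.inl s1) rfl

/-- Adding an arc. -/
theorem DrawsLower.append_arc (ha : label ℓ w w.length i = 3) (hj' : j = 1 ∨ j = 2)
    (hb : label ℓ w w.length (i + 1) = 0) (hopp : u.opp (β i) = β (i + 1))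
    (hA : A₀ = A \ {β i, β (i + 1)}) :
    ∃ e, DrawsLower n ℓ (w ++ [(i, j)]) u A β e := by
  classical
  obtain ⟨e, e₁, e₂, -⟩ := exists_extension (IsThin n ℓ (w ++ [(i, j)]) (w.length + 1))
    (w.length + 1) β (by simpa using hf.inj) A₀ e₀ e₀
  obtain ⟨σ, hlow⟩ := hf.lower
  have t1 : IsThin n ℓ (w ++ [(i, j)]) (w.length + 1) i := by
    rw [isThin_append_left hi hi']; omega
  have t2 : IsThin n ℓ (w ++ [(i, j)]) (w.length + 1) (i + 1) := by
    rw [isThin_append_right hi']; omega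
  have t3 : ¬ IsThin n ℓ w w.length i := by
    rw [isThin_iff hi (by omega)]; omega
  have t4 : ¬ IsThin n ℓ w w.length (i + 1) := by
    rw [isThin_iff (by omega) hi']; omega
  have s1 := star_append_left (n := n) (ℓ := ℓ) (w := w) (i := i) (j := j)
  have s2 := star_append_right (n := n) (ℓ := ℓ) (w := w) (i := i) (j := j)
  simp only [t1, t2, t3, t4, hj', if_false, if_true, List.append_nil, List.cons_append,
    List.nil_append] at s1 s2
  -- the arc runs down the left post, along the rung, and up the right post
  have hr : Strand n ℓ (w ++ [(i, j)]) (.vert i (w.length + 1) true)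
      (.rung (w.length + 1) true) :=
    (Strand.edge _ : Strand n ℓ (w ++ [(i, j)]) _ (.vert i (w.length + 1) false)).cont_pair
      (Or.inl s1) rfl
  have hs : Strand n ℓ (w ++ [(i, j)]) (.vert i (w.length + 1) true)
      (.vert (i + 1) (w.length + 1) true) := hr.cont_pair (Or.inr s2) rfl
  have hmem : ∀ p, IsThin n ℓ (w ++ [(i, j)]) (w.length + 1) p → β p ∈ A := fun p hp =>
    hlow.mem_of_mem _ ((hf.mem_iff _).2 ⟨p, by simpa using hp, rfl⟩)
  have hnew : ∀ d ∈ A, d ∉ A₀ → d = β i ∨ d = β (i + 1) := by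
    intro d hd hd'
    by_contra h
    exact hd' (hA ▸ ⟨hd, h⟩)
  refine ⟨e, D.append hj (D.valid.append hi hi' (by omega) (by omega)) e₁ e₂
    (hA ▸ Set.sdiff_subset) hlow.opp_mem hmem ?_ hfar ?_ ?_ (v := fun _ => none) (by simp) ?_ ?_ ?_
    ?_ hf.out_eq⟩
  · intro p hp hp'
    rw [hA] at hp'
    rcases eq_or_ne p i with rfl | h1
    · exact absurd (Or.inl rfl) hp'.2
    · rcases eq_or_ne p (i + 1) with rfl | h2
      · exact absurd (Or.inr rfl) hp'.2
      · exact ⟨p, (isThin_append_of_ne h1 h2).1 hp, hfar p h1 h2⟩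
  · rintro q (rfl | rfl) hq
    · exact absurd hq t3
    · exact absurd hq t4
  · intro d hd hd'
    rcases hnew d hd hd' with rfl | rfl
    · exact Or.inl ⟨_, t1, rfl⟩
    · exact Or.inl ⟨_, t2, rfl⟩
  · intro r hr
    exfalso
    rcases eq_or_ne r i with rfl | h1
    · rw [s1] at hr; simp at hr
    · rcases eq_or_ne r (i + 1) with rfl | h2
      · rw [s2] at hr; simp at hr
      · exact length_star_append_far h1 h2 hr
  · intro d hd hd'
    rcases hnew d hd hd' with rfl | rfl
    · rw [hopp, e₁ _ t1, e₁ _ t2]; exact hs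
    · rw [← hopp, u.opp_opp, hopp, e₁ _ t1, e₁ _ t2]; exact hs.symm
  · exact fun _ => ⟨β i, hmem i t1, true, by rw [e₁ _ t1]; exact hr⟩
  · intro d hd hd'
    rcases hnew d hd hd' with rfl | rfl
    · rw [hf.out_eq _ t1, e₁ _ t1]
    · rw [hf.out_eq _ t2, e₁ _ t2]

/-- Adding a trivalent vertex with one leg at the bottom, on the left post. -/
theorem DrawsLower.append_fork_left (ha : label ℓ w w.length i = 2) (hj' : j = 1)
    (hb : label ℓ w w.length (i + 1) = 0) (h₁ : u.opp (β i) ∉ bl) (h₂ : u.opp (β (i + 1)) ∉ bl)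
    (h₃ : u.rot (u.opp (β (i + 1))) = u.opp (β i)) (hβ : β₀ i = u.rot (u.opp (β i)))
    (hA : A₀ = A \ {β i, β (i + 1), u.opp (β i), u.opp (β (i + 1))}) :
    ∃ e, DrawsLower n ℓ (w ++ [(i, j)]) u A β e := by
  classical
  obtain ⟨σ, hlow⟩ := hf.lower
  have t1 : IsThin n ℓ (w ++ [(i, j)]) (w.length + 1) i := by
    rw [isThin_append_left hi hi']; omega
  have t2 : IsThin n ℓ (w ++ [(i, j)]) (w.length + 1) (i + 1) := by
    rw [isThin_append_right hi']; omega
  have t3 : IsThin n ℓ w w.length i := by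
    rw [isThin_iff hi (by omega)]; omega
  have t4 : ¬ IsThin n ℓ w w.length (i + 1) := by
    rw [isThin_iff (by omega) hi']; omega
  have s1 := star_append_left (n := n) (ℓ := ℓ) (w := w) (i := i) (j := j)
  have s2 := star_append_right (n := n) (ℓ := ℓ) (w := w) (i := i) (j := j)
  simp only [t1, t2, t3, t4, show j = 1 ∨ j = 2 from Or.inl hj', if_false, if_true,
    List.append_nil, List.cons_append, List.nil_append] at s1 s2
  have hbl : ∀ p, IsThin n ℓ (w ++ [(i, j)]) (w.length + 1) p → β p ∈ bl := fun p hp =>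
    (hf.mem_iff _).2 ⟨p, by simpa using hp, rfl⟩
  have hmem := fun p hp => hlow.mem_of_mem _ (hbl p hp)
  have hx := hlow.opp_mem _ (hmem i t1)
  have hy := hlow.opp_mem _ (hmem _ t2)
  have hxy : u.opp (β i) ≠ u.opp (β (i + 1)) := fun h => by
    have := hf.inj i (i + 1) (by simpa using t1) (by simpa using t2) (u.opp.injective h)
    omega
  have hne : ∀ d, d ∉ bl → ∀ p, IsThin n ℓ (w ++ [(i, j)]) (w.length + 1) p → β p ≠ d :=
    fun d hd p hp h => hd (h ▸ hbl p hp)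
  -- the vertex lies on the left post; its darts point up, down, and to the right
  obtain ⟨e, e₁, e₂, e₃⟩ := exists_extension (IsThin n ℓ (w ++ [(i, j)]) (w.length + 1))
    (w.length + 1) β (by simpa using hf.inj) A₀ e₀ fun d =>
      if d = u.opp (β i) then .vert i (w.length + 1) false else .rung (w.length + 1) false
  have hz := hlow.rot_mem _ hx h₁
  have hz' := hlow.rot_notMem _ hx h₁
  have hzy : u.rot (u.rot (u.opp (β i))) = u.opp (β (i + 1)) := by
    rw [← h₃, hlow.rot_rot_rot hy h₂]
  have ex : e (u.opp (β i)) = .vert i (w.length + 1) false := by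
    rw [e₃ _ (by rw [hA]; simp) (hne _ h₁), if_pos rfl]
  have ey : e (u.opp (β (i + 1))) = .rung (w.length + 1) false := by
    rw [e₃ _ (by rw [hA]; simp) (hne _ h₂), if_neg hxy.symm]
  have ez : e (u.rot (u.opp (β i))) = .vert i w.length true := by
    rw [← (D.bd i t3).2, hβ, e₂ _ (hβ ▸ (D.bd i t3).1) (hne _ hz')]
  -- the right leg turns from the rung into the right post
  have hy₂ : Strand n ℓ (w ++ [(i, j)]) (.rung (w.length + 1) false)
      (.vert (i + 1) (w.length + 1) true) :=
    (Strand.edge _ : Strand n ℓ (w ++ [(i, j)]) _ (.rung (w.length + 1) true)).cont_pair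
      (Or.inr s2) rfl
  have hnew : ∀ d ∈ A, d ∉ A₀ → d = β i ∨ d = β (i + 1) ∨ d = u.opp (β i) ∨
      d = u.opp (β (i + 1)) := by
    intro d hd hd'
    by_contra h
    exact hd' (hA ▸ ⟨hd, h⟩)
  refine ⟨e, D.append hj (D.valid.append hi hi' (by omega) (by omega)) e₁ e₂
    (hA ▸ Set.sdiff_subset) hlow.opp_mem hmem ?_ hfar ?_ ?_
    (v := fun r => if r = i then some (u.opp (β i)) else none) ?_ ?_ ?_ ?_ ?_ hf.out_eq⟩
  · intro p hp hp'
    rw [hA] at hp'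
    rcases eq_or_ne p i with rfl | h1
    · exact absurd (Or.inl rfl) hp'.2
    · rcases eq_or_ne p (i + 1) with rfl | h2
      · exact absurd (Or.inr (Or.inl rfl)) hp'.2
      · exact ⟨p, (isThin_append_of_ne h1 h2).1 hp, hfar p h1 h2⟩
  · rintro q (rfl | rfl) hq
    · refine Or.inr ⟨?_, q, _, if_pos rfl, Or.inr (Or.inl hβ)⟩
      rw [hβ]; exact hne _ hz'
    · exact absurd hq t4
  · intro d hd hd'
    rcases hnew d hd hd' with rfl | rfl | rfl | rfl
    · exact Or.inl ⟨_, t1, rfl⟩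
    · exact Or.inl ⟨_, t2, rfl⟩
    · exact Or.inr ⟨i, _, if_pos rfl, Or.inl rfl⟩
    · exact Or.inr ⟨i, _, if_pos rfl, Or.inr (Or.inr hzy.symm)⟩
  · intro r x hr
    split_ifs at hr with hri
    subst hri
    obtain rfl : u.opp (β r) = x := by simpa using hr
    refine ⟨⟨hx, hz, hzy ▸ hy⟩, hlow.rot_rot_rot hx h₁, ?_⟩
    rw [s1, hzy, ex, ey, ez]
  · intro r hr
    rcases eq_or_ne r i with rfl | h1
    · exact ⟨_, if_pos rfl⟩
    · exfalso
      rcases eq_or_ne r (i + 1) with rfl | h2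
      · rw [s2] at hr; simp at hr
      · exact length_star_append_far h1 h2 hr
  · intro d hd hd'
    rcases hnew d hd hd' with rfl | rfl | rfl | rfl
    · rw [ex, e₁ _ t1]; exact Strand.edge _
    · rw [ey, e₁ _ t2]; exact hy₂.symm
    · rw [u.opp_opp, ex, e₁ _ t1]; exact Strand.edge _
    · rw [u.opp_opp, ey, e₁ _ t2]; exact hy₂
  · exact fun _ => ⟨_, hy, true, by rw [ey]; exact Strand.edge _⟩
  · intro d hd hd'
    rcases hnew d hd hd' with rfl | rfl | rfl | rfl
    · rw [hf.out_eq _ t1, e₁ _ t1]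
    · rw [hf.out_eq _ t2, e₁ _ t2]
    · rw [u.out_opp, hf.out_eq _ t1, ex, out_vert_false]
    · rw [u.out_opp, hf.out_eq _ t2, ey]
      simp [FString.out, dartLabel, step_append_last, label_append_right, hb, hj']

/-- Adding a trivalent vertex with one leg at the bottom, on the right post. -/
theorem DrawsLower.append_fork_right (ha : label ℓ w w.length i = 3) (hj' : j = 1)
    (hb : label ℓ w w.length (i + 1) = 1) (h₁ : u.opp (β i) ∉ bl) (h₂ : u.opp (β (i + 1)) ∉ bl)
    (h₃ : u.rot (u.opp (β (i + 1))) = u.opp (β i)) (hβ : β₀ (i + 1) = u.rot (u.opp (β i)))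
    (hA : A₀ = A \ {β i, β (i + 1), u.opp (β i), u.opp (β (i + 1))}) :
    ∃ e, DrawsLower n ℓ (w ++ [(i, j)]) u A β e := by
  classical
  obtain ⟨σ, hlow⟩ := hf.lower
  have t1 : IsThin n ℓ (w ++ [(i, j)]) (w.length + 1) i := by
    rw [isThin_append_left hi hi']; omega
  have t2 : IsThin n ℓ (w ++ [(i, j)]) (w.length + 1) (i + 1) := by
    rw [isThin_append_right hi']; omega
  have t3 : ¬ IsThin n ℓ w w.length i := by
    rw [isThin_iff hi (by omega)]; omega
  have t4 : IsThin n ℓ w w.length (i + 1) := by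
    rw [isThin_iff (by omega) hi']; omega
  have s1 := star_append_left (n := n) (ℓ := ℓ) (w := w) (i := i) (j := j)
  have s2 := star_append_right (n := n) (ℓ := ℓ) (w := w) (i := i) (j := j)
  simp only [t1, t2, t3, t4, show j = 1 ∨ j = 2 from Or.inl hj', if_false, if_true,
    List.append_nil, List.cons_append, List.nil_append] at s1 s2
  have hbl : ∀ p, IsThin n ℓ (w ++ [(i, j)]) (w.length + 1) p → β p ∈ bl := fun p hp =>
    (hf.mem_iff _).2 ⟨p, by simpa using hp, rfl⟩
  have hmem := fun p hp => hlow.mem_of_mem _ (hbl p hp)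
  have hx := hlow.opp_mem _ (hmem i t1)
  have hy := hlow.opp_mem _ (hmem _ t2)
  have hxy : u.opp (β i) ≠ u.opp (β (i + 1)) := fun h => by
    have := hf.inj i (i + 1) (by simpa using t1) (by simpa using t2) (u.opp.injective h)
    omega
  have hne : ∀ d, d ∉ bl → ∀ p, IsThin n ℓ (w ++ [(i, j)]) (w.length + 1) p → β p ≠ d :=
    fun d hd p hp h => hd (h ▸ hbl p hp)
  -- the vertex lies on the right post; its darts point up, to the left, and down
  obtain ⟨e, e₁, e₂, e₃⟩ := exists_extension (IsThin n ℓ (w ++ [(i, j)]) (w.length + 1))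
    (w.length + 1) β (by simpa using hf.inj) A₀ e₀ fun d =>
      if d = u.opp (β i) then .rung (w.length + 1) true
      else .vert (i + 1) (w.length + 1) false
  have hz := hlow.rot_mem _ hx h₁
  have hz' := hlow.rot_notMem _ hx h₁
  have ex : e (u.opp (β i)) = .rung (w.length + 1) true := by
    rw [e₃ _ (by rw [hA]; simp) (hne _ h₁), if_pos rfl]
  have ey : e (u.opp (β (i + 1))) = .vert (i + 1) (w.length + 1) false := by
    rw [e₃ _ (by rw [hA]; simp) (hne _ h₂), if_neg hxy.symm]
  have ez : e (u.rot (u.opp (β i))) = .vert (i + 1) w.length true := by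
    rw [← (D.bd _ t4).2, hβ, e₂ _ (hβ ▸ (D.bd _ t4).1) (hne _ hz')]
  have hx₂ : Strand n ℓ (w ++ [(i, j)]) (.rung (w.length + 1) true)
      (.vert i (w.length + 1) true) :=
    (Strand.edge _ : Strand n ℓ (w ++ [(i, j)]) _ (.rung (w.length + 1) false)).cont_pair
      (Or.inr s1) rfl
  have hnew : ∀ d ∈ A, d ∉ A₀ → d = β i ∨ d = β (i + 1) ∨ d = u.opp (β i) ∨
      d = u.opp (β (i + 1)) := by
    intro d hd hd'
    by_contra h
    exact hd' (hA ▸ ⟨hd, h⟩)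
  refine ⟨e, D.append hj (D.valid.append hi hi' (by omega) (by omega)) e₁ e₂
    (hA ▸ Set.sdiff_subset) hlow.opp_mem hmem ?_ hfar ?_ ?_
    (v := fun r => if r = i + 1 then some (u.opp (β (i + 1))) else none) ?_ ?_ ?_ ?_ ?_ hf.out_eq⟩
  · intro p hp hp'
    rw [hA] at hp'
    rcases eq_or_ne p i with rfl | h1
    · exact absurd (Or.inl rfl) hp'.2
    · rcases eq_or_ne p (i + 1) with rfl | h2
      · exact absurd (Or.inr (Or.inl rfl)) hp'.2
      · exact ⟨p, (isThin_append_of_ne h1 h2).1 hp, hfar p h1 h2⟩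
  · rintro q (rfl | rfl) hq
    · exact absurd hq t3
    · refine Or.inr ⟨?_, i + 1, _, if_pos rfl, Or.inr (Or.inr ?_)⟩
      · rw [hβ]; exact hne _ hz'
      · rw [h₃, hβ]
  · intro d hd hd'
    rcases hnew d hd hd' with rfl | rfl | rfl | rfl
    · exact Or.inl ⟨_, t1, rfl⟩
    · exact Or.inl ⟨_, t2, rfl⟩
    · exact Or.inr ⟨i + 1, _, if_pos rfl, Or.inr (Or.inl h₃.symm)⟩
    · exact Or.inr ⟨i + 1, _, if_pos rfl, Or.inl rfl⟩
  · intro r x hr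
    split_ifs at hr with hri
    subst hri
    obtain rfl : u.opp (β (i + 1)) = x := by simpa using hr
    refine ⟨⟨hy, h₃ ▸ hx, h₃ ▸ hz⟩, hlow.rot_rot_rot hy h₂, ?_⟩
    rw [s2, h₃, ex, ey, ez]
  · intro r hr
    rcases eq_or_ne r (i + 1) with rfl | h1
    · exact ⟨_, if_pos rfl⟩
    · exfalso
      rcases eq_or_ne r i with rfl | h2
      · rw [s1] at hr; simp at hr
      · exact length_star_append_far h2 h1 hr
  · intro d hd hd'
    rcases hnew d hd hd' with rfl | rfl | rfl | rfl
    · rw [ex, e₁ _ t1]; exact hx₂.symm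
    · rw [ey, e₁ _ t2]; exact Strand.edge _
    · rw [u.opp_opp, ex, e₁ _ t1]; exact hx₂
    · rw [u.opp_opp, ey, e₁ _ t2]; exact Strand.edge _
  · exact fun _ => ⟨_, hx, false, by rw [ex]; exact Strand.edge _⟩
  · intro d hd hd'
    rcases hnew d hd hd' with rfl | rfl | rfl | rfl
    · rw [hf.out_eq _ t1, e₁ _ t1]
    · rw [hf.out_eq _ t2, e₁ _ t2]
    · rw [u.out_opp, hf.out_eq _ t1, ex]
      simp [FString.out, dartLabel, step_append_last, label_append_left, ha, hj']
    · rw [u.out_opp, hf.out_eq _ t2, ey, out_vert_false]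

/-- Adding an `H`. -/
theorem DrawsLower.append_rung (ha : label ℓ w w.length i = 2) (hj' : j = 1)
    (hb : label ℓ w w.length (i + 1) = 1) (h₁ : u.opp (β i) ∉ bl) (h₂ : u.opp (β (i + 1)) ∉ bl)
    {c : u.Dart} (hc : c ∉ bl) (hc' : u.opp c ∉ bl) (h₃ : u.rot c = u.opp (β i))
    (h₄ : u.rot (u.opp (β (i + 1))) = u.opp c)
    (hβ : β₀ i = u.rot (u.opp (β i))) (hβ' : β₀ (i + 1) = u.rot (u.opp c))
    (hA : A₀ = A \ {β i, β (i + 1), u.opp (β i), u.opp (β (i + 1)), c, u.opp c}) :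
    ∃ e, DrawsLower n ℓ (w ++ [(i, j)]) u A β e := by
  classical
  obtain ⟨σ, hlow⟩ := hf.lower
  have t1 : IsThin n ℓ (w ++ [(i, j)]) (w.length + 1) i := by
    rw [isThin_append_left hi hi']; omega
  have t2 : IsThin n ℓ (w ++ [(i, j)]) (w.length + 1) (i + 1) := by
    rw [isThin_append_right hi']; omega
  have t3 : IsThin n ℓ w w.length i := by
    rw [isThin_iff hi (by omega)]; omega
  have t4 : IsThin n ℓ w w.length (i + 1) := by
    rw [isThin_iff (by omega) hi']; omega
  have s1 := star_append_left (n := n) (ℓ := ℓ) (w := w) (i := i) (j := j)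
  have s2 := star_append_right (n := n) (ℓ := ℓ) (w := w) (i := i) (j := j)
  simp only [t1, t2, t3, t4, show j = 1 ∨ j = 2 from Or.inl hj', if_true,
    List.cons_append, List.nil_append] at s1 s2
  have hbl : ∀ p, IsThin n ℓ (w ++ [(i, j)]) (w.length + 1) p → β p ∈ bl := fun p hp =>
    (hf.mem_iff _).2 ⟨p, by simpa using hp, rfl⟩
  have hmem := fun p hp => hlow.mem_of_mem _ (hbl p hp)
  have hx := hlow.opp_mem _ (hmem i t1)
  have hy := hlow.opp_mem _ (hmem _ t2)
  have hxy : u.opp (β i) ≠ u.opp (β (i + 1)) := fun h => by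
    have := hf.inj i (i + 1) (by simpa using t1) (by simpa using t2) (u.opp.injective h)
    omega
  have hne : ∀ d, d ∉ bl → ∀ p, IsThin n ℓ (w ++ [(i, j)]) (w.length + 1) p → β p ≠ d :=
    fun d hd p hp h => hd (h ▸ hbl p hp)
  -- both ends of the rung are trivalent vertices, and `c` points from left to right
  obtain ⟨e, e₁, e₂, e₃⟩ := exists_extension (IsThin n ℓ (w ++ [(i, j)]) (w.length + 1))
    (w.length + 1) β (by simpa using hf.inj) A₀ e₀ fun d =>
      if d = u.opp (β i) then .vert i (w.length + 1) false
      else if d = u.opp (β (i + 1)) then .vert (i + 1) (w.length + 1) false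
      else if d = c then .rung (w.length + 1) false else .rung (w.length + 1) true
  have hz := hlow.rot_mem _ hx h₁
  have hz' := hlow.rot_notMem _ hx h₁
  have hzc : u.rot (u.rot (u.opp (β i))) = c := by
    refine u.rot.injective ?_
    rw [hlow.rot_rot_rot hx h₁, h₃]
  have hcA : c ∈ A := hzc ▸ hlow.rot_mem _ hz hz'
  have hcA' := hlow.opp_mem c hcA
  have hq := hlow.rot_mem _ hcA' hc'
  have hq' := hlow.rot_notMem _ hcA' hc'
  have hcx : c ≠ u.opp (β i) := fun h => hlow.rot_ne hcA hc (h₃.trans h.symm)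
  have hcy : c ≠ u.opp (β (i + 1)) := fun h => hc' (by rw [h, u.opp_opp]; exact hbl _ t2)
  have hcx' : u.opp c ≠ u.opp (β i) := fun h => hc (u.opp.injective h ▸ hbl _ t1)
  have hcy' : u.opp c ≠ u.opp (β (i + 1)) := fun h => hc (u.opp.injective h ▸ hbl _ t2)
  have ex : e (u.opp (β i)) = .vert i (w.length + 1) false := by
    rw [e₃ _ (by rw [hA]; simp) (hne _ h₁), if_pos rfl]
  have ey : e (u.opp (β (i + 1))) = .vert (i + 1) (w.length + 1) false := by
    rw [e₃ _ (by rw [hA]; simp) (hne _ h₂), if_neg hxy.symm, if_pos rfl]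
  have ec : e c = .rung (w.length + 1) false := by
    rw [e₃ _ (by rw [hA]; simp) (hne _ hc), if_neg hcx, if_neg hcy, if_pos rfl]
  have ec' : e (u.opp c) = .rung (w.length + 1) true := by
    rw [e₃ _ (by rw [hA]; simp) (hne _ hc'), if_neg hcx', if_neg hcy', if_neg (u.opp_ne c)]
  have ez : e (u.rot (u.opp (β i))) = .vert i w.length true := by
    rw [← (D.bd _ t3).2, hβ, e₂ _ (hβ ▸ (D.bd _ t3).1) (hne _ hz')]
  have eq : e (u.rot (u.opp c)) = .vert (i + 1) w.length true := by
    rw [← (D.bd _ t4).2, hβ', e₂ _ (hβ' ▸ (D.bd _ t4).1) (hne _ hq')]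
  have hnew : ∀ d ∈ A, d ∉ A₀ → d = β i ∨ d = β (i + 1) ∨ d = u.opp (β i) ∨
      d = u.opp (β (i + 1)) ∨ d = c ∨ d = u.opp c := by
    intro d hd hd'
    by_contra h
    exact hd' (hA ▸ ⟨hd, h⟩)
  refine ⟨e, D.append hj (D.valid.append hi hi' (by omega) (by omega)) e₁ e₂
    (hA ▸ Set.sdiff_subset) hlow.opp_mem hmem ?_ hfar ?_ ?_
    (v := fun r => if r = i then some (u.opp (β i)) else
      if r = i + 1 then some (u.opp (β (i + 1))) else none) ?_ ?_ ?_ ?_ ?_ hf.out_eq⟩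
  · intro p hp hp'
    rw [hA] at hp'
    rcases eq_or_ne p i with rfl | h1
    · exact absurd (Or.inl rfl) hp'.2
    · rcases eq_or_ne p (i + 1) with rfl | h2
      · exact absurd (Or.inr (Or.inl rfl)) hp'.2
      · exact ⟨p, (isThin_append_of_ne h1 h2).1 hp, hfar p h1 h2⟩
  · rintro q (rfl | rfl) hq
    · refine Or.inr ⟨?_, q, _, if_pos rfl, Or.inr (Or.inl hβ)⟩
      rw [hβ]; exact hne _ hz'
    · refine Or.inr ⟨?_, i + 1, u.opp (β (i + 1)), by simp, Or.inr (Or.inr ?_)⟩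
      · rw [hβ']; exact hne _ hq'
      · rw [h₄, hβ']
  · intro d hd hd'
    rcases hnew d hd hd' with rfl | rfl | rfl | rfl | rfl | rfl
    · exact Or.inl ⟨_, t1, rfl⟩
    · exact Or.inl ⟨_, t2, rfl⟩
    · exact Or.inr ⟨i, _, if_pos rfl, Or.inl rfl⟩
    · exact Or.inr ⟨i + 1, u.opp (β (i + 1)), by simp, Or.inl rfl⟩
    · exact Or.inr ⟨i, _, if_pos rfl, Or.inr (Or.inr hzc.symm)⟩
    · exact Or.inr ⟨i + 1, u.opp (β (i + 1)), by simp, Or.inr (Or.inl h₄.symm)⟩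
  · intro r x hr
    split_ifs at hr with hri hri
    · subst hri
      obtain rfl : u.opp (β r) = x := by simpa using hr
      refine ⟨⟨hx, hz, hzc ▸ hcA⟩, hlow.rot_rot_rot hx h₁, ?_⟩
      rw [s1, hzc, ex, ec, ez]
    · subst hri
      obtain rfl : u.opp (β (i + 1)) = x := by simpa using hr
      refine ⟨⟨hy, h₄ ▸ hcA', h₄ ▸ hq⟩, hlow.rot_rot_rot hy h₂, ?_⟩
      rw [s2, h₄, ec', ey, eq]
  · intro r hr
    rcases eq_or_ne r i with rfl | h2
    · exact ⟨_, if_pos rfl⟩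
    · rcases eq_or_ne r (i + 1) with rfl | h1
      · exact ⟨u.opp (β (i + 1)), by simp⟩
      · exact absurd hr (length_star_append_far h2 h1)
  · intro d hd hd'
    rcases hnew d hd hd' with rfl | rfl | rfl | rfl | rfl | rfl
    · rw [ex, e₁ _ t1]; exact Strand.edge _
    · rw [ey, e₁ _ t2]; exact Strand.edge _
    · rw [u.opp_opp, ex, e₁ _ t1]; exact Strand.edge _
    · rw [u.opp_opp, ey, e₁ _ t2]; exact Strand.edge _
    · rw [ec, ec']; exact Strand.edge _
    · rw [u.opp_opp, ec, ec']; exact Strand.edge _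
  · exact fun _ => ⟨_, hcA, true, by rw [ec]; exact Strand.edge _⟩
  · have hoc : u.out c = true := by
      rw [← u.out_rot c (hlow.notMem_range c hcA hc), h₃, u.out_opp, hf.out_eq _ t1]
      simp [FString.out, dartLabel, label_append_left, ha, hj']
    intro d hd hd'
    rcases hnew d hd hd' with rfl | rfl | rfl | rfl | rfl | rfl
    · rw [hf.out_eq _ t1, e₁ _ t1]
    · rw [hf.out_eq _ t2, e₁ _ t2]
    · rw [u.out_opp, hf.out_eq _ t1, ex, out_vert_false]
    · rw [u.out_opp, hf.out_eq _ t2, ey, out_vert_false]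
    · rw [hoc, ec]; simp [FString.out, dartLabel, step_append_last, hj']
    · rw [u.out_opp, hoc, ec']; simp [FString.out, dartLabel, step_append_last, hj']

end Fits

end FString

/-! ### Every non-elliptic web is a ladder -/

namespace FString

variable {n ℓ m : ℕ}

/-- The darts at the posts with the labels `1` and `2`, from left to right. -/
def thinDarts {D : Type*} (n : ℕ) (a : ℕ → ℤ) (β : ℕ → D) : List D :=
  ((List.range' 1 n).filter fun p => decide (a p = 1 ∨ a p = 2)).map β

theorem mem_thinDarts {D : Type*} {a : ℕ → ℤ} {β : ℕ → D} {d : D} :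
    d ∈ thinDarts n a β ↔ ∃ p, ((1 ≤ p ∧ p ≤ n) ∧ (a p = 1 ∨ a p = 2)) ∧ β p = d := by
  simp only [thinDarts, List.mem_map, List.mem_filter, List.mem_range'_1, decide_eq_true_eq]
  constructor
  · rintro ⟨p, ⟨h1, h2⟩, h3⟩; exact ⟨p, ⟨⟨h1.1, by omega⟩, h2⟩, h3⟩
  · rintro ⟨p, ⟨h1, h2⟩, h3⟩; exact ⟨p, ⟨⟨h1.1, by omega⟩, h2⟩, h3⟩

/-- Two lists of darts at posts that agree away from two neighbouring posts. -/
theorem exists_thinDarts_eq {D : Type*} {a a' : ℕ → ℤ} {β β' : ℕ → D} {i : ℕ} (hi : 1 ≤ i)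
    (hi' : i + 1 ≤ n) (ha : ∀ p, p ≠ i → p ≠ i + 1 → a' p = a p)
    (hβ : ∀ p, p ≠ i → p ≠ i + 1 → β p = β' p) :
    ∃ P Q, thinDarts n a β =
        P ++ ((if a i = 1 ∨ a i = 2 then [β i] else []) ++
          (if a (i + 1) = 1 ∨ a (i + 1) = 2 then [β (i + 1)] else []) ++ Q) ∧
      thinDarts n a' β' =
        P ++ ((if a' i = 1 ∨ a' i = 2 then [β' i] else []) ++
          (if a' (i + 1) = 1 ∨ a' (i + 1) = 2 then [β' (i + 1)] else []) ++ Q) := by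
  have hr : List.range' 1 n = List.range' 1 (i - 1) ++ (i :: (i + 1) :: List.range' (i + 2) (n - i - 1)) := by
    rw [show n = (i - 1) + ((n - i - 1) + 1 + 1) by omega, ← List.range'_append, List.range'_succ,
      List.range'_succ]
    congr 2
    · omega
    · congr 1
      · omega
      · congr 1 <;> omega
  have key : ∀ (c : ℕ → ℤ) (γ : ℕ → D), thinDarts n c γ =
      ((List.range' 1 (i - 1)).filter fun p => decide (c p = 1 ∨ c p = 2)).map γ ++
      ((if c i = 1 ∨ c i = 2 then [γ i] else []) ++
        (if c (i + 1) = 1 ∨ c (i + 1) = 2 then [γ (i + 1)] else []) ++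
      ((List.range' (i + 2) (n - i - 1)).filter fun p => decide (c p = 1 ∨ c p = 2)).map γ) := by
    intro c γ
    rw [thinDarts, hr, List.filter_append, List.map_append, List.filter_cons, List.filter_cons]
    simp only [decide_eq_true_eq]
    split_ifs <;> simp
  have hfar : ∀ l : List ℕ, i ∉ l → i + 1 ∉ l →
      (l.filter fun p => decide (a p = 1 ∨ a p = 2)).map β =
      (l.filter fun p => decide (a' p = 1 ∨ a' p = 2)).map β' := by
    intro l h1 h2
    have hne : ∀ p ∈ l, p ≠ i ∧ p ≠ i + 1 := fun p hp =>
      ⟨fun h => h1 (h ▸ hp), fun h => h2 (h ▸ hp)⟩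
    rw [List.filter_congr fun p hp => by rw [← ha p (hne p hp).1 (hne p hp).2]]
    exact List.map_congr_left fun p hp =>
      hβ p (hne p (List.mem_of_mem_filter hp)).1 (hne p (List.mem_of_mem_filter hp)).2
  refine ⟨_, _, key a β, ?_⟩
  rw [key a' β', hfar _ (by simp; omega) (by simp; omega), hfar _ (by simp) (by simp)]

/-- A lower part of a web, and labels of the posts at the line that cuts it off. -/
structure IsLabelledPart (n ℓ : ℕ) (a : ℕ → ℤ) (u : Web m) (A : Set u.Dart) (β : ℕ → u.Dart) :
    Prop where
  mem_Icc : ∀ p, 0 ≤ a p ∧ a p ≤ 3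
  eq_zero : ∀ p, ¬ (1 ≤ p ∧ p ≤ n) → a p = 0
  sum : ∑ p ∈ Finset.Icc 1 n, a p = 3 * ℓ
  out : ∀ p, 1 ≤ p ∧ p ≤ n → (a p = 1 ∨ a p = 2) → (u.out (β p) = false ↔ a p = 1)
  lower : ∃ σ, u.IsLowerPart A (thinDarts n a β) σ

/-- The labels below a rung of thickness `j` from post `i` to post `i + 1`. -/
def lowerLabels (a : ℕ → ℤ) (i j : ℕ) (p : ℕ) : ℤ :=
  a p + (if p = i then (j : ℤ) else 0) - (if p = i + 1 then (j : ℤ) else 0)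

theorem lowerLabels_left (a : ℕ → ℤ) (i j : ℕ) : lowerLabels a i j i = a i + j := by
  simp [lowerLabels]

theorem lowerLabels_right (a : ℕ → ℤ) (i j : ℕ) :
    lowerLabels a i j (i + 1) = a (i + 1) - j := by
  simp [lowerLabels]

theorem lowerLabels_far (a : ℕ → ℤ) {i p : ℕ} (j : ℕ) (h1 : p ≠ i) (h2 : p ≠ i + 1) :
    lowerLabels a i j p = a p := by
  simp [lowerLabels, h1, h2]

theorem sum_mul_lowerLabels (a f : ℕ → ℤ) {i : ℕ} (j : ℕ) (hi : 1 ≤ i) (hi' : i + 1 ≤ n) :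
    ∑ p ∈ Finset.Icc 1 n, f p * lowerLabels a i j p =
      ∑ p ∈ Finset.Icc 1 n, f p * a p + f i * j - f (i + 1) * j := by
  have h1 : i ∈ Finset.Icc 1 n := Finset.mem_Icc.2 ⟨hi, by omega⟩
  have h2 : i + 1 ∈ Finset.Icc 1 n := Finset.mem_Icc.2 ⟨by omega, hi'⟩
  simp only [lowerLabels, mul_sub, mul_add, mul_ite, mul_zero, Finset.sum_sub_distrib,
    Finset.sum_add_distrib, Finset.sum_ite_eq', h1, h2, if_true]

variable {u : Web m} {A A₀ : Set u.Dart} {β β₀ : ℕ → u.Dart} {a : ℕ → ℤ}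

/-- Labels below a rung: away from its two posts nothing changes, so that only the new darts `β₀ i`,
`β₀ (i + 1)` have to be checked. -/
theorem IsLabelledPart.lowerLabels (h : IsLabelledPart n ℓ a u A β) {i j : ℕ} (hi : 1 ≤ i)
    (hi' : i + 1 ≤ n) (h1 : a i + j ≤ 3) (h2 : (j : ℤ) ≤ a (i + 1))
    (hfar : ∀ p, p ≠ i → p ≠ i + 1 → β p = β₀ p)
    (ho : a i + j = 1 ∨ a i + j = 2 → (u.out (β₀ i) = false ↔ a i + j = 1))
    (ho' : a (i + 1) - j = 1 ∨ a (i + 1) - j = 2 →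
      (u.out (β₀ (i + 1)) = false ↔ a (i + 1) - j = 1))
    (hl : ∀ P Q, thinDarts n a β =
        P ++ ((if a i = 1 ∨ a i = 2 then [β i] else []) ++
          (if a (i + 1) = 1 ∨ a (i + 1) = 2 then [β (i + 1)] else []) ++ Q) →
      ∃ σ, u.IsLowerPart A₀ (P ++ ((if a i + j = 1 ∨ a i + j = 2 then [β₀ i] else []) ++
          (if a (i + 1) - j = 1 ∨ a (i + 1) - j = 2 then [β₀ (i + 1)] else []) ++ Q)) σ) :
    IsLabelledPart n ℓ (FString.lowerLabels a i j) u A₀ β₀ := by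
  refine ⟨?_, ?_, ?_, ?_, ?_⟩
  · intro p
    have := h.mem_Icc p
    rcases eq_or_ne p i with rfl | hp
    · rw [lowerLabels_left]; omega
    · rcases eq_or_ne p (i + 1) with rfl | hp'
      · rw [lowerLabels_right]; omega
      · rw [lowerLabels_far _ _ hp hp']; exact this
  · intro p hp
    rw [lowerLabels_far _ _ (by rintro rfl; omega) (by rintro rfl; omega)]
    exact h.eq_zero p hp
  · have := sum_mul_lowerLabels a (fun _ => 1) j hi hi'
    simp only [one_mul] at this
    rw [this, h.sum]; ring
  · intro p hp
    rcases eq_or_ne p i with rfl | hp1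
    · rw [lowerLabels_left]; exact ho
    · rcases eq_or_ne p (i + 1) with rfl | hp2
      · rw [lowerLabels_right]; exact ho'
      · rw [lowerLabels_far _ _ hp1 hp2, ← hfar p hp1 hp2]; exact h.out p hp
  · obtain ⟨P, Q, e1, e2⟩ := exists_thinDarts_eq (a' := FString.lowerLabels a i j) hi hi'
      (fun p hp hp' => lowerLabels_far a j hp hp') hfar
    obtain ⟨σ, hσ⟩ := hl P Q e1
    refine ⟨σ, ?_⟩
    rw [e2, lowerLabels_left, lowerLabels_right]
    exact hσ

theorem label_append_of_eq_lowerLabels {w : FString} {i j : ℕ}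
    (hw : label ℓ w w.length = lowerLabels a i j) :
    label ℓ (w ++ [(i, j)]) (w ++ [(i, j)]).length = a := by
  funext p
  rw [List.length_append, List.length_singleton]
  rcases eq_or_ne p i with rfl | hp
  · rw [label_append_left, hw, lowerLabels_left]; ring
  · rcases eq_or_ne p (i + 1) with rfl | hp'
    · rw [label_append_right, hw, lowerLabels_right]; ring
    · rw [label_append_far hp hp', hw, lowerLabels_far _ _ hp hp']

theorem IsLabelledPart.fits (h : IsLabelledPart n ℓ a u A β) {w : FString}
    (hw : label ℓ w w.length = a) : Fits n ℓ w u A (thinDarts n a β) β := by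
  subst hw
  obtain ⟨σ, hσ⟩ := h.lower
  refine ⟨fun d => mem_thinDarts, ?_, fun p hp => h.out p hp.1 hp.2, σ, hσ⟩
  intro p q hp hq hpq
  refine List.inj_on_of_nodup_map hσ.nodup ?_ ?_ hpq
  · simp only [List.mem_filter, List.mem_range'_1, decide_eq_true_eq]
    exact ⟨⟨hp.1.1, by have := hp.1.2; omega⟩, hp.2⟩
  · simp only [List.mem_filter, List.mem_range'_1, decide_eq_true_eq]
    exact ⟨⟨hq.1.1, by have := hq.1.2; omega⟩, hq.2⟩

theorem eq_Icc_card_of_isLowerSet {T : Finset ℕ} (h0 : 0 ∉ T)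
    (h : ∀ p, 1 ≤ p → p + 1 ∈ T → p ∈ T) : T = Finset.Icc 1 T.card := by
  have h' : ∀ k p, 1 ≤ p → p + k ∈ T → p ∈ T := by
    intro k
    induction k with
    | zero => exact fun p _ hp => hp
    | succ k ih => exact fun p hp hk => ih p hp (h (p + k) (by omega) hk)
  refine Finset.eq_of_subset_of_card_le (fun p hp => ?_) (by simp)
  have hp0 : 1 ≤ p := Nat.one_le_iff_ne_zero.2 fun h => h0 (h ▸ hp)
  refine Finset.mem_Icc.2 ⟨hp0, ?_⟩
  have : Finset.Icc 1 p ⊆ T := fun q hq => by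
    rw [Finset.mem_Icc] at hq
    exact h' (p - q) q hq.1 (by rwa [Nat.add_sub_cancel' hq.2])
  simpa using Finset.card_le_card this

/-- The empty part is drawn by the empty string. -/
theorem drawsLower_nil : DrawsLower n ℓ [] u ∅ β fun _ => .rung 0 false := by
  have hl : ∀ k p, label ℓ [] k p = 0 ∨ label ℓ [] k p = 3 := by
    intro k p
    rw [label_of_length_le ℓ _ (by simp)]
    simp only [List.length_nil, label_zero]
    split_ifs <;> simp
  have hp : ∀ x, present n ℓ [] x ≠ true := by
    intro x hx
    match x with
    | .vert p k b =>
      have := (present_vert.1 hx).2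
      have := hl k p
      omega
    | .rung k b =>
      have := (present_rung.1 hx).1
      simp at this; omega
  refine ⟨⟨by simp, fun k p => ?_⟩, by simp, by simp, fun x => ?_, fun p hp' => ?_, by simp,
    by simp, fun x hx => absurd hx (hp x), by simp⟩
  · have := hl k p; omega
  · simp [hp x]
  · have := hl ([] : FString).length p
    have := hp'.2
    omega

/-- Labels that cannot be lowered further are those of the highest weight. -/
theorem IsLabelledPart.eq_highest (h : IsLabelledPart n ℓ a u A β) (h0 : thinDarts n a β = [])
    (h1 : ∀ i, 1 ≤ i → i + 1 ≤ n → a i = 0 → a (i + 1) = 0) :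
    label ℓ [] ([] : FString).length = a := by
  have hthin : ∀ p, a p = 0 ∨ a p = 3 := by
    intro p
    have h2 := h.mem_Icc p
    by_cases hp : 1 ≤ p ∧ p ≤ n
    · by_contra h3
      have : β p ∈ thinDarts n a β := mem_thinDarts.2 ⟨p, ⟨hp, by omega⟩, rfl⟩
      rw [h0] at this
      exact absurd this (by simp)
    · exact Or.inl (h.eq_zero p hp)
  set T := (Finset.Icc 1 n).filter fun p => a p = 3 with hT
  have e1 : T = Finset.Icc 1 T.card := by
    refine eq_Icc_card_of_isLowerSet (by simp [hT]) fun p hp hp' => ?_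
    simp only [hT, Finset.mem_filter, Finset.mem_Icc] at hp' ⊢
    refine ⟨⟨hp, by omega⟩, ?_⟩
    rcases hthin p with h2 | h2
    · have := h1 p hp hp'.1.2 h2; omega
    · exact h2
  have e2 : T.card = ℓ := by
    have h2 := h.sum
    rw [Finset.sum_congr rfl fun p _ => show a p = if a p = 3 then 3 else 0 by
      rcases hthin p with h | h <;> simp [h], ← Finset.sum_filter] at h2
    simp only [Finset.sum_const, nsmul_eq_mul] at h2
    have h3 : (T.card : ℤ) * 3 = 3 * ℓ := h2
    omega
  have e3 : ∀ p, a p = 3 ↔ 1 ≤ p ∧ p ≤ ℓ := by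
    intro p
    rw [← Finset.mem_Icc, ← e2, ← e1]
    simp only [hT, Finset.mem_filter, Finset.mem_Icc]
    refine ⟨fun hp => ⟨?_, hp⟩, fun hp => hp.2⟩
    by_contra hn
    rw [h.eq_zero p hn] at hp
    omega
  funext p
  rw [List.length_nil, label_zero]
  split_ifs with hp
  · exact ((e3 p).2 hp).symm
  · exact ((hthin p).resolve_right fun h => hp ((e3 p).1 h)).symm

/-- In a sequence of labels `3, …, 3, *, …, *, 0, …, 0`, consecutive edges are at neighbouring
posts. -/
theorem exists_adjacent_of_thinDarts_eq {D : Type*} {β : ℕ → D}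
    (h0 : ∀ p, 0 ≤ a p ∧ a p ≤ 3)
    (h1 : ∀ i, 1 ≤ i → i + 1 ≤ n → a i = 0 → a (i + 1) = 0)
    (h2 : ∀ i, 1 ≤ i → i + 1 ≤ n → a (i + 1) = 3 → a i = 0 ∨ a i = 3) {P Q : List D} {b₁ b₂ : D}
    (h : thinDarts n a β = P ++ b₁ :: b₂ :: Q) :
    ∃ i, 1 ≤ i ∧ i + 1 ≤ n ∧ (a i = 1 ∨ a i = 2) ∧ (a (i + 1) = 1 ∨ a (i + 1) = 2) ∧
      β i = b₁ ∧ β (i + 1) = b₂ := by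
  rw [thinDarts] at h
  obtain ⟨L, R, e1, rfl, e2⟩ := List.map_eq_append_iff.1 h
  obtain ⟨q, R, rfl, rfl, e3⟩ := List.map_eq_cons_iff.1 e2
  obtain ⟨q', R, rfl, rfl, rfl⟩ := List.map_eq_cons_iff.1 e3
  have hmem : ∀ p, p ∈ L ++ q :: q' :: R ↔ (1 ≤ p ∧ p ≤ n) ∧ (a p = 1 ∨ a p = 2) := by
    intro p
    rw [← e1, List.mem_filter, List.mem_range'_1, decide_eq_true_eq]
    constructor <;> rintro ⟨h, h'⟩ <;> exact ⟨by omega, h'⟩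
  have hs : (L ++ q :: q' :: R).Pairwise (· < ·) := by
    rw [← e1]; exact List.Pairwise.filter _ List.pairwise_lt_range'
  rw [List.pairwise_append, List.pairwise_cons, List.pairwise_cons] at hs
  obtain ⟨-, ⟨s1, s2, -⟩, s3⟩ := hs
  have hq := (hmem q).1 (by simp)
  have hq' := (hmem q').1 (by simp)
  have hlt : q < q' := s1 q' (by simp)
  have key : q' = q + 1 := by
    by_contra hne
    have hnot : ¬ ((1 ≤ q + 1 ∧ q + 1 ≤ n) ∧ (a (q + 1) = 1 ∨ a (q + 1) = 2)) := by
      rw [← hmem, List.mem_append, List.mem_cons, List.mem_cons]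
      rintro (h | h | h | h)
      · have := s3 _ h q (by simp); omega
      · omega
      · omega
      · have := s2 _ h; omega
    have h3 := h0 (q + 1)
    have h4 : a (q + 1) = 0 := by
      by_contra h4
      have := h2 q hq.1.1 (by omega) (by omega)
      omega
    have h5 : ∀ k, q + 1 + k ≤ n → a (q + 1 + k) = 0 := by
      intro k
      induction k with
      | zero => exact fun _ => h4
      | succ k ih => exact fun hk => h1 (q + 1 + k) (by omega) hk (ih (by omega))
    have := h5 (q' - q - 1) (by omega)
    rw [show q + 1 + (q' - q - 1) = q' by omega] at this
    omega
  subst key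
  exact ⟨q, hq.1.1, hq'.1.2, hq.2, hq'.2, rfl, rfl⟩

/-- A lower part of a non-elliptic web with labels that fit is drawn by a string. -/
theorem IsLabelledPart.exists_drawsLower (hu : u.NonElliptic) (N : ℕ)
    (h : IsLabelledPart n ℓ a u A β) (hN : ∑ p ∈ Finset.Icc 1 n, (p : ℤ) * a p < N) :
    ∃ w e, label ℓ w w.length = a ∧ DrawsLower n ℓ w u A β e := by
  classical
  -- a rung raises the weighted sum of the labels by its thickness, so that the sum drops when the
  -- topmost rung is removed
  induction N generalizing a A β with
  | zero =>
    have : 0 ≤ ∑ p ∈ Finset.Icc 1 n, (p : ℤ) * a p :=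
      Finset.sum_nonneg fun p _ => mul_nonneg (by positivity) (h.mem_Icc p).1
    push_cast at hN
    omega
  | succ N ih =>
    -- the rung on top, and the part below it
    have step : ∀ {i j : ℕ} {A₀ : Set u.Dart} {β₀ : ℕ → u.Dart}, 1 ≤ i → i + 1 ≤ n → 1 ≤ j →
        IsLabelledPart n ℓ (FString.lowerLabels a i j) u A₀ β₀ →
        (∀ w e₀, label ℓ w w.length = FString.lowerLabels a i j → DrawsLower n ℓ w u A₀ β₀ e₀ →
          Fits n ℓ (w ++ [(i, j)]) u A (thinDarts n a β) β →
          ∃ e, DrawsLower n ℓ (w ++ [(i, j)]) u A β e) →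
        ∃ w e, label ℓ w w.length = a ∧ DrawsLower n ℓ w u A β e := by
      intro i j A₀ β₀ hi hi' hj h₀ hD
      obtain ⟨w, e₀, hw, D⟩ := ih h₀ (by
        rw [sum_mul_lowerLabels a (fun p => p) j hi hi']
        push_cast at hN ⊢
        nlinarith)
      have hw' := label_append_of_eq_lowerLabels hw
      obtain ⟨e, he⟩ := hD w e₀ hw D (h.fits hw')
      exact ⟨_, e, hw', he⟩
    have hfar : ∀ (i : ℕ) (x y : u.Dart), ∀ p, p ≠ i → p ≠ i + 1 →
        β p = Function.update (Function.update β i x) (i + 1) y p := by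
      intro i x y p h1 h2
      rw [Function.update_of_ne h2, Function.update_of_ne h1]
    have hleft : ∀ (i : ℕ) (x y : u.Dart),
        Function.update (Function.update β i x) (i + 1) y i = x := by
      intro i x y
      rw [Function.update_of_ne (by simp), Function.update_self]
    have hright : ∀ (i : ℕ) (x y : u.Dart),
        Function.update (Function.update β i x) (i + 1) y (i + 1) = y := by
      intro i x y
      rw [Function.update_self]
    -- a label zero to the left of a positive label `j` arises from a rung of thickness `j`
    by_cases h1 : ∀ i, 1 ≤ i → i + 1 ≤ n → a i = 0 → a (i + 1) = 0
    swap
    · push Not at h1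
      obtain ⟨i, hi, hi', h0, h1⟩ := h1
      obtain ⟨j, hj⟩ := Int.eq_ofNat_of_zero_le (h.mem_Icc (i + 1)).1
      have hj3 := (h.mem_Icc (i + 1)).2
      refine step (A₀ := A) (β₀ := Function.update (Function.update β i (β (i + 1))) (i + 1)
        (β (i + 1))) hi hi' (j := j) (by omega) (h.lowerLabels hi hi' (by omega) (by omega)
          (hfar _ _ _) ?_ ?_ ?_) fun w e₀ hw D hf => ?_
      · rw [hleft, h0, zero_add]
        intro hj'
        rw [h.out (i + 1) (by omega) (by omega), hj]
      · omega
      · intro P Q hPQ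
        obtain ⟨σ, hσ⟩ := h.lower
        refine ⟨σ, ?_⟩
        rw [hPQ] at hσ
        rw [hleft]
        simpa [h0, hj] using hσ
      · exact D.append_zero (by omega) hi hi' hf (hfar _ _ _)
          (by rw [hw, lowerLabels_left, h0, zero_add]) (by omega)
          (by rw [hw, lowerLabels_right, hj, sub_self]) rfl (hleft _ _ _).symm
    -- a label three to the right of an edge with label `1` or `2` arises from a rung
    by_cases h2 : ∀ i, 1 ≤ i → i + 1 ≤ n → a (i + 1) = 3 → a i = 0 ∨ a i = 3
    swap
    · push Not at h2
      obtain ⟨i, hi, hi', h3, h2, h2'⟩ := h2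
      have hm := h.mem_Icc i
      obtain ⟨j, hj⟩ := Int.eq_ofNat_of_zero_le (show 0 ≤ 3 - a i by omega)
      refine step (A₀ := A) (β₀ := Function.update (Function.update β i (β i)) (i + 1)
        (β i)) hi hi' (j := j) (by omega) (h.lowerLabels hi hi' (by omega) (by omega)
          (hfar _ _ _) ?_ ?_ ?_) fun w e₀ hw D hf => ?_
      · omega
      · rw [hright, h3]
        intro hj'
        rw [h.out i (by omega) (by omega)]
        omega
      · intro P Q hPQ
        obtain ⟨σ, hσ⟩ := h.lower
        refine ⟨σ, ?_⟩
        rw [hPQ] at hσ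
        rw [hright, if_neg (by omega), if_pos (by omega)]
        rw [if_pos (by omega), if_neg (by omega)] at hσ
        simpa using hσ
      · exact D.append_three (by omega) hi hi' hf (hfar _ _ _)
          (by rw [hw, lowerLabels_left]; omega) (by omega)
          (by rw [hw, lowerLabels_right, h3]) rfl (hright _ _ _).symm
    obtain ⟨σ, hσ⟩ := h.lower
    by_cases hbl : thinDarts n a β = []
    · obtain rfl : A = ∅ := (hbl ▸ hσ).eq_empty hu
      exact ⟨[], _, h.eq_highest hbl h1, drawsLower_nil⟩
    -- now the labels are `3, …, 3`, then `1` or `2`, then `0, …, 0`, and a corner lies at two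
    -- neighbouring posts
    obtain ⟨P, b₁, b₂, Q, hPQ, hcor⟩ := hσ.exists_isCorner hu hbl
    obtain ⟨i, hi, hi', t1, t2, rfl, rfl⟩ := exists_adjacent_of_thinDarts_eq h.mem_Icc h1 h2 hPQ
    have o1 := h.out i (by omega) t1
    have o2 := h.out (i + 1) (by omega) t2
    have hb₁ : β i ∈ A := hσ.mem_of_mem _ (by rw [hPQ]; simp)
    have hb₂ : β (i + 1) ∈ A := hσ.mem_of_mem _ (by rw [hPQ]; simp)
    have hout : ∀ d ∈ A, d ∉ thinDarts n a β → u.out (u.rot d) = u.out d := fun d hd hd' =>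
      u.out_rot d (hσ.notMem_range d hd hd')
    rcases hcor with hc | ⟨c1, c2, c3⟩ | ⟨c1, c2, c3, c4, c, c5, c6, c7, c8⟩
    -- an arc: the labels are `1, 2` or `2, 1`, and `3, 0` below
    · have ho : u.out (β (i + 1)) = !u.out (β i) := by rw [← hc, u.out_opp]
      obtain ⟨j, hj⟩ := Int.eq_ofNat_of_zero_le (h.mem_Icc (i + 1)).1
      have h3 : a i + j = 3 := by
        rw [ho] at o2
        cases hbi : u.out (β i) <;> simp only [hbi, Bool.not_true, Bool.not_false, true_iff,
          Bool.true_eq_false, false_iff] at o1 o2 <;> omega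
      refine step (A₀ := A \ {β i, β (i + 1)}) (β₀ := β) hi hi' (j := j) (by omega)
        (h.lowerLabels hi hi' (by omega) (by omega) (fun _ _ _ => rfl) (by omega) (by omega) ?_)
        fun w e₀ hw D hf => ?_
      · intro P Q hPQ
        rw [if_pos t1, if_pos t2] at hPQ
        rw [if_neg (by omega), if_neg (by omega)]
        rw [hPQ] at hσ
        simpa using hσ.exists_of_arc hc
      · exact D.append_arc (by omega) hi hi' hf (fun _ _ _ => rfl)
          (by rw [hw, lowerLabels_left, h3]) (by omega)
          (by rw [hw, lowerLabels_right, hj, sub_self]) hc rfl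
    · have hx := hσ.opp_mem _ hb₁
      have hox : u.out (u.rot (u.opp (β i))) = !u.out (β i) := by rw [hout _ hx c1, u.out_opp]
      -- a fork: the labels are `1, 1` and `2, 0` below, or `2, 2` and `3, 1` below
      have hxy : u.out (β (i + 1)) = u.out (β i) := by
        have := hout _ (hσ.opp_mem _ hb₂) c2
        rw [c3, u.out_opp, u.out_opp] at this
        simpa using this.symm
      rcases t1 with t1 | t1
      · have o1' := o1.2 t1
        have t2' : a (i + 1) = 1 := o2.1 (hxy.trans o1')
        refine step (A₀ := A \ {β i, β (i + 1), u.opp (β i), u.opp (β (i + 1))})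
          (β₀ := Function.update (Function.update β i (u.rot (u.opp (β i)))) (i + 1) (β i))
          hi hi' (j := 1) le_rfl (h.lowerLabels hi hi' (by push_cast; omega) (by push_cast; omega)
            (hfar _ _ _) ?_ ?_ ?_) fun w e₀ hw D hf => ?_
        · rw [hleft, hox, o1', t1]; simp
        · rw [t2']; simp
        · intro P Q hPQ
          rw [hleft, hright, t1, t2']
          rw [t1, t2'] at hPQ
          rw [hPQ] at hσ c1 c2
          simp only [true_or, if_true, List.cons_append, List.nil_append] at hσ c1 c2
          simpa using hσ.exists_of_fork c1 c2 c3
        · exact D.append_fork_left le_rfl hi hi' hf (hfar _ _ _)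
            (by rw [hw, lowerLabels_left, t1]; norm_num) rfl
            (by rw [hw, lowerLabels_right, t2']; norm_num) c1 c2 c3 (hleft _ _ _) rfl
      · have o1' : u.out (β i) = true := by
          cases ho : u.out (β i)
          · have := o1.1 ho; omega
          · rfl
        have t2' : a (i + 1) = 2 := by
          refine t2.resolve_left fun h => ?_
          have := o2.2 h
          rw [hxy, o1'] at this
          exact absurd this (by simp)
        refine step (A₀ := A \ {β i, β (i + 1), u.opp (β i), u.opp (β (i + 1))})
          (β₀ := Function.update (Function.update β i (β i)) (i + 1) (u.rot (u.opp (β i))))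
          hi hi' (j := 1) le_rfl (h.lowerLabels hi hi' (by push_cast; omega) (by push_cast; omega)
            (hfar _ _ _) ?_ ?_ ?_) fun w e₀ hw D hf => ?_
        · rw [t1]; simp
        · rw [hright, hox, o1', t2']; simp
        · intro P Q hPQ
          rw [hleft, hright, t1, t2']
          rw [t1, t2'] at hPQ
          rw [hPQ] at hσ c1 c2
          simp only [or_true, if_true, List.cons_append, List.nil_append] at hσ c1 c2
          simpa using hσ.exists_of_fork c1 c2 c3
        · exact D.append_fork_right le_rfl hi hi' hf (hfar _ _ _)
            (by rw [hw, lowerLabels_left, t1]; norm_num) rfl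
            (by rw [hw, lowerLabels_right, t2']; norm_num) c1 c2 c3 (hright _ _ _) rfl
    -- an `H`: the labels are `1, 2`, and `2, 1` below
    · have t1' : a i = 1 := o1.1 c3
      have t2' : a (i + 1) = 2 := by
        refine t2.resolve_left fun h => ?_
        have := o2.2 h
        rw [c4] at this
        exact absurd this (by simp)
      have hx := hσ.opp_mem _ hb₁
      have hox : u.out (u.rot (u.opp (β i))) = true := by
        rw [hout _ hx c1, u.out_opp, c3]; rfl
      have hoc : u.out (u.rot (u.opp c)) = false := by
        rw [← c8, hout _ (hσ.rot_mem _ (hσ.opp_mem _ hb₂) c2) (hσ.rot_notMem _ (hσ.opp_mem _ hb₂) c2),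
          hout _ (hσ.opp_mem _ hb₂) c2, u.out_opp, c4]
        rfl
      refine step (A₀ := A \ {β i, β (i + 1), u.opp (β i), u.opp (β (i + 1)), c, u.opp c})
        (β₀ := Function.update (Function.update β i (u.rot (u.opp (β i)))) (i + 1)
          (u.rot (u.opp c))) hi hi' (j := 1) le_rfl
        (h.lowerLabels hi hi' (by push_cast; omega) (by push_cast; omega) (hfar _ _ _) ?_ ?_ ?_)
        fun w e₀ hw D hf => ?_
      · rw [hleft, hox, t1']; simp
      · rw [hright, hoc, t2']; simp
      · intro P Q hPQ
        rw [hleft, hright, t1', t2']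
        rw [t1', t2'] at hPQ
        rw [hPQ] at hσ c1 c2 c5 c6
        simp only [true_or, or_true, if_true, List.cons_append, List.nil_append]
          at hσ c1 c2 c5 c6
        simpa using hσ.exists_of_rung c1 c2 c3 c4 c5 c6 c7 c8
      · exact D.append_rung le_rfl hi hi' hf (hfar _ _ _)
          (by rw [hw, lowerLabels_left, t1']; norm_num) rfl
          (by rw [hw, lowerLabels_right, t2']; norm_num) c1 c2 c5 c6 c7 c8 (hleft _ _ _)
          (hright _ _ _) rfl

end FString

namespace List

theorem formPerm_map_apply {D E : Type*} [DecidableEq D] [DecidableEq E] {e : D → E}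
    (he : Function.Injective e) {l : List D} (hl : l.Nodup) {d : D} (hd : d ∈ l) :
    (l.map e).formPerm (e d) = e (l.formPerm d) := by
  obtain ⟨k, hk, rfl⟩ := List.getElem_of_mem hd
  have h1 := List.formPerm_apply_getElem _ (hl.map he) k (by simpa using hk)
  have h2 := List.formPerm_apply_getElem _ hl k hk
  simp only [List.getElem_map, List.length_map] at h1
  rw [h1, h2]

end List

namespace FString

variable {n ℓ : ℕ}

/-- The labels of the posts along the cut line. -/
def signLabels {n : ℕ} (S : Fin n → WebSign) (p : ℕ) : ℤ :=
  if h : 1 ≤ p ∧ p ≤ n then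
    match S ⟨p - 1, by omega⟩ with
    | .plus => 1
    | .minus => 2
  else 0

theorem signLabels_succ {S : Fin n → WebSign} (p : Fin n) :
    signLabels S (p + 1) = match S p with
    | .plus => 1
    | .minus => 2 := by
  rw [signLabels, dif_pos ⟨by omega, p.2⟩]
  rfl

theorem signLabels_eq (S : Fin n → WebSign) {p : ℕ} (hp : 1 ≤ p ∧ p ≤ n) :
    signLabels S p = 1 ∨ signLabels S p = 2 := by
  rw [signLabels, dif_pos hp]
  split <;> simp

theorem sum_signLabels (S : Fin n → WebSign) :
    ∑ p ∈ Finset.Icc 1 n, signLabels S p = signWeight S := by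
  have h1 : ∑ p ∈ Finset.Icc 1 n, signLabels S p = ∑ p ∈ Finset.range n, signLabels S (p + 1) := by
    rw [Finset.range_eq_Ico, Finset.sum_Ico_add' (fun p => signLabels S p) 0 n 1]
    rfl
  rw [h1, Finset.sum_range, signWeight, Nat.cast_sum]
  refine Finset.sum_congr rfl fun p _ => ?_
  rw [signLabels_succ]
  cases S p <;> rfl

/-- A drawing of all of `u` as a lower part is a drawing of the web. -/
theorem DrawsLower.isDrawing {w : FString} {u : Web n} {β : ℕ → u.Dart} {e : u.Dart → LDart}
    (D : DrawsLower n ℓ w u Set.univ β e) (hβ : ∀ p : Fin n, β (p + 1) = u.bd p)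
    (hw : ∀ p : Fin n, IsThin n ℓ w w.length (p + 1)) : IsDrawing ℓ w u e := by
  classical
  have hinj : Function.Injective e := fun d d' h => D.injOn (Set.mem_univ d) (Set.mem_univ d') h
  have hbd : ∀ p : Fin n, e (u.bd p) = .vert (p + 1) w.length true := fun p => by
    rw [← hβ, (D.bd _ (hw p)).2]
  have hstar : star n ℓ w none = (List.ofFn u.bd).map e := by
    rw [List.map_ofFn, star, List.filter_eq_self.2, List.ofFn_eq_map, ← List.map_coe_finRange_eq_range,
      List.map_map]
    · exact List.map_congr_left fun p _ => (hbd p).symm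
    · simp only [List.mem_map, List.mem_range]
      rintro _ ⟨p, hp, rfl⟩
      exact present_vert.2 ⟨⟨by omega, hp, le_rfl⟩, (hw ⟨p, hp⟩).2⟩
  refine ⟨D.valid, hinj, fun x => ?_, hbd, fun d => ?_, fun d => (D.opp d (Set.mem_univ d)).2,
    fun x hx => ?_, fun d => D.out d (Set.mem_univ d)⟩
  · rw [← D.mem_iff]; simp
  · by_cases hb : base w (e d) = none
    · have hp := ((D.mem_iff (e d)).1 ⟨d, Set.mem_univ d, rfl⟩).1
      have hmem := mem_star.2 ⟨hp, hb⟩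
      have hL := u.isLowerPart_univ
      rw [hstar, List.mem_map] at hmem
      obtain ⟨d', hd', hdd⟩ := hmem
      obtain rfl := hinj hdd
      rw [next, hb, hstar, List.formPerm_map_apply hinj hL.nodup hd', hL.eq_formPerm d' hd']
    · exact (D.rot d (Set.mem_univ d) hb).2.symm
  · obtain ⟨d, -, h⟩ := D.exists_strand x hx
    exact ⟨d, x, h, Or.inl rfl⟩

/-- Every non-elliptic web is presented by a string of divided powers. -/
theorem exists_presents {S : Fin n → WebSign} (hS : signWeight S = 3 * ℓ) {u : Web n}
    (hu : u.NonElliptic) (hb : u.HasBoundary S) : ∃ w : FString, w.Presents ℓ u := by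
  classical
  have hvals : ∀ p, signLabels S p = 0 ∨ signLabels S p = 1 ∨ signLabels S p = 2 := by
    intro p
    by_cases hp : 1 ≤ p ∧ p ≤ n
    · exact Or.inr (signLabels_eq S hp)
    · exact Or.inl (dif_neg hp)
  rcases isEmpty_or_nonempty u.Dart with hD | ⟨⟨d₀⟩⟩
  · -- without darts there is no boundary, and the empty string draws the empty web
    obtain rfl : n = 0 := by
      by_contra h
      exact hD.elim (u.bd ⟨0, by omega⟩)
    obtain rfl : ℓ = 0 := by simpa [signWeight] using hS
    have hp : ∀ x, present 0 0 [] x ≠ true := by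
      intro x hx
      match x with
      | .vert p k b => have := (present_vert.1 hx).1; omega
      | .rung k b => have := (present_rung.1 hx).1; simp at this; omega
    refine ⟨[], by simp, fun _ => .rung 0 false, ⟨⟨by simp, fun k p => ?_⟩,
      fun d => hD.elim d, fun x => ?_, fun p => p.elim0, fun d => hD.elim d, fun d => hD.elim d,
      fun x hx => absurd hx (hp x), fun d => hD.elim d⟩⟩
    · rw [label_of_length_le 0 _ (by simp), List.length_nil, label_zero]
      split_ifs <;> simp
    · simp [hp x]
  · set β : ℕ → u.Dart := fun p => if h : 1 ≤ p ∧ p ≤ n then u.bd ⟨p - 1, by omega⟩ else d₀ with hβ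
    have hβs : ∀ p : Fin n, β (p + 1) = u.bd p := by
      intro p
      simp only [hβ]
      rw [dif_pos ⟨by omega, p.2⟩]
      rfl
    have hlist : thinDarts n (signLabels S) β = List.ofFn u.bd := by
      rw [thinDarts, List.filter_eq_self.2]
      · refine List.ext_getElem (by simp) fun k h1 h2 => ?_
        simp only [List.getElem_map, List.getElem_range', List.getElem_ofFn]
        have hk : k < n := by simpa using h2
        rw [← hβs ⟨k, hk⟩]
        congr 1
        simp only
        omega
      · intro p hp
        rw [List.mem_range'_1] at hp
        simpa using signLabels_eq S ⟨hp.1, by omega⟩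
    have h : IsLabelledPart n ℓ (signLabels S) u Set.univ β := by
      refine ⟨fun p => ?_, fun p hp => dif_neg hp, ?_, fun p hp _ => ?_,
        u.rot, hlist ▸ u.isLowerPart_univ⟩
      · have := hvals p; omega
      · rw [sum_signLabels, hS]; push_cast; ring
      · obtain ⟨q, rfl⟩ : ∃ q : Fin n, p = q + 1 := ⟨⟨p - 1, by omega⟩, by simp; omega⟩
        rw [hβs, hb q, signLabels_succ]
        cases S q <;> simp
    obtain ⟨w, e, hw, D⟩ := h.exists_drawsLower hu
      ((∑ p ∈ Finset.Icc 1 n, (p : ℤ) * signLabels S p).toNat + 1) (by push_cast; omega)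
    refine ⟨w, D.pos, e, D.isDrawing hβs fun p => ⟨⟨by omega, p.2⟩, ?_⟩⟩
    rw [hw]
    exact signLabels_eq S ⟨by omega, p.2⟩

end FString

/-! ### Flows on ladder diagrams and colors -/

/-- The colors at an edge with label `a` and state `s`. -/
def colorsOf (a : ℤ) (s : SignType) : Finset (Fin 3) :=
  if a = 1 then stateColumns .plus s
  else if a = 2 then stateColumns .minus s
  else if a = 3 then Finset.univ
  else ∅

/-- The entry of a weight diagram with a given set of colors. -/
def symbolOf (X : Finset (Fin 3)) : WeightSymbol :=
  match decide (0 ∈ X), decide (1 ∈ X), decide (2 ∈ X) with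
  | true, true, true => .cross
  | true, true, false => .starred 1
  | true, false, false => .plain 1
  | true, false, true => .starred 0
  | false, true, false => .plain 0
  | false, true, true => .starred (-1)
  | false, false, true => .plain (-1)
  | false, false, false => .circ

/-- The state of the flow on an edge with a given set of colors. -/
def stateOf (X : Finset (Fin 3)) : SignType := (symbolOf X).state

theorem thickness_symbolOf (X : Finset (Fin 3)) : (symbolOf X).thickness = X.card := by
  revert X; decide

theorem colorsOf_stateOf (X : Finset (Fin 3)) : colorsOf X.card (stateOf X) = X := by
  revert X; decide

theorem card_colorsOf {a : ℤ} (h0 : 0 ≤ a) (h3 : a ≤ 3) (s : SignType) :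
    ((colorsOf a s).card : ℤ) = a := by
  have : a = 0 ∨ a = 1 ∨ a = 2 ∨ a = 3 := by omega
  rcases this with rfl | rfl | rfl | rfl <;> revert s <;> decide

theorem stateOf_colorsOf {a : ℤ} (ha : a = 1 ∨ a = 2) (s : SignType) :
    stateOf (colorsOf a s) = s := by
  rcases ha with rfl | rfl <;> revert s <;> decide

/-- The state of a rung is read off from the states of its left post. -/
theorem sign_state_sub_eq_stateOf {X Y : Finset (Fin 3)} (h : Y ⊆ X) (hc : (X \ Y).card = 1 ∨ (X \ Y).card = 2) :
    SignType.sign (((symbolOf X).state : ℤ) - ((symbolOf Y).state : ℤ)) = stateOf (X \ Y) := by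
  revert X Y; decide

/-- The condition on the values of a flow on the darts around a point of a ladder diagram. -/
def flowAt : List SignType → Bool
  | [x, y] => decide (y = -x)
  | [x, y, z] => decide (x ≠ y) && decide (y ≠ z) && decide (z ≠ x)
  | _ => true

/-- The flow condition at the left end of a rung says that the colors of the edge below are
distributed to the edge above and to the rung. -/
theorem flowAt_left {a a' : ℤ} {j : ℕ} (h0 : 0 ≤ a') (h3 : a ≤ 3) (h : a' = a - j)
    (s s' t : SignType) :
    flowAt ((if a' = 1 ∨ a' = 2 then [-s'] else []) ++ (if a = 1 ∨ a = 2 then [s] else []) ++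
      (if j = 1 ∨ j = 2 then [-t] else [])) = true ↔
      Disjoint (colorsOf a' s') (colorsOf j t) ∧
        colorsOf a s = colorsOf a' s' ∪ colorsOf j t := by
  have hj : j = 0 ∨ j = 1 ∨ j = 2 ∨ j = 3 := by omega
  have ha' : a' = 0 ∨ a' = 1 ∨ a' = 2 ∨ a' = 3 := by omega
  obtain rfl : a = a' + j := by omega
  rcases hj with rfl | rfl | rfl | rfl <;> rcases ha' with rfl | rfl | rfl | rfl <;>
    first
    | (exfalso; revert h3; norm_num; done)
    | (revert s s' t; clear h0 h3 h; decide)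

/-- The flow condition at the right end of a rung says that the colors of the edge above come from
the edge below and from the rung. -/
theorem flowAt_right {a a' : ℤ} {j : ℕ} (h0 : 0 ≤ a) (h3 : a' ≤ 3) (h : a' = a + j)
    (s s' t : SignType) :
    flowAt ((if a' = 1 ∨ a' = 2 then [-s'] else []) ++ (if j = 1 ∨ j = 2 then [t] else []) ++
      (if a = 1 ∨ a = 2 then [s] else [])) = true ↔
      Disjoint (colorsOf a s) (colorsOf j t) ∧
        colorsOf a' s' = colorsOf a s ∪ colorsOf j t := by
  have hj : j = 0 ∨ j = 1 ∨ j = 2 ∨ j = 3 := by omega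
  have ha : a = 0 ∨ a = 1 ∨ a = 2 ∨ a = 3 := by omega
  subst h
  rcases hj with rfl | rfl | rfl | rfl <;> rcases ha with rfl | rfl | rfl | rfl <;>
    first
    | (exfalso; revert h3; norm_num; done)
    | (revert s s' t; clear h0 h3; decide)

theorem flowAt_far {a : ℤ} (s s' : SignType) :
    flowAt ((if a = 1 ∨ a = 2 then [-s'] else []) ++ (if a = 1 ∨ a = 2 then [s] else [])) = true ↔
      colorsOf a s' = colorsOf a s := by
  by_cases ha : a = 1 ∨ a = 2
  · rcases ha with rfl | rfl <;> revert s s' <;> decide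
  · rw [if_neg ha, if_neg ha]
    push Not at ha
    simp [flowAt, colorsOf, ha.1, ha.2]

namespace FString

variable {n ℓ : ℕ} {w : FString} {φ : LDart → SignType}

/-- The flow condition, formulated for the points of the diagram instead of the darts. -/
theorem isFlow_iff : IsFlow n ℓ w φ ↔
    (∀ d, present n ℓ w d = true → φ d.opp = -φ d) ∧
      ∀ p k, k < w.length → flowAt ((star n ℓ w (some (p, k + 1))).map φ) = true := by
  constructor
  · refine fun h => ⟨fun d hd => (h d hd).1, fun p k hk => ?_⟩
    have hmem : ∀ d ∈ star n ℓ w (some (p, k + 1)), present n ℓ w d = true ∧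
        base w d = some (p, k + 1) := fun d hd => mem_star.1 hd
    have hnd := nodup_star (n := n) (ℓ := ℓ) (w := w) (some (p, k + 1))
    match hs : star n ℓ w (some (p, k + 1)) with
    | [] => rfl
    | [x] => rfl
    | [x, y] =>
      obtain ⟨h1, h2⟩ := hmem x (by simp [hs])
      have h3 : Smooth n ℓ w x := Smooth.of_star h2 hs
      have h4 := (h x h1).2.1 h3
      rw [next_of_star_eq_pair (by rw [h2, hs]), Equiv.swap_apply_left] at h4
      simp [flowAt, h4]
    | [x, y, z] =>
      rw [hs] at hnd hmem
      obtain ⟨f1, f2, f3⟩ := formPerm_triple hnd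
      have h5 : ∀ d ∈ [x, y, z], φ ([x, y, z].formPerm d) ≠ φ d := by
        intro d hd
        obtain ⟨h1, h2⟩ := hmem d hd
        have := (h d h1).2.2 (by rw [h2]; simp) (by rw [h2, hs]; rfl)
        rwa [next, h2, hs] at this
      have h6 := h5 x (by simp)
      have h7 := h5 y (by simp)
      have h8 := h5 z (by simp)
      rw [f1] at h6
      rw [f2] at h7
      rw [f3] at h8
      simp [flowAt, h6.symm, h7.symm, h8.symm]
    | _ :: _ :: _ :: _ :: _ => rfl
  · rintro ⟨h, h'⟩ d hd
    refine ⟨h d hd, ?_, ?_⟩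
    · rintro ⟨hb, hl⟩
      obtain ⟨⟨p, k⟩, hpk⟩ := Option.ne_none_iff_exists'.1 hb
      have hmem := mem_star.2 ⟨hd, hpk⟩
      obtain ⟨k, rfl, hk⟩ := exists_succ_of_mem_star hmem
      have h2 := h' p k hk
      rw [hpk] at hl
      obtain ⟨x, y, hxy⟩ := List.length_eq_two.1 hl
      rw [next_of_star_eq_pair (by rw [hpk, hxy])]
      rw [hxy] at hmem h2
      have h3 : φ y = -φ x := by simpa [flowAt] using h2
      rcases List.mem_pair.1 hmem with rfl | rfl
      · rw [Equiv.swap_apply_left, h3]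
      · rw [Equiv.swap_apply_right, h3, neg_neg]
    · intro hb hl
      obtain ⟨⟨p, k⟩, hpk⟩ := Option.ne_none_iff_exists'.1 hb
      have hmem := mem_star.2 ⟨hd, hpk⟩
      obtain ⟨k, rfl, hk⟩ := exists_succ_of_mem_star hmem
      have h2 := h' p k hk
      have hnd := nodup_star (n := n) (ℓ := ℓ) (w := w) (some (p, k + 1))
      rw [hpk] at hl
      obtain ⟨x, y, z, hxy⟩ := List.length_eq_three.1 hl
      rw [next, hpk, hxy]
      rw [hxy] at hmem h2 hnd
      obtain ⟨f1, f2, f3⟩ := formPerm_triple hnd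
      have h3 : (φ x ≠ φ y ∧ φ y ≠ φ z) ∧ φ z ≠ φ x := by simpa [flowAt] using h2
      simp only [List.mem_cons, List.not_mem_nil, or_false] at hmem
      rcases hmem with rfl | rfl | rfl
      · rw [f1]; exact h3.1.1.symm
      · rw [f2]; exact h3.1.2.symm
      · rw [f3]; exact h3.2.symm

/-- Outside of the `n` posts nothing happens. -/
theorem Valid.label_of_lt (h : Valid n ℓ w) {p : ℕ} (hp : ¬ (1 ≤ p ∧ p ≤ n)) (k : ℕ) :
    label ℓ w k p = label ℓ w 0 p := by
  induction k with
  | zero => rfl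
  | succ k ih =>
    rcases Nat.lt_or_ge k w.length with hk | hk
    · have hs := h.1 _ (step_mem (w := w) (k := k + 1) (by omega) (by omega))
      rw [label_succ ℓ w hk, ih]
      rcases hs with hs | hs
      · simp [hs]
      · rw [if_neg (by omega), if_neg (by omega)]
    · rw [label_of_length_le ℓ w (by omega), ← label_of_length_le ℓ w hk, ih]

theorem Valid.isThin_iff (h : Valid n ℓ w) {k p : ℕ} :
    IsThin n ℓ w k p ↔ label ℓ w k p = 1 ∨ label ℓ w k p = 2 := by
  refine ⟨fun hp => hp.2, fun hp => ⟨?_, hp⟩⟩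
  by_contra hn
  rw [h.label_of_lt hn, label_zero] at hp
  split_ifs at hp <;> omega

/-- In every step, a rung carries its colors from its left post to its right post, and all other
colors are kept. -/
def Conserves (w : FString) (C : ℕ → ℕ → Finset (Fin 3)) (M : ℕ → Finset (Fin 3)) : Prop :=
  ∀ k, k < w.length →
    (Disjoint (C (k + 1) (step w (k + 1)).1) (M (k + 1)) ∧
      C k (step w (k + 1)).1 = C (k + 1) (step w (k + 1)).1 ∪ M (k + 1)) ∧
    (Disjoint (C k ((step w (k + 1)).1 + 1)) (M (k + 1)) ∧
      C (k + 1) ((step w (k + 1)).1 + 1) = C k ((step w (k + 1)).1 + 1) ∪ M (k + 1)) ∧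
    ∀ p, p ≠ (step w (k + 1)).1 → p ≠ (step w (k + 1)).1 + 1 → C (k + 1) p = C k p

/-- A flow is a distribution of colors which is conserved at all rungs. -/
theorem isFlow_iff_conserves (h : Valid n ℓ w) : IsFlow n ℓ w φ ↔
    (∀ d, present n ℓ w d = true → φ d.opp = -φ d) ∧
      Conserves w (fun k p => colorsOf (label ℓ w k p) (φ (.vert p k true)))
        fun k => colorsOf (step w k).2 (φ (.rung k true)) := by
  classical
  rw [isFlow_iff]
  refine and_congr_right fun hneg => ?_
  -- the values of the flow around a point, with all signs expressed by the ends on one side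
  have hstar : ∀ p k, k < w.length → (star n ℓ w (some (p, k + 1))).map φ =
      (if label ℓ w (k + 1) p = 1 ∨ label ℓ w (k + 1) p = 2 then [-φ (.vert p (k + 1) true)] else []) ++
      (if p = (step w (k + 1)).1 + 1 ∧ ((step w (k + 1)).2 = 1 ∨ (step w (k + 1)).2 = 2) then
        [φ (.rung (k + 1) true)] else []) ++
      (if label ℓ w k p = 1 ∨ label ℓ w k p = 2 then [φ (.vert p k true)] else []) ++
      (if p = (step w (k + 1)).1 ∧ ((step w (k + 1)).2 = 1 ∨ (step w (k + 1)).2 = 2) then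
        [-φ (.rung (k + 1) true)] else []) := by
    intro p k hk
    rw [star_succ hk]
    simp only [h.isThin_iff, List.map_append]
    congr 1
    · congr 1
      · congr 1
        · split_ifs with h1
          · have h2 := h.isThin_iff.2 h1
            have h3 : present n ℓ w (.vert p (k + 1) true) = true :=
              present_vert.2 ⟨⟨h2.1.1, h2.1.2, hk⟩, h2.2⟩
            exact congrArg (fun x => [x]) (hneg _ h3)
          · rfl
        · split_ifs <;> rfl
      · split_ifs <;> rfl
    · split_ifs with h1
      · have h3 : present n ℓ w (.rung (k + 1) true) = true :=
          present_rung.2 ⟨⟨by omega, hk⟩, h1.2⟩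
        exact congrArg (fun x => [x]) (hneg _ h3)
      · rfl
  constructor
  · intro hf k hk
    refine ⟨?_, ?_, fun p hp hp' => ?_⟩
    · have h1 := hf (step w (k + 1)).1 k hk
      rw [hstar _ k hk] at h1
      simp only [Nat.left_eq_add, one_ne_zero, false_and, if_false, true_and, List.append_nil] at h1
      refine (flowAt_left (h.2 _ _).1 (h.2 _ _).2 ?_ _ _ _).1 h1
      rw [label_succ ℓ w hk, if_pos rfl]
    · have h1 := hf ((step w (k + 1)).1 + 1) k hk
      rw [hstar _ k hk] at h1
      simp only [Nat.add_eq_left, one_ne_zero, false_and, if_false, true_and, List.append_nil] at h1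
      refine (flowAt_right (h.2 _ _).1 (h.2 _ _).2 ?_ _ _ _).1 h1
      rw [label_succ ℓ w hk, if_neg (by omega), if_pos rfl]
    · have h1 := hf p k hk
      have h2 : label ℓ w (k + 1) p = label ℓ w k p := by
        rw [label_succ ℓ w hk, if_neg hp, if_neg hp']
      rw [hstar _ k hk] at h1
      simp only [hp, hp', false_and, if_false, List.append_nil, h2] at h1
      simp only [h2]
      exact (flowAt_far _ _).1 h1
  · intro hC p k hk
    obtain ⟨c1, c2, c3⟩ := hC k hk
    rw [hstar _ k hk]
    rcases eq_or_ne p (step w (k + 1)).1 with rfl | hp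
    · simp only [Nat.left_eq_add, one_ne_zero, false_and, if_false, true_and, List.append_nil]
      refine (flowAt_left (h.2 _ _).1 (h.2 _ _).2 ?_ _ _ _).2 c1
      rw [label_succ ℓ w hk, if_pos rfl]
    · rcases eq_or_ne p ((step w (k + 1)).1 + 1) with rfl | hp'
      · simp only [Nat.add_eq_left, one_ne_zero, false_and, if_false, true_and, List.append_nil]
        refine (flowAt_right (h.2 _ _).1 (h.2 _ _).2 ?_ _ _ _).2 c2
        rw [label_succ ℓ w hk, if_neg (by omega), if_pos rfl]
      · have h2 : label ℓ w (k + 1) p = label ℓ w k p := by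
          rw [label_succ ℓ w hk, if_neg hp, if_neg hp']
        simp only [hp, hp', false_and, if_false, List.append_nil, h2]
        have h3 := c3 p hp hp'
        simp only [h2] at h3
        exact (flowAt_far _ _).2 h3

end FString

/-! ### Partitions as bead configurations -/

/-- A partition with at most `ℓ` rows. -/
structure IsPart (ℓ : ℕ) (m : ℕ → ℕ) : Prop where
  antitone : Antitone m
  eq_zero : ∀ r, ℓ ≤ r → m r = 0

/-- The bead configuration of a partition: row `r` gives a bead at the position `m r + ℓ - r`. -/
def IsBead (ℓ : ℕ) (m : ℕ → ℕ) (p : ℕ) : Prop := ∃ r < ℓ, p + r = m r + ℓ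

/-- The bead at the position `i` moves to the position `i + 1`, that is, a node of residue `i` is
added to the partition. -/
def MovesBead (ℓ : ℕ) (m m' : ℕ → ℕ) (i : ℕ) : Prop :=
  ∃ r < ℓ, i + r = m r + ℓ ∧ (r = 0 ∨ m r < m (r - 1)) ∧ m' = Function.update m r (m r + 1)

variable {ℓ i : ℕ} {m m' : ℕ → ℕ}

theorem IsPart.row_unique (h : IsPart ℓ m) {p r r' : ℕ} (hr : p + r = m r + ℓ)
    (hr' : p + r' = m r' + ℓ) : r = r' := by
  rcases lt_trichotomy r r' with hlt | rfl | hlt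
  · have := h.antitone hlt.le; omega
  · rfl
  · have := h.antitone hlt.le; omega

theorem IsPart.le_of_isBead_imp (h : IsPart ℓ m) (h' : IsPart ℓ m')
    (hb : ∀ p, IsBead ℓ m p → IsBead ℓ m' p) {r : ℕ} (hr : r < ℓ) (ih : ∀ s < r, m s = m' s) :
    m r ≤ m' r := by
  obtain ⟨r', hr', he⟩ := hb (m r + ℓ - r) ⟨r, hr, by omega⟩
  -- the bead of row `r` is also one of `m'`, and the rows above are occupied by the same beads
  have hle : r ≤ r' := by
    by_contra hlt
    have := h.row_unique (p := m r + ℓ - r) (r := r) (r' := r') (by omega)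
      (by rw [ih r' (by omega)]; exact he)
    omega
  have := h'.antitone hle
  omega

/-- A partition is determined by its beads. -/
theorem IsPart.ext (h : IsPart ℓ m) (h' : IsPart ℓ m') (hb : ∀ p, IsBead ℓ m p ↔ IsBead ℓ m' p) :
    m = m' := by
  funext r
  induction r using Nat.strong_induction_on with
  | _ r ih =>
    rcases Nat.lt_or_ge r ℓ with hr | hr
    · exact le_antisymm (h.le_of_isBead_imp h' (fun p => (hb p).1) hr ih)
        (h'.le_of_isBead_imp h (fun p => (hb p).2) hr fun s hs => (ih s hs).symm)
    · rw [h.eq_zero r hr, h'.eq_zero r hr]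

theorem isPart_zero : IsPart ℓ fun _ => 0 := ⟨fun _ _ _ => le_rfl, fun _ _ => rfl⟩

theorem isBead_zero {p : ℕ} : IsBead ℓ (fun _ => 0) p ↔ 1 ≤ p ∧ p ≤ ℓ := by
  constructor
  · rintro ⟨r, hr, h⟩
    dsimp only at h
    omega
  · rintro ⟨h1, h2⟩
    exact ⟨ℓ - p, by omega, by dsimp only; omega⟩

theorem MovesBead.isPart (h : MovesBead ℓ m m' i) (hm : IsPart ℓ m) : IsPart ℓ m' := by
  obtain ⟨r, hr, h1, h2, rfl⟩ := h
  constructor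
  · refine antitone_nat_of_succ_le fun s => ?_
    have h3 := hm.antitone (Nat.le_succ s)
    rcases eq_or_ne s r with rfl | hs
    · rw [Function.update_self, Function.update_of_ne (by omega)]
      exact h3.trans (Nat.le_succ _)
    · rw [Function.update_of_ne hs]
      rcases eq_or_ne (s + 1) r with rfl | hs'
      · rw [Function.update_self]
        rcases h2 with h2 | h2
        · omega
        · simpa using h2
      · rwa [Function.update_of_ne hs']
  · intro s hs
    rw [Function.update_of_ne (by omega), hm.eq_zero s hs]

theorem MovesBead.isBead_left (h : MovesBead ℓ m m' i) : IsBead ℓ m i := by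
  obtain ⟨r, hr, h1, -, -⟩ := h
  exact ⟨r, hr, h1⟩

theorem MovesBead.not_isBead_right (h : MovesBead ℓ m m' i) (hm : IsPart ℓ m) :
    ¬ IsBead ℓ m (i + 1) := by
  obtain ⟨r, hr, h1, h2, -⟩ := h
  rintro ⟨s, hs, h3⟩
  rcases lt_trichotomy s r with hlt | rfl | hlt
  · have h4 := hm.antitone (show s ≤ r - 1 by omega)
    rcases h2 with h2 | h2 <;> omega
  · omega
  · have := hm.antitone hlt.le; omega

/-- Adding a node of residue `i` moves exactly one bead, from `i` to `i + 1`. -/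
theorem MovesBead.isBead_iff (h : MovesBead ℓ m m' i) (hm : IsPart ℓ m) {p : ℕ} :
    IsBead ℓ m' p ↔ (IsBead ℓ m p ∧ p ≠ i) ∨ p = i + 1 := by
  obtain ⟨r, hr, h1, -, rfl⟩ := h
  constructor
  · rintro ⟨s, hs, h3⟩
    rcases eq_or_ne s r with rfl | hsr
    · rw [Function.update_self] at h3
      right; omega
    · rw [Function.update_of_ne hsr] at h3
      refine Or.inl ⟨⟨s, hs, h3⟩, ?_⟩
      rintro rfl
      exact hsr (hm.row_unique h3 h1)
  · rintro (⟨⟨s, hs, h3⟩, hp⟩ | rfl)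
    · have hsr : s ≠ r := by rintro rfl; omega
      exact ⟨s, hs, by rw [Function.update_of_ne hsr]; exact h3⟩
    · exact ⟨r, hr, by rw [Function.update_self]; omega⟩

/-- A bead can move to the right if the next position is free: then row `r` is shorter than the row
above it. -/
theorem exists_movesBead (hm : IsPart ℓ m) (h1 : IsBead ℓ m i) (h2 : ¬ IsBead ℓ m (i + 1)) :
    ∃ m', MovesBead ℓ m m' i := by
  obtain ⟨r, hr, h⟩ := h1
  refine ⟨_, r, hr, h, ?_, rfl⟩
  by_contra hn
  push Not at hn
  have := hm.antitone (Nat.sub_le r 1)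
  exact h2 ⟨r - 1, by omega, by omega⟩

/-- The colors of the beads at the position `p`. -/
noncomputable def beadColors (ℓ : ℕ) (m : Fin 3 → ℕ → ℕ) (p : ℕ) : Finset (Fin 3) :=
  open Classical in Finset.univ.filter fun c => IsBead ℓ (m c) p

theorem mem_beadColors {m : Fin 3 → ℕ → ℕ} {p : ℕ} {c : Fin 3} :
    c ∈ beadColors ℓ m p ↔ IsBead ℓ (m c) p := by
  simp [beadColors]

/-- A sequence of multipartitions, where in the `k`-th step the components in `M k` get a node of
residue `i k`. -/
structure BeadChain (ℓ K : ℕ) (i : ℕ → ℕ) (M : ℕ → Finset (Fin 3)) (μ : ℕ → Fin 3 → ℕ → ℕ) :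
    Prop where
  zero : ∀ c, μ 0 c = fun _ => 0
  of_notMem : ∀ k < K, ∀ c, c ∉ M (k + 1) → μ (k + 1) c = μ k c
  of_mem : ∀ k < K, ∀ c, c ∈ M (k + 1) → MovesBead ℓ (μ k c) (μ (k + 1) c) (i (k + 1))

namespace BeadChain

variable {K : ℕ} {i : ℕ → ℕ} {M : ℕ → Finset (Fin 3)} {μ : ℕ → Fin 3 → ℕ → ℕ}

theorem isPart (h : BeadChain ℓ K i M μ) {k : ℕ} (hk : k ≤ K) (c : Fin 3) : IsPart ℓ (μ k c) := by
  induction k with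
  | zero => rw [h.zero]; exact isPart_zero
  | succ k ih =>
    by_cases hc : c ∈ M (k + 1)
    · exact (h.of_mem k hk c hc).isPart (ih (by omega))
    · rw [h.of_notMem k hk c hc]; exact ih (by omega)

theorem beadColors_zero (h : BeadChain ℓ K i M μ) (p : ℕ) :
    beadColors ℓ (μ 0) p = if 1 ≤ p ∧ p ≤ ℓ then Finset.univ else ∅ := by
  ext c
  rw [mem_beadColors, h.zero, isBead_zero]
  split_ifs with hp <;> simp [hp]

theorem beadColors_left (h : BeadChain ℓ K i M μ) {k : ℕ} (hk : k < K) :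
    Disjoint (beadColors ℓ (μ (k + 1)) (i (k + 1))) (M (k + 1)) ∧
      beadColors ℓ (μ k) (i (k + 1)) = beadColors ℓ (μ (k + 1)) (i (k + 1)) ∪ M (k + 1) := by
  rw [Finset.disjoint_left]
  have key : ∀ c, c ∈ M (k + 1) → ¬ IsBead ℓ (μ (k + 1) c) (i (k + 1)) := by
    intro c hc hb
    rcases ((h.of_mem k hk c hc).isBead_iff (h.isPart hk.le c)).1 hb with h1 | h1
    · exact h1.2 rfl
    · omega
  refine ⟨fun c hc hc' => key c hc' (mem_beadColors.1 hc), ?_⟩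
  ext c
  rw [Finset.mem_union, mem_beadColors, mem_beadColors]
  by_cases hc : c ∈ M (k + 1)
  · simp [hc, (h.of_mem k hk c hc).isBead_left]
  · simp [hc, h.of_notMem k hk c hc]

theorem beadColors_right (h : BeadChain ℓ K i M μ) {k : ℕ} (hk : k < K) :
    Disjoint (beadColors ℓ (μ k) (i (k + 1) + 1)) (M (k + 1)) ∧
      beadColors ℓ (μ (k + 1)) (i (k + 1) + 1) =
        beadColors ℓ (μ k) (i (k + 1) + 1) ∪ M (k + 1) := by
  rw [Finset.disjoint_left]
  refine ⟨fun c hc hc' => (h.of_mem k hk c hc').not_isBead_right (h.isPart hk.le c)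
    (mem_beadColors.1 hc), ?_⟩
  ext c
  rw [Finset.mem_union, mem_beadColors, mem_beadColors]
  by_cases hc : c ∈ M (k + 1)
  · simp [hc, (h.of_mem k hk c hc).isBead_iff (h.isPart hk.le c)]
  · simp [hc, h.of_notMem k hk c hc]

theorem beadColors_far (h : BeadChain ℓ K i M μ) {k : ℕ} (hk : k < K) {p : ℕ}
    (h1 : p ≠ i (k + 1)) (h2 : p ≠ i (k + 1) + 1) :
    beadColors ℓ (μ (k + 1)) p = beadColors ℓ (μ k) p := by
  ext c
  rw [mem_beadColors, mem_beadColors]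
  by_cases hc : c ∈ M (k + 1)
  · simp [(h.of_mem k hk c hc).isBead_iff (h.isPart hk.le c), h1, h2]
  · simp [h.of_notMem k hk c hc]

end BeadChain

/-- Conserved colors are the colors of moving beads. -/
theorem FString.Conserves.exists_beadChain {w : FString} {C : ℕ → ℕ → Finset (Fin 3)}
    {M : ℕ → Finset (Fin 3)} (h : w.Conserves C M)
    (h0 : ∀ p, C 0 p = if 1 ≤ p ∧ p ≤ ℓ then Finset.univ else ∅) :
    ∃ μ, BeadChain ℓ w.length (fun k => (w.step k).1) M μ ∧
      ∀ k, k ≤ w.length → ∀ p, C k p = beadColors ℓ (μ k) p := by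
  classical
  -- the partitions are built up step by step; the choice is unique, and it exists because the colors
  -- are conserved
  set μ : ℕ → Fin 3 → ℕ → ℕ := fun k => Nat.rec (fun _ _ => 0)
    (fun k m c => if hc : ∃ m', c ∈ M (k + 1) ∧ MovesBead ℓ (m c) m' (w.step (k + 1)).1 then
      hc.choose else m c) k with hμ
  have hsucc : ∀ k c, μ (k + 1) c =
      if hc : ∃ m', c ∈ M (k + 1) ∧ MovesBead ℓ (μ k c) m' (w.step (k + 1)).1 then
      hc.choose else μ k c := fun _ _ => rfl
  have step : ∀ k, k < w.length → (∀ c, IsPart ℓ (μ k c)) →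
      (∀ p, C k p = beadColors ℓ (μ k) p) → (∀ c, c ∉ M (k + 1) → μ (k + 1) c = μ k c) ∧
        ∀ c, c ∈ M (k + 1) → MovesBead ℓ (μ k c) (μ (k + 1) c) (w.step (k + 1)).1 := by
    refine fun k hk e1 e2 => ⟨fun c hc => ?_, fun c hc => ?_⟩
    · rw [hsucc, dif_neg (by rintro ⟨_, h, -⟩; exact hc h)]
    · obtain ⟨⟨-, c1⟩, ⟨c2, -⟩, -⟩ := h k hk
      have hex : ∃ m', c ∈ M (k + 1) ∧ MovesBead ℓ (μ k c) m' (w.step (k + 1)).1 := by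
        obtain ⟨m', hm'⟩ := exists_movesBead (e1 c) (i := (w.step (k + 1)).1)
          (by rw [← mem_beadColors, ← e2, c1]; exact Finset.mem_union_right _ hc)
          (by rw [← mem_beadColors, ← e2]; exact fun h => Finset.disjoint_left.1 c2 h hc)
        exact ⟨m', hc, hm'⟩
      rw [hsucc k, dif_pos hex]
      exact hex.choose_spec.2
  have key : ∀ k, k ≤ w.length →
      (∀ c, IsPart ℓ (μ k c)) ∧ ∀ p, C k p = beadColors ℓ (μ k) p := by
    intro k
    induction k with
    | zero =>
      refine fun _ => ⟨fun c => isPart_zero, fun p => ?_⟩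
      ext c
      rw [mem_beadColors, show μ 0 c = fun _ => 0 from rfl, isBead_zero, h0]
      split_ifs with hp <;> simp [hp]
    | succ k ih =>
      intro hk
      obtain ⟨e1, e2⟩ := ih (by omega)
      obtain ⟨e4, e5⟩ := step k hk e1 e2
      refine ⟨fun c => ?_, fun p => ?_⟩
      · by_cases hc : c ∈ M (k + 1)
        · exact (e5 c hc).isPart (e1 c)
        · rw [e4 c hc]; exact e1 c
      · obtain ⟨⟨c0, c1⟩, ⟨c2, c3⟩, c4⟩ := h k hk
        ext c
        rw [mem_beadColors]
        rcases eq_or_ne p (w.step (k + 1)).1 with rfl | hp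
        · by_cases hc : c ∈ M (k + 1)
          · rw [(e5 c hc).isBead_iff (e1 c)]
            simp only [ne_eq, not_true_eq_false, and_false, Nat.left_eq_add, one_ne_zero, or_self,
              iff_false]
            exact fun h => Finset.disjoint_left.1 c0 h hc
          · rw [e4 c hc, ← mem_beadColors, ← e2, c1]
            simp [hc]
        · rcases eq_or_ne p ((w.step (k + 1)).1 + 1) with rfl | hp'
          · rw [c3, e2]
            by_cases hc : c ∈ M (k + 1)
            · simp [hc, (e5 c hc).isBead_iff (e1 c)]
            · rw [e4 c hc, ← mem_beadColors]
              simp [hc]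
          · rw [c4 p hp hp', e2, mem_beadColors]
            by_cases hc : c ∈ M (k + 1)
            · simp [(e5 c hc).isBead_iff (e1 c), hp, hp']
            · rw [e4 c hc]
  have key' := fun k hk => step k hk (key k hk.le).1 (key k hk.le).2
  exact ⟨μ, ⟨fun c => rfl, fun k hk => (key' k hk).1, fun k hk => (key' k hk).2⟩,
    fun k hk => (key k hk).2⟩

/-! ### Standard fillings and chains of multipartitions -/

/-- The entries of `T` are at most `K`, and those up to `k` fill the multipartition `μ k`. -/
structure Records (K : ℕ) (μ : ℕ → Fin 3 → ℕ → ℕ) (T : MultiFilling) : Prop where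
  lt_iff : ∀ k, k ≤ K → ∀ c r s, s < μ k c r ↔ T c r s ≠ 0 ∧ T c r s ≤ k
  le : ∀ c r s, T c r s ≤ K

/-- The filling that records in which step a node is added. -/
noncomputable def chainFilling (K : ℕ) (μ : ℕ → Fin 3 → ℕ → ℕ) : MultiFilling :=
  fun c r s => sInf {k | k ≤ K ∧ s < μ k c r}

variable {ℓ K : ℕ} {i : ℕ → ℕ} {M : ℕ → Finset (Fin 3)} {μ : ℕ → Fin 3 → ℕ → ℕ}
  {T T' : MultiFilling} {lam : Fin 3 → ℕ → ℕ}

theorem Records.ext (h : Records K μ T) (h' : Records K μ T') : T = T' := by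
  funext c r s
  have key : ∀ k, k ≤ K → (T c r s ≠ 0 ∧ T c r s ≤ k ↔ T' c r s ≠ 0 ∧ T' c r s ≤ k) :=
    fun k hk => by rw [← h.lt_iff k hk, ← h'.lt_iff k hk]
  have h1 := key _ (h.le c r s)
  have h2 := key _ (h'.le c r s)
  omega

theorem BeadChain.monotone (h : BeadChain ℓ K i M μ) {k k' : ℕ} (hk : k ≤ k') (hk' : k' ≤ K)
    (c : Fin 3) (r : ℕ) : μ k c r ≤ μ k' c r := by
  induction k', hk using Nat.le_induction with
  | base => exact le_rfl
  | succ k' hk ih =>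
    refine (ih (by omega)).trans ?_
    by_cases hc : c ∈ M (k' + 1)
    · obtain ⟨r', -, -, -, h4⟩ := h.of_mem k' hk' c hc
      rw [h4, Function.update_apply]
      split_ifs with hr
      · subst hr; omega
      · exact le_rfl
    · rw [h.of_notMem k' hk' c hc]

/-- A chain of multipartitions is recorded by a filling. -/
theorem BeadChain.records (h : BeadChain ℓ K i M μ) : Records K μ (chainFilling K μ) := by
  have hle : ∀ c r s, chainFilling K μ c r s ≤ K := by
    intro c r s
    rcases Set.eq_empty_or_nonempty {k | k ≤ K ∧ s < μ k c r} with he | he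
    · rw [chainFilling, he, Nat.sInf_empty]; omega
    · exact (Nat.sInf_mem he).1
  refine ⟨fun k hk c r s => ⟨fun hs => ?_, ?_⟩, hle⟩
  · have he : {k | k ≤ K ∧ s < μ k c r}.Nonempty := ⟨k, hk, hs⟩
    refine ⟨fun h0 => ?_, Nat.sInf_le ⟨hk, hs⟩⟩
    have h1 := (Nat.sInf_mem he).2
    rw [show sInf {k | k ≤ K ∧ s < μ k c r} = 0 from h0, h.zero] at h1
    exact absurd h1 (Nat.not_lt_zero s)
  · rintro ⟨h0, h1⟩
    have he : {k | k ≤ K ∧ s < μ k c r}.Nonempty := by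
      by_contra hn
      rw [Set.not_nonempty_iff_eq_empty] at hn
      exact h0 (by rw [chainFilling, hn, Nat.sInf_empty])
    exact (Nat.sInf_mem he).2.trans_le (h.monotone h1 hk c r)

/-- The nodes with the entry `k + 1` are those that are added in the step `k + 1`. -/
theorem Records.eq_succ_iff (h : Records K μ T) (hc : BeadChain ℓ K i M μ) {k : ℕ} (hk : k < K)
    {c : Fin 3} {r s : ℕ} : T c r s = k + 1 ↔
      c ∈ M (k + 1) ∧ i (k + 1) + r = μ k c r + ℓ ∧ r < ℓ ∧ s = μ k c r := by
  have h1 := h.lt_iff k hk.le c r s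
  have h2 := h.lt_iff (k + 1) hk c r s
  have key : T c r s = k + 1 ↔ s < μ (k + 1) c r ∧ ¬ s < μ k c r := by
    rw [h1, h2]; omega
  rw [key]
  by_cases hM : c ∈ M (k + 1)
  · obtain ⟨r', h3, h4, h5, h6⟩ := hc.of_mem k hk c hM
    rw [h6, Function.update_apply]
    by_cases hr : r = r'
    · subst hr
      rw [if_pos rfl]
      constructor
      · rintro ⟨h7, h8⟩; exact ⟨hM, h4, h3, by omega⟩
      · rintro ⟨-, -, -, h7⟩; omega
    · rw [if_neg hr]
      constructor
      · rintro ⟨h7, h8⟩; exact absurd h7 h8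
      · rintro ⟨-, h7, -, -⟩
        exact absurd ((hc.isPart hk.le c).row_unique h7 h4) hr
  · rw [hc.of_notMem k hk c hM]
    constructor
    · rintro ⟨h7, h8⟩; exact absurd h7 h8
    · rintro ⟨h7, -⟩; exact absurd h7 hM

theorem Records.exists_succ (h : Records K μ T) {c : Fin 3} {r s : ℕ} (hs : s < μ K c r) :
    ∃ k, k < K ∧ T c r s = k + 1 := by
  have h1 := (h.lt_iff K le_rfl c r s).1 hs
  exact ⟨T c r s - 1, by omega, by omega⟩

/-- A filling that records a chain of multipartitions is standard. -/
theorem Records.isStandard (h : Records K μ T) (hc : BeadChain ℓ K i M μ)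
    (hshift : residueShift (μ K) = ℓ) : IsStandard (μ K) T := by
  refine ⟨fun c r s => ?_, ?_, ?_, ?_, ?_⟩
  · rw [h.lt_iff K le_rfl]
    exact ⟨fun h0 => ⟨h0, h.le c r s⟩, fun h0 => h0.1⟩
  · intro c r s s' hss hs
    obtain ⟨k, hk, hT⟩ := h.exists_succ hs
    have h1 := ((h.eq_succ_iff hc hk).1 hT).2.2.2
    have := ((h.lt_iff k hk.le c r s).1 (by omega)).2
    omega
  · intro c r r' s hrr hs
    obtain ⟨k, hk, hT⟩ := h.exists_succ hs
    have h1 := (h.eq_succ_iff hc hk).1 hT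
    have h2 : s < μ (k + 1) c r :=
      ((h.lt_iff (k + 1) hk c r' s).2 ⟨by omega, hT.le⟩).trans_le
        ((hc.isPart hk c).antitone hrr.le)
    have h3 := (h.lt_iff (k + 1) hk c r s).1 h2
    have h4 : T c r s ≠ k + 1 := by
      intro h4
      have h5 := (h.eq_succ_iff hc hk).1 h4
      have := (hc.isPart hk.le c).row_unique h1.2.1 h5.2.1
      omega
    omega
  · intro c r s r' s' hs hs' hT
    obtain ⟨k, hk, hT'⟩ := h.exists_succ hs
    have h1 := (h.eq_succ_iff hc hk).1 hT'
    have h2 := (h.eq_succ_iff hc hk).1 (hT ▸ hT')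
    obtain rfl := (hc.isPart hk.le c).row_unique h1.2.1 h2.2.1
    exact ⟨rfl, h1.2.2.2.trans h2.2.2.2.symm⟩
  · intro c r s c' r' s' hs hs' hT
    obtain ⟨k, hk, hT'⟩ := h.exists_succ hs
    have h1 := (h.eq_succ_iff hc hk).1 hT'
    have h2 := (h.eq_succ_iff hc hk).1 (hT ▸ hT')
    rw [residue, residue, hshift]
    omega

/-- The reading of the chain fills the shape step by step. -/
theorem Records.fills (h : Records K μ T) {L : LadderWeb}
    (hc : BeadChain ℓ L.word.length (fun k => (L.word.step k).1) M μ) (hK : K = L.word.length)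
    (hM : ∀ k, k < L.word.length → L.moved ℓ (k + 1) = M (k + 1))
    (hshift : residueShift (μ K) = ℓ) : L.Fills ℓ (μ K) T := by
  subst hK
  set K := L.word.length
  have hseq : ∀ k, k ≤ K → ∀ c r s, (if T c r s ≤ k then T c r s else 0) ≠ 0 ↔ s < μ k c r := by
    intro k hk c r s
    rw [h.lt_iff k hk]
    split_ifs <;> omega
  -- after `k` steps the entries up to `k` are in place
  refine ⟨fun k c r s => if T c r s ≤ k then T c r s else 0, ?_, ?_, ?_⟩
  · funext c r s
    dsimp only
    split_ifs <;> omega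
  · intro k hk1 hkK
    obtain ⟨k, rfl⟩ : ∃ k', k = k' + 1 := ⟨k - 1, by omega⟩
    rw [Nat.add_sub_cancel, hM k hkK]
    intro c
    refine ⟨fun hcM => ?_, fun hcM => ?_⟩
    · funext r s
      have h1 : T c r s ≠ k + 1 := fun h1 => hcM ((h.eq_succ_iff hc hkK).1 h1).1
      dsimp only
      split_ifs <;> omega
    · obtain ⟨r, h1, h2, h3, h4⟩ := hc.of_mem k hkK c hcM
      have hT : T c r (μ k c r) = k + 1 := (h.eq_succ_iff hc hkK).2 ⟨hcM, h2, h1, rfl⟩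
      refine ⟨r, μ k c r, ⟨?_, ?_, ?_, ?_, ?_⟩, ?_, ?_⟩
      · refine (Nat.lt_of_lt_of_le ?_ (hc.monotone hkK le_rfl c r))
        rw [h4, Function.update_self]; omega
      · dsimp only
        rw [hT, if_neg (by omega)]
      · exact h3.imp id fun h3 => (hseq k (by omega) c (r - 1) _).2 h3
      · rcases Nat.eq_zero_or_pos (μ k c r) with h5 | h5
        · exact Or.inl h5
        · exact Or.inr ((hseq k (by omega) c r _).2 (by omega))
      · rw [residue, hshift]; omega
      · -- a free node of residue `i` is the place where the bead at the position `i` moves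
        rintro r' s' ⟨f1, f2, -, f4, f5⟩
        have hr' : r' < ℓ := by
          by_contra hn
          rw [(hc.isPart le_rfl c).eq_zero r' (by omega)] at f1
          omega
        have hs' : s' = μ k c r' := by
          have h5 : ¬ s' < μ k c r' := fun h5 => (hseq k (by omega) c r' s').2 h5 f2
          rcases f4 with f4 | f4
          · omega
          · have := (hseq k (by omega) c r' (s' - 1)).1 f4
            omega
        rw [residue, hshift] at f5
        exact ((hc.isPart (k := k) (by omega) c).row_unique h2 (r' := r') (by omega)).le
      · funext r' s'
        dsimp only
        by_cases h5 : T c r' s' = k + 1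
        · have h6 := (h.eq_succ_iff hc hkK).1 h5
          obtain rfl := (hc.isPart (k := k) (by omega) c).row_unique h2 h6.2.1
          rw [if_pos h5.le, h5, if_pos ⟨rfl, h6.2.2.2⟩]
        · have h6 : ¬ (r' = r ∧ s' = μ k c r) := by
            rintro ⟨rfl, rfl⟩
            exact h5 hT
          rw [if_neg h6]
          split_ifs <;> omega
  · funext c r s
    exact if_pos (h.le c r s)

/-- A finite initial segment of the natural numbers is determined by its cardinality. -/
theorem Set.Finite.lt_ncard_iff_mem {A : Set ℕ} (hA : A.Finite)
    (h : ∀ s ∈ A, ∀ s' < s, s' ∈ A) (s : ℕ) : s < A.ncard ↔ s ∈ A := by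
  have hex : ∃ m, m ∉ A := hA.exists_notMem
  classical
  have key : A = Set.Iio (Nat.find hex) := by
    ext t
    rw [Set.mem_Iio, Nat.lt_find_iff]
    constructor
    · intro ht m hm hmA
      rcases hm.eq_or_lt with rfl | hm
      · exact hmA ht
      · exact hmA (h t ht m hm)
    · intro ht
      by_contra hn
      exact ht t le_rfl hn
  rw [key, Set.mem_Iio, ← Finset.coe_Iio, Set.ncard_coe_finset]
  simp

/-- The number of entries up to `k` in a row. -/
noncomputable def rowCount (T : MultiFilling) (k : ℕ) (c : Fin 3) (r : ℕ) : ℕ :=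
  {s : ℕ | T c r s ≠ 0 ∧ T c r s ≤ k}.ncard

theorem IsStandard.lt_rowCount_iff (h : IsStandard lam T) (k : ℕ) (c : Fin 3) (r s : ℕ) :
    s < rowCount T k c r ↔ T c r s ≠ 0 ∧ T c r s ≤ k := by
  refine Set.Finite.lt_ncard_iff_mem (A := {s : ℕ | T c r s ≠ 0 ∧ T c r s ≤ k}) ?_ ?_ s
  · exact (Set.finite_Iio (lam c r)).subset fun s hs => (h.support c r s).1 hs.1
  · rintro s ⟨h1, h2⟩ s' hs'
    rw [Ne, ← Ne, h.support] at h1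
    have := h.row c r s' s hs' h1
    exact ⟨(h.support c r s').2 (by omega), by omega⟩

/-- The entries of a standard filling are bounded. -/
theorem IsStandard.le_maxEntry (h : IsStandard lam T) (hlam : ∀ c, IsPart ℓ (lam c)) (c : Fin 3)
    (r s : ℕ) : T c r s ≤ maxEntry T := by
  refine le_csSup ?_ ⟨c, r, s, rfl⟩
  have hfin : ((Set.univ : Set (Fin 3)) ×ˢ (Set.Iio ℓ ×ˢ
      Set.Iio (Finset.univ.sup fun c => lam c 0))).Finite :=
    Set.finite_univ.prod ((Set.finite_Iio _).prod (Set.finite_Iio _))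
  refine ((hfin.image fun x => T x.1 x.2.1 x.2.2).insert 0).bddAbove.mono ?_
  rintro _ ⟨c, r, s, rfl⟩
  by_cases h0 : T c r s = 0
  · exact Or.inl h0
  · rw [← Ne, h.support] at h0
    refine Or.inr ⟨(c, r, s), ⟨trivial, ?_, ?_⟩, rfl⟩
    · by_contra hr
      rw [(hlam c).eq_zero r (by simpa using hr)] at h0
      omega
    · exact h0.trans_le (((hlam c).antitone (Nat.zero_le r)).trans
        (Finset.le_sup (f := fun c => lam c 0) (Finset.mem_univ c)))

theorem IsStandard.records (h : IsStandard lam T) (hlam : ∀ c, IsPart ℓ (lam c)) :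
    Records (maxEntry T) (rowCount T) T :=
  ⟨fun k _ c r s => h.lt_rowCount_iff k c r s, h.le_maxEntry hlam⟩

theorem IsStandard.rowCount_maxEntry (h : IsStandard lam T) (hlam : ∀ c, IsPart ℓ (lam c))
    (c : Fin 3) (r : ℕ) : rowCount T (maxEntry T) c r = lam c r := by
  refine eq_of_forall_lt_iff fun s => ?_
  rw [h.lt_rowCount_iff, ← h.support]
  exact ⟨fun h1 => h1.1, fun h1 => ⟨h1, h.le_maxEntry hlam c r s⟩⟩

/-- The entries of a standard filling, read in increasing order, build up its shape. -/
theorem IsStandard.exists_beadChain (h : IsStandard lam T) (hlam : ∀ c, IsPart ℓ (lam c))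
    (hshift : residueShift lam = ℓ) :
    ∃ i M, BeadChain ℓ (maxEntry T) i M (rowCount T) ∧
      ∀ k, M (k + 1) = ∅ → i (k + 1) = 0 := by
  classical
  -- all nodes with the entry `k + 1` have the same residue; if there are none, then the residue is set
  -- to `0`, which is the value of `towerPost` for an empty step
  have hi : ∀ k, ∃ i : ℕ, (∀ c r s, T c r s = k + 1 → i + r = s + ℓ) ∧
      ((∀ c r s, T c r s ≠ k + 1) → i = 0) := by
    intro k
    by_cases hex : ∃ c r s, T c r s = k + 1
    · obtain ⟨c, r, s, hT⟩ := hex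
      have hs := (h.support c r s).1 (by omega)
      have hr : r < ℓ := by
        by_contra hr
        rw [(hlam c).eq_zero r (by omega)] at hs
        omega
      refine ⟨s + ℓ - r, fun c' r' s' hT' => ?_, fun hn => absurd hT (hn c r s)⟩
      have hs' := (h.support c' r' s').1 (by omega)
      have := h.residue_eq c r s c' r' s' hs hs' (by omega)
      rw [residue, residue, hshift] at this
      omega
    · push Not at hex
      exact ⟨0, fun c r s hT => absurd hT (hex c r s), fun _ => rfl⟩
  choose i hi hi0 using hi
  refine ⟨fun k => i (k - 1), fun k => Finset.univ.filter fun c => 1 ≤ k ∧ ∃ r s, T c r s = k,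
    ⟨fun c => ?_, fun k hk c hc => ?_, fun k hk c hc => ?_⟩, fun k hk => ?_⟩
  · funext r
    refine Nat.eq_zero_of_not_pos fun h0 => ?_
    have := (h.lt_rowCount_iff 0 c r 0).1 h0
    omega
  · funext r
    refine eq_of_forall_lt_iff fun s => ?_
    rw [h.lt_rowCount_iff, h.lt_rowCount_iff]
    have : T c r s ≠ k + 1 := fun hT => hc (Finset.mem_filter.2 ⟨Finset.mem_univ c, by omega, r, s, hT⟩)
    omega
  · obtain ⟨-, r, s, hT⟩ := (Finset.mem_filter.1 hc).2
    have hs := (h.support c r s).1 (by omega)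
    have hr : r < ℓ := by
      by_contra hr
      rw [(hlam c).eq_zero r (by omega)] at hs
      omega
    -- in the component `c`, the entry `k + 1` occurs exactly once, at the end of row `r`
    have hmem : ∀ s' r', s' < rowCount T (k + 1) c r' ↔
        s' < rowCount T k c r' ∨ (r' = r ∧ s' = s) := by
      intro s' r'
      rw [h.lt_rowCount_iff, h.lt_rowCount_iff]
      have h1 : T c r' s' = k + 1 ↔ r' = r ∧ s' = s := by
        constructor
        · intro hT'
          exact h.component c r' s' r s ((h.support c r' s').1 (by omega)) hs (by omega)
        · rintro ⟨rfl, rfl⟩; exact hT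
      rw [← h1]
      omega
    have hk1 : ¬ s < rowCount T k c r := by
      rw [h.lt_rowCount_iff]; omega
    have hk2 : rowCount T k c r = s := by
      have h1 := (hmem s r).2 (Or.inr ⟨rfl, rfl⟩)
      have h2 := hmem (rowCount T k c r) r
      omega
    refine ⟨r, hr, ?_, ?_, ?_⟩
    · rw [hk2]; exact hi k c r s hT
    · rcases Nat.eq_zero_or_pos r with h0 | h0
      · exact Or.inl h0
      · right
        rw [hk2, h.lt_rowCount_iff]
        have h1 := h.col c (r - 1) r s (by omega) hs
        exact ⟨(h.support c (r - 1) s).2 (hs.trans_le ((hlam c).antitone (by omega))), by omega⟩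
    · funext r'
      rw [Function.update_apply]
      split_ifs with hr'
      · subst hr'
        have h1 := (hmem s r').2 (Or.inr ⟨rfl, rfl⟩)
        have h2 := hmem (s + 1) r'
        omega
      · refine eq_of_forall_lt_iff fun s' => ?_
        rw [hmem]
        simp [hr']
  · refine hi0 _ fun c r s hT => ?_
    have : c ∈ (∅ : Finset (Fin 3)) :=
      hk ▸ Finset.mem_filter.2 ⟨Finset.mem_univ c, by omega, r, s, hT⟩
    simp at this

/-! ### The shape of the boundary data -/

section Shape

variable {n ℓ : ℕ} {S : Fin n → WebSign} {J : Fin n → SignType} {c : Fin 3}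

theorem mem_column {p : ℕ} :
    p ∈ column S J c ↔ ∃ q : Fin n, c ∈ stateColumns (S q) (J q) ∧ (q : ℕ) + 1 = p := by
  simp [column]

theorem pairwise_column (S : Fin n → WebSign) (J : Fin n → SignType) (c : Fin 3) :
    (column S J c).Pairwise (· < ·) := by
  have h : column S J c = ((List.finRange n).filter fun p =>
      decide (c ∈ stateColumns (S p) (J p))).map fun p : Fin n => (p : ℕ) + 1 := by
    simp [column, ← List.map_eq_flatMap]
  rw [h, List.pairwise_map]
  refine List.Pairwise.filter _ ?_
  exact (List.pairwise_lt_finRange n).imp fun h => by simpa using h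

theorem add_one_le_getElem_column {k : ℕ} (hk : k < (column S J c).length) :
    k + 1 ≤ (column S J c)[k] := by
  induction k with
  | zero =>
    obtain ⟨q, -, hq⟩ := mem_column.1 (List.getElem_mem hk)
    omega
  | succ k ih =>
    have h1 := ih (by omega)
    have h2 := List.pairwise_iff_getElem.1 (pairwise_column S J c) k (k + 1) (by omega) hk (by omega)
    omega

/-- The entries of a column are the bead positions of the rows of the shape, from bottom to top. -/
theorem shape_add (h : HasTableau ℓ S J) {r : ℕ} (hr : r < ℓ) :
    shape ℓ S J c r + (ℓ - r) =
      (column S J c)[ℓ - 1 - r]'(by rw [h c]; omega) := by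
  have h1 := add_one_le_getElem_column (S := S) (J := J) (c := c) (k := ℓ - 1 - r)
    (by rw [h c]; omega)
  rw [shape, if_pos hr, List.getD_eq_getElem _ _ (by rw [h c]; omega)]
  omega

theorem HasTableau.isPart (h : HasTableau ℓ S J) (c : Fin 3) : IsPart ℓ (shape ℓ S J c) := by
  have hz : ∀ r, ℓ ≤ r → shape ℓ S J c r = 0 := fun r hr => if_neg (by omega)
  refine ⟨antitone_nat_of_succ_le fun r => ?_, hz⟩
  rcases Nat.lt_or_ge (r + 1) ℓ with hr | hr
  · have h1 := shape_add (c := c) h hr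
    have h2 := shape_add (c := c) h (show r < ℓ by omega)
    have h3 := List.pairwise_iff_getElem.1 (pairwise_column S J c) (ℓ - 1 - (r + 1)) (ℓ - 1 - r)
      (by rw [h c]; omega) (by rw [h c]; omega) (by omega)
    omega
  · rw [hz _ hr]; omega

/-- The beads of the shape are the entries of the columns. -/
theorem HasTableau.isBead_iff (h : HasTableau ℓ S J) {p : ℕ} :
    IsBead ℓ (shape ℓ S J c) p ↔ p ∈ column S J c := by
  constructor
  · rintro ⟨r, hr, hp⟩
    have h1 := shape_add (c := c) h hr
    rw [show p = shape ℓ S J c r + (ℓ - r) by omega, h1]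
    exact List.getElem_mem _
  · intro hp
    obtain ⟨k, hk, rfl⟩ := List.getElem_of_mem hp
    have hk' : k < ℓ := by rwa [h c] at hk
    have h1 := shape_add (c := c) h (r := ℓ - 1 - k) (by omega)
    refine ⟨ℓ - 1 - k, by omega, ?_⟩
    have h2 : (column S J c)[ℓ - 1 - (ℓ - 1 - k)]'(by rw [h c]; omega) = (column S J c)[k] := by
      congr 1; omega
    omega

/-- Partitions whose beads are the entries of the columns are the components of the shape. -/
theorem hasTableau_and_eq_shape {m : Fin 3 → ℕ → ℕ} (hm : ∀ c, IsPart ℓ (m c))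
    (hb : ∀ c p, IsBead ℓ (m c) p ↔ p ∈ column S J c) : HasTableau ℓ S J ∧ m = shape ℓ S J := by
  have h : HasTableau ℓ S J := by
    intro c
    have hnd : (column S J c).Nodup := (pairwise_column S J c).imp fun h => h.ne
    rw [← List.toFinset_card_of_nodup hnd]
    have : (column S J c).toFinset = (Finset.range ℓ).image fun r => m c r + ℓ - r := by
      ext p
      rw [List.mem_toFinset, ← hb, Finset.mem_image]
      constructor
      · rintro ⟨r, hr, hp⟩; exact ⟨r, Finset.mem_range.2 hr, by omega⟩
      · rintro ⟨r, hr, hp⟩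
        rw [Finset.mem_range] at hr
        exact ⟨r, hr, by omega⟩
    rw [this, Finset.card_image_of_injOn, Finset.card_range]
    intro r hr r' hr' hrr
    simp only [Finset.coe_range, Set.mem_Iio] at hr hr' hrr
    exact (hm c).row_unique (p := m c r + ℓ - r) (by omega) (by omega)
  exact ⟨h, funext fun c => (hm c).ext (h.isPart c) fun p => by rw [hb, h.isBead_iff]⟩

theorem HasTableau.beadColors_shape (h : HasTableau ℓ S J) (q : Fin n) :
    beadColors ℓ (shape ℓ S J) (q + 1) = stateColumns (S q) (J q) := by
  ext c
  rw [mem_beadColors, h.isBead_iff, mem_column]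
  constructor
  · rintro ⟨q', hq', h'⟩
    obtain rfl : q' = q := Fin.ext (by omega)
    exact hq'
  · exact fun hc => ⟨q, hc, rfl⟩

theorem stateColumns_ne_univ (s : WebSign) (j : SignType) : ∃ c, c ∉ stateColumns s j := by
  cases s <;> revert j <;> decide

/-- The first post of the cut line lacks a color, so that one of the components of the shape has `ℓ`
non-zero parts. -/
theorem HasTableau.residueShift_shape (h : HasTableau ℓ S J) :
    residueShift (shape ℓ S J) = ℓ := by
  refine le_antisymm (Finset.sup_le fun c _ => ?_) ?_
  · have hsub : {r | shape ℓ S J c r ≠ 0} ⊆ (Finset.range ℓ : Set ℕ) := by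
      intro r hr
      by_contra hn
      exact hr ((h.isPart c).eq_zero r (by simpa using hn))
    refine (Set.ncard_le_ncard hsub).trans ?_
    rw [Set.ncard_coe_finset, Finset.card_range]
  · rcases Nat.eq_zero_or_pos ℓ with rfl | hℓ
    · exact Nat.zero_le _
    · have hn : 0 < n := by
        obtain ⟨q, -⟩ := mem_column.1 (List.getElem_mem (l := column S J 0) (n := 0)
          (by rw [h]; exact hℓ))
        exact q.pos
      obtain ⟨c, hc⟩ := stateColumns_ne_univ (S ⟨0, hn⟩) (J ⟨0, hn⟩)
      have h0 : shape ℓ S J c (ℓ - 1) ≠ 0 := by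
        intro h0
        have h1 : IsBead ℓ (shape ℓ S J c) 1 := ⟨ℓ - 1, by omega, by omega⟩
        obtain ⟨q, hq, hq'⟩ := mem_column.1 (h.isBead_iff.1 h1)
        obtain rfl : q = ⟨0, hn⟩ := Fin.ext (by simpa using hq')
        exact hc hq
      have hsub : {r | shape ℓ S J c r ≠ 0} = (Finset.range ℓ : Set ℕ) := by
        ext r
        simp only [Set.mem_ofPred_eq, Finset.coe_range, Set.mem_Iio]
        constructor
        · intro hr
          by_contra hn
          exact hr ((h.isPart c).eq_zero r (by omega))
        · intro hr
          have := (h.isPart c).antitone (show r ≤ ℓ - 1 by omega)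
          omega
      refine le_trans ?_ (Finset.le_sup (f := fun c => {r | shape ℓ S J c r ≠ 0}.ncard)
        (Finset.mem_univ c))
      rw [hsub, Set.ncard_coe_finset, Finset.card_range]

theorem le_of_signWeight_eq (hS : signWeight S = 3 * ℓ) : ℓ ≤ n := by
  have : signWeight S ≤ ∑ _p : Fin n, 2 := Finset.sum_le_sum fun p _ => by cases S p <;> simp
  rw [Finset.sum_const, Finset.card_univ, Fintype.card_fin, smul_eq_mul] at this
  omega

end Shape

/-! ### The extended growth algorithm -/

theorem FString.Conserves.congr {w : FString} {C C' : ℕ → ℕ → Finset (Fin 3)}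
    {M M' : ℕ → Finset (Fin 3)} (h : w.Conserves C M)
    (hC : ∀ k, k ≤ w.length → ∀ p, C' k p = C k p)
    (hM : ∀ k, k < w.length → M' (k + 1) = M (k + 1)) : w.Conserves C' M' := by
  intro k hk
  obtain ⟨h1, h2, h3⟩ := h k hk
  simp only [hC k hk.le, hC (k + 1) hk, hM k hk]
  exact ⟨h1, h2, h3⟩

theorem not_isBead_zero {ℓ : ℕ} {m : ℕ → ℕ} : ¬ IsBead ℓ m 0 := by
  rintro ⟨r, hr, h⟩; omega

theorem beadColors_post_zero {ℓ : ℕ} {m : Fin 3 → ℕ → ℕ} : beadColors ℓ m 0 = ∅ := by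
  ext c
  simp [mem_beadColors, not_isBead_zero]

theorem tower_eq_symbolOf {T : MultiFilling} {k : ℕ} {l : ℤ} {X : Finset (Fin 3)}
    (h : ∀ c, l ∈ Set.range (kTuple T k c) ↔ c ∈ X) : tower T k l = symbolOf X := by
  have e : ∀ c, (open Classical in decide (l ∈ Set.range (kTuple T k c))) = decide (c ∈ X) :=
    fun c => decide_eq_decide.2 (h c)
  rw [tower, symbolOf, e 0, e 1, e 2]

section Growth

variable {n ℓ : ℕ} {T : MultiFilling} {k : ℕ}

/-- The weight diagrams of the tower show the beads: `kTuple` lists the positions of the beads, shifted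
by `ℓ`, and the rows from `ℓ` on only give entries at positions `≤ -ℓ`. -/
theorem tower_post (hm : ∀ c, IsPart ℓ (rowCount T k c)) {p : ℕ} (hp : 1 ≤ p) :
    tower T k ((p : ℤ) - ℓ) = symbolOf (beadColors ℓ (rowCount T k) p) := by
  refine tower_eq_symbolOf fun c => ?_
  rw [mem_beadColors]
  constructor
  · rintro ⟨r, hr⟩
    have hr' : (rowCount T k c r : ℤ) - r = p - ℓ := hr
    have hlt : r < ℓ := by
      by_contra hn
      have := (hm c).eq_zero r (by omega)
      omega
    exact ⟨r, hlt, by omega⟩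
  · rintro ⟨r, hr, h⟩
    refine ⟨r, ?_⟩
    change (rowCount T k c r : ℤ) - r = p - ℓ
    omega

theorem tower_of_le (hm : ∀ c, IsPart ℓ (rowCount T k c)) {l : ℤ} (hl : l ≤ -ℓ) :
    tower T k l = .cross := by
  refine (tower_eq_symbolOf (X := Finset.univ) fun c => ?_).trans rfl
  simp only [Finset.mem_univ, iff_true]
  refine ⟨(-l).toNat, ?_⟩
  change (rowCount T k c (-l).toNat : ℤ) - ((-l).toNat : ℕ) = l
  rw [(hm c).eq_zero _ (by omega)]
  omega

variable {i : ℕ → ℕ} {M : ℕ → Finset (Fin 3)}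
  (hc : BeadChain ℓ (maxEntry T) i M (rowCount T))
  (h0 : ∀ k, k < maxEntry T → M (k + 1) = ∅ → i (k + 1) = 0)

include hc

theorem thickness_tower_post (hk : k ≤ maxEntry T) {p : ℕ} (hp : 1 ≤ p) :
    (tower T k ((p : ℤ) - ℓ)).thickness = (beadColors ℓ (rowCount T k) p).card := by
  rw [tower_post (fun c => hc.isPart hk c) hp, thickness_symbolOf]

theorem BeadChain.pos (hk : k < maxEntry T) (hM : M (k + 1) ≠ ∅) : 1 ≤ i (k + 1) := by
  obtain ⟨c, hcM⟩ := Finset.nonempty_iff_ne_empty.2 hM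
  by_contra hn
  have := (hc.of_mem k hk c hcM).isBead_left
  rw [show i (k + 1) = 0 by omega] at this
  exact not_isBead_zero this

include h0

/-- The post at which the thickness drops is the one that the beads leave. -/
theorem towerPost_tower (hk : k < maxEntry T) : towerPost ℓ (tower T) (k + 1) = i (k + 1) := by
  -- only the left post loses thickness, and none does in an empty step
  have hset : {p : ℕ | (tower T (k + 1) ((p : ℤ) - ℓ)).thickness <
      (tower T k ((p : ℤ) - ℓ)).thickness} = if M (k + 1) = ∅ then ∅ else {i (k + 1)} := by
    ext p
    rw [Set.mem_ofPred_eq]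
    obtain ⟨l1, l2⟩ := hc.beadColors_left hk
    obtain ⟨r1, r2⟩ := hc.beadColors_right hk
    have l3 := congrArg Finset.card l2
    have r3 := congrArg Finset.card r2
    rw [Finset.card_union_of_disjoint l1] at l3
    rw [Finset.card_union_of_disjoint r1] at r3
    rcases Nat.eq_zero_or_pos p with rfl | hp
    · rw [tower_of_le (fun c => hc.isPart hk c) (by simp),
        tower_of_le (fun c => hc.isPart hk.le c) (by simp)]
      split_ifs with hM
      · simp
      · have := hc.pos hk hM
        simp only [lt_self_iff_false, Set.mem_singleton_iff, false_iff]
        omega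
    · rw [thickness_tower_post hc (k := k + 1) hk hp, thickness_tower_post hc hk.le hp]
      split_ifs with hM
      · rw [hM, Finset.card_empty] at l3 r3
        simp only [Set.mem_empty_iff_false, iff_false, not_lt]
        by_cases hi : p = i (k + 1)
        · subst hi; omega
        · by_cases hi' : p = i (k + 1) + 1
          · subst hi'; omega
          · rw [hc.beadColors_far hk hi hi']
      · have hM' := Finset.card_pos.2 (Finset.nonempty_iff_ne_empty.2 hM)
        rw [Set.mem_singleton_iff]
        by_cases hi : p = i (k + 1)
        · subst hi
          simp only [iff_true]
          omega
        · simp only [hi, iff_false, not_lt]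
          by_cases hi' : p = i (k + 1) + 1
          · subst hi'; omega
          · rw [hc.beadColors_far hk hi hi']
  rw [towerPost]
  change sInf {p : ℕ | (tower T (k + 1) ((p : ℤ) - ℓ)).thickness <
      (tower T (k + 1 - 1) ((p : ℤ) - ℓ)).thickness} = _
  rw [Nat.add_sub_cancel, hset]
  split_ifs with hM
  · rw [Nat.sInf_empty, h0 k hk hM]
  · exact csInf_singleton _

theorem thickness_sub_eq_card (hk : k < maxEntry T) :
    (tower T k ((i (k + 1) : ℤ) - ℓ)).thickness -
      (tower T (k + 1) ((i (k + 1) : ℤ) - ℓ)).thickness = (M (k + 1)).card := by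
  by_cases hM : M (k + 1) = ∅
  · rw [h0 k hk hM, hM, tower_of_le (fun c => hc.isPart hk c) (by simp),
        tower_of_le (fun c => hc.isPart hk.le c) (by simp)]
    simp
  · have hp := hc.pos hk hM
    obtain ⟨l1, l2⟩ := hc.beadColors_left hk
    rw [thickness_tower_post hc (k := k + 1) hk hp, thickness_tower_post hc hk.le hp, l2,
      Finset.card_union_of_disjoint l1]
    omega

theorem growth_word : (growth ℓ T).word =
    (List.range (maxEntry T)).map fun k => (i (k + 1), (M (k + 1)).card) := by
  rw [growth, connect]
  refine List.map_congr_left fun k hk => ?_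
  rw [List.mem_range] at hk
  simp only [towerPost_tower hc h0 hk, thickness_sub_eq_card hc h0 hk]

theorem growth_word_length : (growth ℓ T).word.length = maxEntry T := by
  rw [growth_word hc h0, List.length_map, List.length_range]

theorem growth_step (hk : k < maxEntry T) :
    (growth ℓ T).word.step (k + 1) = (i (k + 1), (M (k + 1)).card) := by
  rw [FString.step, growth_word hc h0, Nat.add_sub_cancel, List.getD_eq_getElem _ _ (by simpa)]
  simp

/-- The labels of the posts count the beads. -/
theorem growth_label (hk : k ≤ maxEntry T) (p : ℕ) :
    (growth ℓ T).word.label ℓ k p = (beadColors ℓ (rowCount T k) p).card := by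
  induction k with
  | zero =>
    rw [FString.label_zero, hc.beadColors_zero]
    split_ifs <;> simp
  | succ k ih =>
    have hk' : k < (growth ℓ T).word.length := by rw [growth_word_length hc h0]; exact hk
    obtain ⟨l1, l2⟩ := hc.beadColors_left hk
    obtain ⟨r1, r2⟩ := hc.beadColors_right hk
    have l3 := congrArg Finset.card l2
    have r3 := congrArg Finset.card r2
    rw [Finset.card_union_of_disjoint l1] at l3
    rw [Finset.card_union_of_disjoint r1] at r3
    rw [FString.label_succ ℓ _ hk', growth_step hc h0 hk, ih (by omega)]
    dsimp only
    split_ifs with h1 h2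
    · subst h1; omega
    · subst h2; omega
    · rw [hc.beadColors_far hk h1 h2]

/-- The colors of the growth algorithm are those of the beads. -/
theorem growth_conserves :
    (growth ℓ T).word.Conserves (fun k p => beadColors ℓ (rowCount T k) p) M := by
  intro k hk
  rw [growth_word_length hc h0] at hk
  rw [growth_step hc h0 hk]
  exact ⟨hc.beadColors_left hk, hc.beadColors_right hk, fun _ h1 h2 => hc.beadColors_far hk h1 h2⟩

omit h0 in
theorem growth_flow_vert (hk : k ≤ maxEntry T) {p : ℕ} (hp : 1 ≤ p) :
    (growth ℓ T).flow (.vert p k true) = stateOf (beadColors ℓ (rowCount T k) p) := by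
  change (tower T k ((p : ℤ) - ℓ)).state = _
  rw [tower_post (fun c => hc.isPart hk c) hp, stateOf]

theorem growth_flow_rung (hk : k < maxEntry T)
    (hM : (M (k + 1)).card = 1 ∨ (M (k + 1)).card = 2) :
    (growth ℓ T).flow (.rung (k + 1) true) = stateOf (M (k + 1)) := by
  have hM' : M (k + 1) ≠ ∅ := by
    intro h
    rw [h, Finset.card_empty] at hM
    omega
  obtain ⟨l1, l2⟩ := hc.beadColors_left hk
  have hsd : beadColors ℓ (rowCount T k) (i (k + 1)) \
      beadColors ℓ (rowCount T (k + 1)) (i (k + 1)) = M (k + 1) := by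
    rw [l2, Finset.union_sdiff_cancel_left l1]
  change SignType.sign (((tower T (k + 1 - 1) ((towerPost ℓ (tower T) (k + 1) : ℤ) - ℓ)).state : ℤ) -
    ((tower T (k + 1) ((towerPost ℓ (tower T) (k + 1) : ℤ) - ℓ)).state : ℤ)) = _
  rw [Nat.add_sub_cancel, towerPost_tower hc h0 hk, tower_post (fun c => hc.isPart hk c) (hc.pos hk hM'),
    tower_post (fun c => hc.isPart hk.le c) (hc.pos hk hM'), ← hsd]
  exact sign_state_sub_eq_stateOf (l2 ▸ Finset.subset_union_left) (by rw [hsd]; exact hM)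

theorem growth_colorsOf_vert (hk : k ≤ maxEntry T) (p : ℕ) :
    colorsOf ((growth ℓ T).word.label ℓ k p) ((growth ℓ T).flow (.vert p k true)) =
      beadColors ℓ (rowCount T k) p := by
  rw [growth_label hc h0 hk]
  rcases Nat.eq_zero_or_pos p with rfl | hp
  · rw [beadColors_post_zero]; rfl
  · rw [growth_flow_vert hc hk hp, colorsOf_stateOf]

theorem growth_colorsOf_rung (hk : k < maxEntry T) :
    colorsOf ((growth ℓ T).word.step (k + 1)).2 ((growth ℓ T).flow (.rung (k + 1) true)) =
      M (k + 1) := by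
  rw [growth_step hc h0 hk]
  dsimp only
  by_cases hM : (M (k + 1)).card = 1 ∨ (M (k + 1)).card = 2
  · rw [growth_flow_rung hc h0 hk hM, colorsOf_stateOf]
  · have h3 : (M (k + 1)).card ≤ 3 := by simpa using Finset.card_le_univ (M (k + 1))
    have h4 : (M (k + 1)).card = 0 ∨ (M (k + 1)).card = 3 := by omega
    rcases h4 with h4 | h4
    · rw [h4, Finset.card_eq_zero.1 h4]; rfl
    · have h5 : M (k + 1) = Finset.univ := Finset.eq_univ_of_card _ (by rw [h4]; rfl)
      rw [h4, h5]
      rfl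

theorem growth_isFlow (hv : (growth ℓ T).word.Valid n ℓ) :
    (growth ℓ T).word.IsFlow n ℓ (growth ℓ T).flow := by
  rw [FString.isFlow_iff_conserves hv]
  have hlen := growth_word_length hc h0
  refine ⟨fun d _ => ?_, (growth_conserves hc h0).congr (fun k hk p => ?_) fun k hk => ?_⟩
  · match d with
    | .vert p k true => rfl
    | .vert p k false => exact (neg_neg _).symm
    | .rung k true => rfl
    | .rung k false => exact (neg_neg _).symm
  · exact growth_colorsOf_vert hc h0 (hlen ▸ hk) p
  · exact growth_colorsOf_rung hc h0 (hlen ▸ hk)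

end Growth

section Shape

variable {n ℓ : ℕ} {S : Fin n → WebSign} {J : Fin n → SignType} {T : MultiFilling}

theorem stateOf_stateColumns (s : WebSign) (j : SignType) : stateOf (stateColumns s j) = j := by
  cases s <;> revert j <;> decide

theorem card_stateColumns (s : WebSign) (j : SignType) :
    ((stateColumns s j).card : ℤ) = match s with
    | .plus => 1
    | .minus => 2 := by
  cases s <;> revert j <;> decide

/-- The extended growth algorithm is well-defined. -/
theorem growth_isWebWithFlow (h : HasTableau ℓ S J) (hT : IsStandard (shape ℓ S J) T) :
    (growth ℓ T).IsWebWithFlow ℓ S J ∧ ConnectsTower n ℓ T := by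
  obtain ⟨i, M, hc, h0⟩ := hT.exists_beadChain h.isPart h.residueShift_shape
  replace h0 : ∀ k, k < maxEntry T → M (k + 1) = ∅ → i (k + 1) = 0 := fun k _ => h0 k
  have hlen := growth_word_length hc h0
  have hK : rowCount T (maxEntry T) = shape ℓ S J :=
    funext fun c => funext fun r => hT.rowCount_maxEntry h.isPart c r
  -- beads only move to the right, and at the end they lie at the posts of the cut line
  have hbead : ∀ k, k ≤ maxEntry T → ∀ c p, IsBead ℓ (rowCount T k c) p → p ≤ n := by
    rintro k hk c p ⟨r, hr, hp⟩
    have h1 := hc.monotone hk le_rfl c r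
    have h2 : IsBead ℓ (rowCount T (maxEntry T) c) (rowCount T (maxEntry T) c r + ℓ - r) :=
      ⟨r, hr, by omega⟩
    rw [hK, h.isBead_iff] at h2
    obtain ⟨q, -, hq⟩ := mem_column.1 h2
    have := q.2
    rw [hK] at h1
    omega
  have hv : (growth ℓ T).word.Valid n ℓ := by
    constructor
    · rw [growth_word hc h0]
      simp only [List.mem_map, List.mem_range]
      rintro _ ⟨k, hk, rfl⟩
      by_cases hM : M (k + 1) = ∅
      · left; simp [hM]
      · refine Or.inr ⟨hc.pos hk hM, ?_⟩
        obtain ⟨c, hcM⟩ := Finset.nonempty_iff_ne_empty.2 hM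
        exact hbead (k + 1) hk c _
          (((hc.of_mem k hk c hcM).isBead_iff (hc.isPart hk.le c)).2 (Or.inr rfl))
    · have key : ∀ k, k ≤ maxEntry T → ∀ p, 0 ≤ (growth ℓ T).word.label ℓ k p ∧
          (growth ℓ T).word.label ℓ k p ≤ 3 := by
        intro k hk p
        rw [growth_label hc h0 hk]
        have : (beadColors ℓ (rowCount T k) p).card ≤ 3 := by
          simpa using Finset.card_le_univ (beadColors ℓ (rowCount T k) p)
        omega
      intro k p
      rcases Nat.lt_or_ge k (maxEntry T) with hk | hk
      · exact key k hk.le p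
      · rw [FString.label_of_length_le ℓ _ (hlen ▸ hk), hlen]
        exact key _ le_rfl p
  refine ⟨⟨hv, growth_isFlow hc h0 hv, fun p => ?_, fun p => ?_⟩, hlen, fun k hk => ⟨fun l hl => ?_,
    fun l hl => ?_, fun p hp _ => ?_⟩⟩
  · rw [hlen, growth_label hc h0 le_rfl, hK, h.beadColors_shape, card_stateColumns]
  · rw [hlen, growth_flow_vert hc le_rfl (by omega), hK, h.beadColors_shape, stateOf_stateColumns]
  · exact tower_of_le (fun c => hc.isPart hk c) hl
  -- a row from `ℓ` on would only give an entry at a position `≤ -ℓ`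
  · have hX : tower T k l = symbolOf ∅ := by
      refine tower_eq_symbolOf fun c => ?_
      simp only [Finset.notMem_empty, iff_false]
      rintro ⟨r, hr⟩
      have hr' : (rowCount T k c r : ℤ) - r = l := hr
      rcases Nat.lt_or_ge r ℓ with hrl | hrl
      · have := hbead k hk c (rowCount T k c r + ℓ - r) ⟨r, hrl, by omega⟩
        omega
      · have h1 := (hc.isPart hk c).eq_zero r hrl
        rcases Nat.eq_zero_or_pos ℓ with rfl | hℓ
        · omega
        · omega
    rw [hX]
    rfl
  · rw [growth_label hc h0 hk, thickness_tower_post hc hk hp]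

end Shape

/-! ### Drawings and flows determine each other -/

namespace FString

variable {n ℓ : ℕ} {w : FString} {u : Web n} {e e' : u.Dart → LDart} {φ φ' : LDart → SignType}

namespace IsDrawing

theorem present (D : IsDrawing ℓ w u e) (d : u.Dart) : present n ℓ w (e d) = true :=
  ((D.range _).1 ⟨d, rfl⟩).1

theorem not_smooth (D : IsDrawing ℓ w u e) (d : u.Dart) : ¬ Smooth n ℓ w (e d) :=
  ((D.range _).1 ⟨d, rfl⟩).2.not_smooth

theorem exists_strand (D : IsDrawing ℓ w u e) {x : LDart} (hx : FString.present n ℓ w x = true) :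
    ∃ d, Strand n ℓ w (e d) x := by
  obtain ⟨d, y, h, rfl | rfl⟩ := D.noCircle x hx
  · exact ⟨d, h⟩
  · exact ⟨u.opp d, (h.to_end (D.opp d) (D.not_smooth _)).symm⟩

/-- Every segment belongs to the strand of at most one dart in each direction. -/
theorem strand_unique (D : IsDrawing ℓ w u e) {d d' : u.Dart} {x : LDart}
    (h : Strand n ℓ w (e d) x) (h' : Strand n ℓ w (e d') x) : d = d' :=
  D.injective (h.symm.end_unique h'.symm (D.not_smooth _) (D.not_smooth _))

theorem mem_range_bd (D : IsDrawing ℓ w u e) {d : u.Dart} (hd : d ∈ Set.range u.bd) :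
    base w (e d) = none := by
  obtain ⟨p, rfl⟩ := hd
  rw [D.bd]
  simp [base]

/-- A non-elliptic web can be drawn by a string in at most one way. -/
theorem unique (D : IsDrawing ℓ w u e) (D' : IsDrawing ℓ w u e') (hu : u.NonElliptic) :
    e = e' := by
  funext d
  refine u.induction_on_connected hu (P := fun d => e d = e' d) (fun p => ?_) (fun d hd => ?_)
    (fun d hd => ?_) d
  · rw [D.bd, D'.bd]
  · rw [D.rot, D'.rot, hd]
  · have h := D'.opp d
    rw [← hd] at h
    exact (D.opp d).end_unique h (D.not_smooth _) (D'.not_smooth _)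

/-- A flow on the web gives a flow on its drawing. -/
theorem exists_isFlow (D : IsDrawing ℓ w u e) {f : u.Dart → SignType} (hf : u.IsFlow f) :
    ∃ φ, IsFlow n ℓ w φ ∧ ∀ d, φ (e d) = f d := by
  classical
  -- a segment that is traversed from `d` on carries the flow of `d`
  set φ : LDart → SignType := fun x =>
    if h : ∃ d, Strand n ℓ w (e d) x then -f h.choose else 0 with hφ
  have key : ∀ d x, Strand n ℓ w (e d) x → φ x = -f d := by
    intro d x h
    have hex : ∃ d, Strand n ℓ w (e d) x := ⟨d, h⟩
    simp only [hφ]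
    rw [dif_pos hex, D.strand_unique hex.choose_spec h]
  have hval : ∀ d, φ (e d) = f d := by
    intro d
    have h := D.opp (u.opp d)
    rw [u.opp_opp] at h
    rw [key _ _ h, hf.1, neg_neg]
  have hneg : ∀ x, FString.present n ℓ w x = true → φ x.opp = -φ x := by
    intro x hx
    obtain ⟨d, h⟩ := D.exists_strand hx
    rw [key _ _ h, key _ _ (h.to_end (D.opp d) (D.not_smooth _)).symm, hf.1, neg_neg]
  refine ⟨φ, fun x hx => ⟨hneg x hx, fun hs => ?_, fun hb hl => ?_⟩, hval⟩
  · obtain ⟨d, h⟩ := D.exists_strand hx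
    have h1 := key _ _ (Strand.cont h hs)
    rw [hneg _ (present_next hx)] at h1
    rw [key _ _ h, ← h1, neg_neg]
  · obtain ⟨d, rfl⟩ := (D.range x).2 ⟨hx, Or.inr hl⟩
    rw [← D.rot, hval, hval]
    exact hf.2 d fun hd => hb (D.mem_range_bd hd)

end IsDrawing

theorem IsFlow.strand (hφ : IsFlow n ℓ w φ) {x y : LDart} (h : Strand n ℓ w x y)
    (hx : present n ℓ w x = true) : φ y = -φ x := by
  induction h with
  | edge => exact (hφ x hx).1
  | @cont y h hy ih =>
    have hp := h.present hx
    rw [(hφ _ (present_next hp)).1, (hφ y hp).2.1 hy, neg_neg, ih]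

/-- Flows on a drawing with the same values on the darts of the web agree. -/
theorem IsDrawing.flow_unique (D : IsDrawing ℓ w u e) (hφ : IsFlow n ℓ w φ)
    (hφ' : IsFlow n ℓ w φ') (h : ∀ d, φ (e d) = φ' (e d)) {x : LDart}
    (hx : FString.present n ℓ w x = true) : φ x = φ' x := by
  obtain ⟨d, hd⟩ := D.exists_strand hx
  rw [hφ.strand hd (D.present d), hφ'.strand hd (D.present d), h]

end FString

section Isotopic

variable {n ℓ : ℕ} {S : Fin n → WebSign} {J : Fin n → SignType} {x y : BasisWebWithFlow n S J}
  {L L' : LadderWeb} {w : FString}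

/-- A ladder web that draws `y` also draws every web isotopic to `y`. -/
theorem LadderWeb.Draws.of_isotopic (h : L.Draws ℓ y) (hxy : x.Isotopic y) : L.Draws ℓ x := by
  obtain ⟨hf, e, D, he⟩ := h
  obtain ⟨g, g1, g2, g3, g4, g5⟩ := hxy
  refine ⟨hf, e ∘ g, ⟨D.valid, D.injective.comp g.injective, fun z => ?_, fun p => ?_, fun d => ?_,
    fun d => ?_, fun z hz => ?_, fun d => ?_⟩, fun d => ?_⟩
  · rw [g.surjective.range_comp]; exact D.range z
  · rw [Function.comp_apply, g3, D.bd]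
  · rw [Function.comp_apply, g1, D.rot]; rfl
  · rw [Function.comp_apply, Function.comp_apply, g2]; exact D.opp (g d)
  · obtain ⟨d, t, h1, h2⟩ := D.noCircle z hz
    exact ⟨g.symm d, t, by rwa [Function.comp_apply, g.apply_symm_apply], h2⟩
  · rw [Function.comp_apply, ← D.out, g4]
  · rw [Function.comp_apply, he, g5]

/-- Webs drawn by the same ladder web are isotopic. -/
theorem LadderWeb.Draws.isotopic (h : L.Draws ℓ x) (h' : L.Draws ℓ y) : x.Isotopic y := by
  obtain ⟨-, e, D, he⟩ := h
  obtain ⟨-, e', D', he'⟩ := h'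
  have hr : ∀ d, ∃ d', e' d' = e d := fun d => (D'.range _).2 ((D.range _).1 ⟨d, rfl⟩)
  have hr' : ∀ d, ∃ d', e d' = e' d := fun d => (D.range _).2 ((D'.range _).1 ⟨d, rfl⟩)
  choose g hg using hr
  choose g' hg' using hr'
  refine ⟨⟨g, g', fun d => D.injective (by rw [hg', hg]), fun d => D'.injective (by rw [hg, hg'])⟩,
    fun d => D'.injective ?_, fun d => D'.injective ?_, fun p => D'.injective ?_, fun d => ?_,
    fun d => ?_⟩
  · change e' (g (x.web.rot d)) = e' (y.web.rot (g d))
    rw [hg, D'.rot, hg, D.rot]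
  · change e' (g (x.web.opp d)) = e' (y.web.opp (g d))
    rw [hg]
    have h1 := D'.opp (g d)
    rw [hg] at h1
    exact (D.opp d).end_unique h1 (D.not_smooth _) (D'.not_smooth _)
  · change e' (g (x.web.bd p)) = e' (y.web.bd p)
    rw [hg, D.bd, D'.bd]
  · change y.web.out (g d) = x.web.out d
    rw [D'.out, hg, D.out]
  · change y.flow (g d) = x.flow d
    rw [← he', hg, he]

/-- The flow of the drawing is determined by the flow of the web, since the drawing is unique. -/
theorem LadderWeb.Draws.flow_unique {φ φ' : LDart → SignType}
    (h : (⟨w, φ⟩ : LadderWeb).Draws ℓ x) (h' : (⟨w, φ'⟩ : LadderWeb).Draws ℓ x) {z : LDart}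
    (hz : w.present n ℓ z = true) : φ z = φ' z := by
  obtain ⟨hf, e, D, he⟩ := h
  obtain ⟨hf', e', D', he'⟩ := h'
  obtain rfl := D.unique D' x.nonElliptic
  exact D.flow_unique hf hf' (fun d => (he d).trans (he' d).symm) hz

end Isotopic

/-! ### The tableau of a web with flow -/

section Fills

variable {ℓ : ℕ} {lam : Fin 3 → ℕ → ℕ} {L L' : LadderWeb} {T T' T₀ : MultiFilling}

/-- The next filling is determined by the previous one. -/
theorem AddNodes.unique {M : Finset (Fin 3)} {i : ℤ} {k : ℕ} (h : AddNodes lam M i k T₀ T)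
    (h' : AddNodes lam M i k T₀ T') : T = T' := by
  funext c
  by_cases hc : c ∈ M
  · obtain ⟨r, s, h1, h2, h3⟩ := (h c).2 hc
    obtain ⟨r', s', h1', h2', h3'⟩ := (h' c).2 hc
    obtain rfl : r = r' := le_antisymm (h2 r' s' h1') (h2' r s h1)
    have h4 := h1.2.2.2.2
    have h5 := h1'.2.2.2.2
    rw [residue] at h4 h5
    obtain rfl : s = s' := by omega
    rw [h3, h3']
  · rw [(h c).1 hc, (h' c).1 hc]

theorem LadderWeb.Fills.unique (h : L.Fills ℓ lam T) (h' : L'.Fills ℓ lam T')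
    (hw : L'.word = L.word)
    (hM : ∀ k, 1 ≤ k → k ≤ L.word.length → L'.moved ℓ k = L.moved ℓ k) : T = T' := by
  obtain ⟨seq, a1, a2, rfl⟩ := h
  obtain ⟨seq', b1, b2, rfl⟩ := h'
  rw [hw] at b2 ⊢
  have key : ∀ k, k ≤ L.word.length → seq k = seq' k := by
    intro k
    induction k with
    | zero => exact fun _ => a1.trans b1.symm
    | succ k ih =>
      intro hk
      have h1 := a2 (k + 1) (by omega) hk
      have h2 := b2 (k + 1) (by omega) hk
      rw [hM _ (by omega) hk, Nat.add_sub_cancel, ← ih (by omega)] at h2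
      exact h1.unique h2
  exact key _ le_rfl

end Fills

section Iota

variable {n ℓ : ℕ} {S : Fin n → WebSign} {J : Fin n → SignType} {x : BasisWebWithFlow n S J}
  {w : FString} {φ φ' : LDart → SignType}

/-- The colors do not depend on the choice of the drawing. -/
theorem LadderWeb.Draws.colors_eq (h : (⟨w, φ⟩ : LadderWeb).Draws ℓ x)
    (h' : (⟨w, φ'⟩ : LadderWeb).Draws ℓ x) {k : ℕ} (hk : k ≤ w.length) (p : ℕ) :
    LadderWeb.colors ℓ ⟨w, φ⟩ k p = LadderWeb.colors ℓ ⟨w, φ'⟩ k p := by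
  have hv : w.Valid n ℓ := by
    obtain ⟨-, e, D, -⟩ := h
    exact D.valid
  have key : w.label ℓ k p = 1 ∨ w.label ℓ k p = 2 → φ (.vert p k true) = φ' (.vert p k true) := by
    intro hl
    have ht := hv.isThin_iff.2 hl
    exact h.flow_unique h' (FString.present_vert.2 ⟨⟨ht.1.1, ht.1.2, hk⟩, hl⟩)
  change colorsOf _ _ = colorsOf _ _
  simp only [colorsOf]
  split_ifs with h1 h2
  · rw [key (Or.inl h1)]
  · rw [key (Or.inr h2)]
  · rfl
  · rfl

/-- The colors along the cut line are those of the boundary data. -/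
theorem LadderWeb.Draws.mem_colors_length_iff (hS : signWeight S = 3 * ℓ)
    (h : (⟨w, φ⟩ : LadderWeb).Draws ℓ x) (c : Fin 3) (p : ℕ) :
    c ∈ LadderWeb.colors ℓ ⟨w, φ⟩ w.length p ↔ p ∈ column S J c := by
  obtain ⟨hf, e, D, he⟩ := h
  rw [mem_column]
  by_cases hp : 1 ≤ p ∧ p ≤ n
  · obtain ⟨q, rfl⟩ : ∃ q : Fin n, p = q + 1 := ⟨⟨p - 1, by omega⟩, by simp; omega⟩
    have hcol : LadderWeb.colors ℓ ⟨w, φ⟩ w.length (q + 1) = stateColumns (S q) (J q) := by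
      have h1 := D.present (x.web.bd q)
      have h2 := D.out (x.web.bd q)
      have h3 := x.hasBoundary q
      have h4 := he (x.web.bd q)
      rw [D.bd] at h1 h2 h4
      rw [x.extends_state] at h4
      change φ _ = _ at h4
      have hl := (FString.present_vert.1 h1).2
      have hout : FString.out ℓ w (.vert (q + 1) w.length true) =
          !decide (w.label ℓ w.length (q + 1) = 1) := by
        rw [FString.out, Bool.true_xor]; rfl
      rw [h2, hout] at h3
      change colorsOf (w.label ℓ w.length (q + 1)) (φ (.vert (q + 1) w.length true)) = _
      rw [h4]
      rcases hl with hl | hl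
      · have : S q = .plus := h3.1 (by simp [hl])
        rw [this, hl]; rfl
      · have : S q = .minus := by
          cases hs : S q
          · have := h3.2 hs
            simp [hl] at this
          · rfl
        rw [this, hl]; rfl
    rw [hcol]
    constructor
    · exact fun hc => ⟨q, hc, rfl⟩
    · rintro ⟨q', hq', h'⟩
      obtain rfl : q' = q := Fin.ext (by omega)
      exact hq'
  · have hl : w.label ℓ w.length p = 0 := by
      have := le_of_signWeight_eq hS
      rw [D.valid.label_of_lt hp, FString.label_zero, if_neg (by omega)]
    have hcol : LadderWeb.colors ℓ ⟨w, φ⟩ w.length p = ∅ := by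
      change colorsOf (w.label ℓ w.length p) _ = _
      rw [hl]; rfl
    rw [hcol]
    simp only [Finset.notMem_empty, false_iff]
    rintro ⟨q, -, hq⟩
    have := q.2
    omega

/-- The colors of a web with flow move along the rungs like beads, and they end up at the entries of
the columns. -/
theorem LadderWeb.Draws.exists_beadChain (hS : signWeight S = 3 * ℓ)
    (h : (⟨w, φ⟩ : LadderWeb).Draws ℓ x) :
    ∃ M μ, BeadChain ℓ w.length (fun k => (w.step k).1) M μ ∧
      (∀ k, k ≤ w.length → ∀ p, LadderWeb.colors ℓ ⟨w, φ⟩ k p = beadColors ℓ (μ k) p) ∧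
      (∀ k, k < w.length → LadderWeb.moved ℓ ⟨w, φ⟩ (k + 1) = M (k + 1) ∧
        (M (k + 1)).card = (w.step (k + 1)).2 ∧
        M (k + 1) = colorsOf (w.step (k + 1)).2 (φ (.rung (k + 1) true))) ∧
      HasTableau ℓ S J ∧ μ w.length = shape ℓ S J := by
  have hv : w.Valid n ℓ := by
    obtain ⟨-, e, D, -⟩ := h
    exact D.valid
  have hC := ((FString.isFlow_iff_conserves hv).1 h.1).2
  obtain ⟨μ, hc, hμ⟩ := hC.exists_beadChain (ℓ := ℓ) fun p => by
    rw [FString.label_zero]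
    split_ifs <;> rfl
  have hshape := hasTableau_and_eq_shape (S := S) (J := J) (m := μ w.length)
    (fun c => hc.isPart le_rfl c) fun c p => by
      rw [← mem_beadColors, ← hμ _ le_rfl, ← h.mem_colors_length_iff hS]
      rfl
  refine ⟨_, μ, hc, hμ, fun k hk => ⟨?_, ?_, rfl⟩, hshape⟩
  · obtain ⟨⟨c1, c2⟩, -, -⟩ := hC k hk
    rw [LadderWeb.moved, Nat.add_sub_cancel]
    refine (congrArg (· \ _) c2).trans ?_
    exact Finset.union_sdiff_cancel_left c1
  · have h1 := FString.label_succ ℓ w hk (w.step (k + 1)).1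
    rw [if_pos rfl] at h1
    have h2 := (hv.2 (k + 1) (w.step (k + 1)).1).1
    have h3 := (hv.2 k (w.step (k + 1)).1).2
    have := card_colorsOf (a := (w.step (k + 1)).2) (by omega) (by omega) (φ (.rung (k + 1) true))
    exact_mod_cast this

/-- The tableau of a drawing with flow does not depend on choices. -/
theorem IsIota.unique {T T' : MultiFilling} (h : IsIota ℓ w x T) (h' : IsIota ℓ w x T') :
    T = T' := by
  obtain ⟨φ, h1, h2⟩ := h
  obtain ⟨φ', h1', h2'⟩ := h'
  refine h2.unique h2' rfl fun k hk hk' => ?_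
  rw [LadderWeb.moved, LadderWeb.moved]
  dsimp only at hk' ⊢
  rw [h1'.colors_eq h1 (k := k - 1) (by omega), h1'.colors_eq h1 hk']

theorem Records.rowCount_eq {K : ℕ} {μ : ℕ → Fin 3 → ℕ → ℕ} {T : MultiFilling}
    (h : Records K μ T) {k : ℕ} (hk : k ≤ K) : rowCount T k = μ k := by
  funext c r
  rw [rowCount, show {s | T c r s ≠ 0 ∧ T c r s ≤ k} = (Finset.range (μ k c r) : Set ℕ) by
    ext s
    rw [Finset.coe_range, Set.mem_Iio, h.lt_iff k hk]
    rfl, Set.ncard_coe_finset, Finset.card_range]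

/-- If no step is empty, then every number up to `K` occurs as an entry. -/
theorem Records.maxEntry_eq {K : ℕ} {i : ℕ → ℕ} {M : ℕ → Finset (Fin 3)}
    {μ : ℕ → Fin 3 → ℕ → ℕ} {T : MultiFilling} (h : Records K μ T) (hc : BeadChain ℓ K i M μ)
    (hM : ∀ k, k < K → M (k + 1) ≠ ∅) : maxEntry T = K := by
  have hle : ∀ k ∈ {k | ∃ c r s, T c r s = k}, k ≤ K := by
    rintro _ ⟨c, r, s, rfl⟩; exact h.le c r s
  refine le_antisymm (csSup_le ⟨_, 0, 0, 0, rfl⟩ hle) ?_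
  rcases Nat.eq_zero_or_pos K with rfl | hK
  · exact Nat.zero_le _
  · obtain ⟨k, rfl⟩ : ∃ k, K = k + 1 := ⟨K - 1, by omega⟩
    obtain ⟨c, hcM⟩ := Finset.nonempty_iff_ne_empty.2 (hM k (by omega))
    obtain ⟨r, h1, h2, -, -⟩ := hc.of_mem k (by omega) c hcM
    exact le_csSup ⟨_, hle⟩ ⟨c, r, μ k c r, (h.eq_succ_iff hc (by omega)).2 ⟨hcM, h2, h1, rfl⟩⟩

/-- The tableau of a web with flow, and its properties. -/
theorem exists_isIota (hS : signWeight S = 3 * ℓ) (hw : w.Presents ℓ x.web) :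
    HasTableau ℓ S J ∧ ∃ T, IsIota ℓ w x T ∧ IsStandard (shape ℓ S J) T ∧
      (growth ℓ T).word = w ∧ (growth ℓ T).Draws ℓ x ∧
      ∀ T', IsStandard (shape ℓ S J) T' → (growth ℓ T').word = w → (growth ℓ T').Draws ℓ x →
        T' = T := by
  obtain ⟨hpos, e, D⟩ := hw
  obtain ⟨φ, hφ, hφe⟩ := D.exists_isFlow x.isFlow
  have hdraw : (⟨w, φ⟩ : LadderWeb).Draws ℓ x := ⟨hφ, e, D, hφe⟩
  obtain ⟨M, μ, hc, hcol, hM, htab, hμ⟩ := hdraw.exists_beadChain hS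
  have hMne : ∀ k, k < w.length → M (k + 1) ≠ ∅ := by
    intro k hk h0
    have h1 := (hM k hk).2.1
    have h2 := hpos _ (FString.step_mem (w := w) (k := k + 1) (by omega) hk)
    rw [h0, Finset.card_empty] at h1
    omega
  -- the tableau records the chain of multipartitions that is given by the colors
  set T := chainFilling w.length μ
  have hR : Records w.length μ T := hc.records
  have hshift : residueShift (μ w.length) = ℓ := by rw [hμ, htab.residueShift_shape]
  have hst : IsStandard (shape ℓ S J) T := hμ ▸ hR.isStandard hc hshift
  have hfill : (⟨w, φ⟩ : LadderWeb).Fills ℓ (shape ℓ S J) T :=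
    hμ ▸ hR.fills (L := ⟨w, φ⟩) hc rfl (fun k hk => (hM k hk).1) hshift
  have hmax : maxEntry T = w.length := hR.maxEntry_eq hc hMne
  have hc' : BeadChain ℓ (maxEntry T) (fun k => (w.step k).1) M (rowCount T) := by
    rw [hmax]
    refine ⟨fun c => ?_, fun k hk c hcM => ?_, fun k hk c hcM => ?_⟩
    · rw [hR.rowCount_eq (Nat.zero_le _), hc.zero]
    · rw [hR.rowCount_eq hk, hR.rowCount_eq (by omega), hc.of_notMem k hk c hcM]
    · rw [hR.rowCount_eq hk, hR.rowCount_eq (by omega)]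
      exact hc.of_mem k hk c hcM
  have h0 : ∀ k, k < maxEntry T → M (k + 1) = ∅ → (w.step (k + 1)).1 = 0 := fun k hk h =>
    absurd h (hMne k (hmax ▸ hk))
  have hword : (growth ℓ T).word = w := by
    rw [growth_word hc' h0, hmax]
    refine List.ext_getElem (by simp) fun k h1 h2 => ?_
    simp only [List.getElem_map, List.getElem_range, (hM k h2).2.1]
    simp [FString.step, List.getD_eq_getElem?_getD, h2]
  -- the flow of the growth algorithm is the given one
  have hflow : ∀ z, w.present n ℓ z = true → (growth ℓ T).flow z = φ z := by
    have hvert : ∀ p k, w.present n ℓ (.vert p k true) = true →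
        (growth ℓ T).flow (.vert p k true) = φ (.vert p k true) := by
      intro p k hz
      obtain ⟨⟨h1, -, h2⟩, h3⟩ := FString.present_vert.1 hz
      rw [growth_flow_vert hc' (hmax ▸ h2) h1, hR.rowCount_eq h2, ← hcol k h2]
      exact stateOf_colorsOf h3 _
    have hrung : ∀ k, w.present n ℓ (.rung k true) = true →
        (growth ℓ T).flow (.rung k true) = φ (.rung k true) := by
      intro k hz
      obtain ⟨⟨h1, h2⟩, h3⟩ := FString.present_rung.1 hz
      obtain ⟨k, rfl⟩ : ∃ k', k = k' + 1 := ⟨k - 1, by omega⟩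
      obtain ⟨-, h4, h5⟩ := hM k h2
      rw [growth_flow_rung hc' h0 (hmax ▸ h2) (by rw [h4]; exact h3), h5]
      exact stateOf_colorsOf (by exact_mod_cast h3) _
    intro z hz
    match z with
    | .vert p k true => exact hvert p k hz
    | .vert p k false =>
      have h1 := (hφ _ (show w.present n ℓ (.vert p k true) = true from hz)).1
      exact (congrArg (- ·) (hvert p k hz)).trans h1.symm
    | .rung k true => exact hrung k hz
    | .rung k false =>
      have h1 := (hφ _ (show w.present n ℓ (.rung k true) = true from hz)).1
      exact (congrArg (- ·) (hrung k hz)).trans h1.symm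
  have hgdraw : (growth ℓ T).Draws ℓ x := by
    have h1 := growth_isFlow (n := n) hc' h0 (by rw [hword]; exact D.valid)
    exact ⟨h1, e, by rw [hword]; exact D, fun d => (hflow _ (D.present d)).trans (hφe d)⟩
  refine ⟨htab, T, ⟨φ, hdraw, hfill⟩, hst, hword, hgdraw, fun T' hT' hw' hd' => ?_⟩
  -- a tableau with the same word and the same colors gives the same chain of multipartitions
  obtain ⟨i', M', hc₁, h₁⟩ := hT'.exists_beadChain htab.isPart htab.residueShift_shape
  have hmax' : maxEntry T' = w.length := by
    rw [← hw', growth_word_length hc₁ fun k _ => h₁ k]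
  have hR' := hT'.records htab.isPart
  rw [hmax'] at hR'
  have heq : ∀ k, k ≤ w.length → rowCount T' k = μ k := by
    intro k hk
    funext c
    refine (hc₁.isPart (hmax' ▸ hk) c).ext (hc.isPart hk c) fun p => ?_
    rw [← mem_beadColors, ← mem_beadColors, ← hcol k hk,
      ← growth_colorsOf_vert hc₁ (fun k _ => h₁ k) (hmax' ▸ hk), hw']
    have hd₁ : (⟨w, (growth ℓ T').flow⟩ : LadderWeb).Draws ℓ x := by
      rw [← hw']; exact hd'
    rw [← hd₁.colors_eq hdraw hk]
    rfl
  refine Records.ext (K := w.length) (μ := μ) ⟨fun k hk c r s => ?_, hR'.le⟩ hR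
  rw [← heq k hk, hR'.lt_iff k hk]

end Iota

theorem mainTheorem6 (n ℓ : ℕ) (S : Fin n → WebSign) (J : Fin n → SignType)
    (hS : signWeight S = 3 * ℓ) :
    -- the extended growth algorithm is well-defined
    (HasTableau ℓ S J → ∀ T, IsStandard (shape ℓ S J) T →
      (growth ℓ T).IsWebWithFlow ℓ S J ∧ ConnectsTower n ℓ T) ∧
    -- every non-elliptic web can be drawn by a string of divided powers
    (∀ u : Web n, u.NonElliptic → u.HasBoundary S → ∃ w : FString, w.Presents ℓ u) ∧
    -- for every such drawing, `ι` is well-defined and `g ∘ ι = id`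
    (∀ (x : BasisWebWithFlow n S J) (w : FString), w.Presents ℓ x.web →
      HasTableau ℓ S J ∧ (∃! T, IsIota ℓ w x T) ∧
      ∀ T, IsIota ℓ w x T →
        IsStandard (shape ℓ S J) T ∧ (growth ℓ T).word = w ∧ (growth ℓ T).Draws ℓ x ∧
        ∀ T', IsStandard (shape ℓ S J) T' → (growth ℓ T').word = w → (growth ℓ T').Draws ℓ x →
          T' = T) ∧
    -- `ι` is an injection of the isotopy classes of non-elliptic webs with flow
    (∀ (x y : BasisWebWithFlow n S J) (w w' : FString) (T T' : MultiFilling),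
      w.Presents ℓ x.web → w'.Presents ℓ y.web → IsIota ℓ w x T → IsIota ℓ w' y T' →
        (T = T' → x.Isotopic y ∧ w = w') ∧ (x.Isotopic y → w = w' → T = T')) := by
  refine ⟨fun h T hT => growth_isWebWithFlow h hT, fun u hu hb => FString.exists_presents hS hu hb,
    fun x w hw => ?_, fun x y w w' T T' hw hw' hT hT' => ⟨?_, ?_⟩⟩
  · obtain ⟨htab, T, hT, h⟩ := exists_isIota hS hw
    refine ⟨htab, ⟨T, hT, fun T' hT' => hT'.unique hT⟩, fun T' hT' => ?_⟩
    obtain rfl := hT'.unique hT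
    exact h
  · rintro rfl
    obtain ⟨-, T₁, hT₁, -, hw₁, hd₁, -⟩ := exists_isIota hS hw
    obtain ⟨-, T₂, hT₂, -, hw₂, hd₂, -⟩ := exists_isIota hS hw'
    obtain rfl := hT₁.unique hT
    obtain rfl := hT₂.unique hT'
    exact ⟨hd₁.isotopic hd₂, hw₁.symm.trans hw₂⟩
  · rintro hxy rfl
    obtain ⟨φ, hd, hf⟩ := hT'
    exact hT.unique ⟨φ, hd.of_isotopic hxy, hf⟩
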